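/- **Setting.** A *Sasakian space form* $M^3(c)$ is a complete connected Riemannian $3$-manifold $(M,g)$ with a contact form $\eta$, Reeb vector field $\xi$ and endomorphism field $\varphi$ such that $$\varphi^2=-I+\eta\otimes\xi,\quad g(\varphi X,\varphi Y)=g(X,Y)-\eta(X)\eta(Y),\quad g(\xi,\cdot)=\eta,\quad d\eta(X,Y)=2g(X,\varphi Y),$$ $$(\nabla_X\varphi)Y=g(X,Y)\xi-\eta(Y)X ,$$ and such that every $\varphi$-invariant tangent plane has sectional curvature $c$. It is *regular* if $\xi$ is complete and the orbit space $\bar M$ of its flow is a smooth Riemannian surface for which the projection $\pi:M\to\bar M$ (the Boothby–Wang fibration) is a Riemannian submersion. For a smooth curve $\bar\gamma:J\to\bar M$ parametrised by arc length on an open interval $J$, the *Hopf cylinder* over $\bar\gamma$ is the surface $S_{\bar\gamma}=\pi^{-1}(\bar\gamma)=\{(s,p)\in J\times M:\pi(p)=\bar\gamma(s)\}$, isometrically immersed in $M$ by $\iota(s,p)=p$. It is *polyharmonic* (biharmonic) if the bitension field of $\iota$ vanishes, i.e. $\mathcal J_\iota(\mathscr T(\iota))=0$, where $\mathscr T(\iota)=\operatorname{tr}(\nabla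 d\iota)$ and, for a local orthonormal frame $(e_i)$ of $S_{\bar\gamma}$, $$\mathcal J_\iota(V)=-\sum_i\bigl(\nabla^\iota_{e_i}\nabla^\iota_{e_i}V-\nabla^\iota_{\nabla_{e_i}e_i}V\bigr)-\sum_i R(V,d\iota(e_i))\,d\iota(e_i).$$ **Statement.** Let $M^3(c)$ be a regular $3$-dimensional Sasakian space form with Boothby–Wang fibration $\pi:M\to\bar M$, and let the Hopf cylinder $\iota:S_{\bar\gamma}\to M^3(c)$ be polyharmonic. 1. If $c\le 1$, then $\bar\gamma$ is a geodesic of $\bar M$. 2. If $c>1$, then $\bar\gamma$ is a geodesic of $\bar M$ or a Riemannian circle of curvature $\sqrt{c-1}$, i.e. there is a unit normal field $n$ along $\bar\gamma$ with $\bar\nabla_{\bar\gamma'}\bar\gamma'=\sqrt{c-1}\,n$ and $\bar\nabla_{\bar\gamma'}n=-\sqrt{c-1}\,\bar\gamma'$. Moreover, for every $c>1$ regular Sasakian space forms $M^3(c)$ exist, and each of them contains a polyharmonic Hopf cylinder that is neither minimal nor totally umbilical. -/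

import Mathlib

open Bundle Manifold
open scoped ContDiff Topology

noncomputable section

namespace HopfCyl

/-! ### Riemannian geometry on boundaryless manifolds modelled on a vector space -/

section Riemannian

variable {E : Type*} [NormedAddCommGroup E] [NormedSpace ℝ E]
  {M : Type*} [TopologicalSpace M] [ChartedSpace E M] [IsManifold 𝓘(ℝ, E) ∞ M]
  {E' : Type*} [NormedAddCommGroup E'] [NormedSpace ℝ E']
  {N : Type*} [TopologicalSpace N] [ChartedSpace E' N] [IsManifold 𝓘(ℝ, E') ∞ N]

variable (E M) in
/-- Smooth Riemannian metrics on `M`. -/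
abbrev RMetric : Type _ :=
  ContMDiffRiemannianMetric 𝓘(ℝ, E) ∞ E (fun x : M ↦ TangentSpace 𝓘(ℝ, E) x)

variable (E M) in
/-- Fields of bilinear forms on the tangent spaces of `M` (no regularity required). -/
abbrev BilinField : Type _ :=
  ∀ x : M, TangentSpace 𝓘(ℝ, E) x →L[ℝ] TangentSpace 𝓘(ℝ, E) x →L[ℝ] ℝ

/-- The vector field near `q` that has constant components in the chart at `q`
and takes the value `v` at `q`. -/
def coordField {q : M} (v : TangentSpace 𝓘(ℝ, E) q) (y : M) : TangentSpace 𝓘(ℝ, E) y :=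
  FiberBundle.extend E v y

/-- The components of a tangent vector `v` at `y` in the chart at `q`. -/
def components (q : M) {y : M} (v : TangentSpace 𝓘(ℝ, E) y) : E :=
  (trivializationAt E (fun x : M ↦ TangentSpace 𝓘(ℝ, E) x) q ⟨y, v⟩).2

/-- The value of `g` at `y`, as a bilinear form on the model space. -/
def formAt (g : BilinField E M) (y : M) : E →L[ℝ] E →L[ℝ] ℝ := g y

/-- The coordinate frame at `y` of the chart at `q`, as a map from the model space to the tangent
space at `y`. -/
def frameAt (q y : M) : E →L[ℝ] E :=
  (trivializationAt E (fun x : M ↦ TangentSpace 𝓘(ℝ, E) x) q).symmL ℝ y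

/-- The components `g_{ab}` of `g` at points `y` in the chart at `q`, as a bilinear form on the
model space. -/
def metricComponents (g : BilinField E M) (q y : M) : E →L[ℝ] E →L[ℝ] ℝ :=
  (formAt g y).bilinearComp (frameAt q y) (frameAt q y)

/-- Partial derivatives at `q` of the components of `g` in the chart at `q`:
`metricDeriv g q u v w` is `u^a v^b w^c ∂_a g_{bc}`. -/
def metricDeriv (g : BilinField E M) (q : M) : E →L[ℝ] E →L[ℝ] E →L[ℝ] ℝ :=
  mfderiv 𝓘(ℝ, E) 𝓘(ℝ, E →L[ℝ] E →L[ℝ] ℝ) (metricComponents g q) q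

/-- Christoffel symbols of the first kind at `q` in the chart at `q`:
`w ↦ (1/2) u^a v^b w^c (∂_a g_{bc} + ∂_b g_{ac} - ∂_c g_{ab})`. -/
def christoffelFirst (g : BilinField E M) (q : M) (u v : E) : E →L[ℝ] ℝ :=
  (1 / 2 : ℝ) • (metricDeriv g q u v + metricDeriv g q v u - ((metricDeriv g q).flip u).flip v)

/-- Christoffel symbols of the second kind at `q` in the chart at `q`: the vector
`Γ^c_{ab} u^a v^b`, obtained by raising the index with the inverse of `g`. -/
def christoffel (g : BilinField E M) (q : M) (u v : TangentSpace 𝓘(ℝ, E) q) :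
    TangentSpace 𝓘(ℝ, E) q :=
  (formAt g q).inverse (christoffelFirst g q u v)

/-- The differential of a map `f : N → M` at `x`. -/
abbrev diff (f : N → M) (x : N) :
    TangentSpace 𝓘(ℝ, E') x →L[ℝ] TangentSpace 𝓘(ℝ, E) (f x) :=
  mfderiv 𝓘(ℝ, E') 𝓘(ℝ, E) f x

/-- The differential of `f` at `x`, as a map between the model spaces. -/
def diffModel (f : N → M) (x : N) : E' →L[ℝ] E := mfderiv 𝓘(ℝ, E') 𝓘(ℝ, E) f x

/-- The covariant derivative `∇^f_v V` at `x`, for the connection on `f^* TM` induced by the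
Levi-Civita connection of `(M, g)`; here `V` is a vector field along `f : N → M`.
In the chart at `f x` its components are `v(V^c) + Γ^c_{ab} df(v)^a V^b`. -/
def covAlong (g : BilinField E M) (f : N → M) (V : ∀ y : N, TangentSpace 𝓘(ℝ, E) (f y))
    (x : N) (v : TangentSpace 𝓘(ℝ, E') x) : TangentSpace 𝓘(ℝ, E) (f x) :=
  let w : TangentSpace 𝓘(ℝ, E) (f x) :=
    diffModel (E := E) (E' := E') (fun y ↦ components (f x) (V y)) x v
  w + christoffel g (f x) (diff f x v) (V x)

/-- The Levi-Civita covariant derivative `∇_v Y` at `p` of a vector field `Y` on `(M, g)`. -/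
def cov (g : BilinField E M) (Y : ∀ y : M, TangentSpace 𝓘(ℝ, E) y) (p : M)
    (v : TangentSpace 𝓘(ℝ, E) p) : TangentSpace 𝓘(ℝ, E) p :=
  covAlong g (fun y : M ↦ y) Y p v

/-- `R(X, Y) Z = ∇_X ∇_Y Z - ∇_Y ∇_X Z - ∇_{[X, Y]} Z` for vector fields. -/
def curvatureField (g : BilinField E M) (X Y Z : ∀ y : M, TangentSpace 𝓘(ℝ, E) y) (p : M) :
    TangentSpace 𝓘(ℝ, E) p :=
  cov g (fun y ↦ cov g Z y (Y y)) p (X p) - cov g (fun y ↦ cov g Z y (X y)) p (Y p) -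
    cov g Z p (VectorField.mlieBracket 𝓘(ℝ, E) X Y p)

/-- The Riemannian curvature tensor `R(u, v) w` at `p`. -/
def curvature (g : BilinField E M) (p : M) (u v w : TangentSpace 𝓘(ℝ, E) p) :
    TangentSpace 𝓘(ℝ, E) p :=
  curvatureField g (coordField u) (coordField v) (coordField w) p

/-- The sectional curvature of the plane spanned by `u` and `v`. -/
def sectionalCurvature (g : BilinField E M) (p : M) (u v : TangentSpace 𝓘(ℝ, E) p) : ℝ :=
  g p (curvature g p u v v) u / (g p u u * g p v v - g p u v ^ 2)

/-- The exterior derivative of a one-form,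
`dη(X, Y) = X (η(Y)) - Y (η(X)) - η([X, Y])`. -/
def extDerivOne (η : ∀ y : M, TangentSpace 𝓘(ℝ, E) y →L[ℝ] ℝ) (p : M)
    (u v : TangentSpace 𝓘(ℝ, E) p) : ℝ :=
  (show ℝ from mfderiv 𝓘(ℝ, E) 𝓘(ℝ, ℝ) (fun y ↦ η y (coordField v y)) p u) -
    (show ℝ from mfderiv 𝓘(ℝ, E) 𝓘(ℝ, ℝ) (fun y ↦ η y (coordField u y)) p v) -
    η p (VectorField.mlieBracket 𝓘(ℝ, E) (coordField u) (coordField v) p)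

/-- The covariant derivative of an endomorphism field,
`(∇_X φ) Y = ∇_X (φ Y) - φ (∇_X Y)`. -/
def covEndo (g : BilinField E M)
    (φ : ∀ y : M, TangentSpace 𝓘(ℝ, E) y →L[ℝ] TangentSpace 𝓘(ℝ, E) y) (p : M)
    (u w : TangentSpace 𝓘(ℝ, E) p) : TangentSpace 𝓘(ℝ, E) p :=
  cov g (fun y ↦ φ y (coordField w y)) p u - φ p (cov g (coordField w) p u)

/-- Completeness of the Riemannian distance: every Cauchy sequence converges. -/
def IsCompleteMetric (g : RMetric E M) : Prop :=
  letI : RiemannianBundle (fun x : M ↦ TangentSpace 𝓘(ℝ, E) x) := ⟨g.toRiemannianMetric⟩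
  ∀ u : ℕ → M,
    (∀ ε > 0, ∃ n₀ : ℕ, ∀ m ≥ n₀, ∀ n ≥ n₀, riemannianEDist 𝓘(ℝ, E) (u m) (u n) < ε) →
      ∃ x : M, Filter.Tendsto u Filter.atTop (𝓝 x)

/-! ### Tension and bitension fields of maps between Riemannian manifolds -/

variable [FiniteDimensional ℝ E']

/-- The trace `∑ h^{ij} B(b_i, b_j)` of a bilinear map with respect to the metric `h`. -/
def metricTrace {W : Type*} [AddCommGroup W] [Module ℝ W] (h : BilinField E' N) (x : N)
    (B : TangentSpace 𝓘(ℝ, E') x → TangentSpace 𝓘(ℝ, E') x → W) : W :=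
  let b := Module.finBasis ℝ E'
  ∑ i, ∑ j, (Matrix.of fun i j ↦ h x (b i) (b j))⁻¹ i j • B (b i) (b j)

/-- The second fundamental form `(∇ df)(X, Y) = ∇^f_X (df(Y)) - df(∇_X Y)` of a map
`f : (N, h) → (M, g)`. -/
def secondFundamentalForm (h : BilinField E' N) (g : BilinField E M) (f : N → M) (x : N)
    (u v : TangentSpace 𝓘(ℝ, E') x) : TangentSpace 𝓘(ℝ, E) (f x) :=
  covAlong g f (fun y ↦ diff f y (coordField v y)) x u - diff f x (cov h (coordField v) x u)

/-- The tension field, `tr (∇ df)`. -/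
def tension (h : BilinField E' N) (g : BilinField E M) (f : N → M) (x : N) :
    TangentSpace 𝓘(ℝ, E) (f x) :=
  metricTrace h x (secondFundamentalForm h g f x)

/-- The rough Laplacian `- tr (∇^f ∇^f V - ∇^f_{∇} V)` of a vector field along `f`. -/
def roughLaplacian (h : BilinField E' N) (g : BilinField E M) (f : N → M)
    (V : ∀ y : N, TangentSpace 𝓘(ℝ, E) (f y)) (x : N) : TangentSpace 𝓘(ℝ, E) (f x) :=
  -metricTrace h x (fun u v ↦
    covAlong g f (fun y ↦ covAlong g f V y (coordField v y)) x u -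
      covAlong g f V x (cov h (coordField v) x u))

/-- The Jacobi operator: the rough Laplacian of `V` minus `tr R(V, df ·) df ·`. -/
def jacobi (h : BilinField E' N) (g : BilinField E M) (f : N → M)
    (V : ∀ y : N, TangentSpace 𝓘(ℝ, E) (f y)) (x : N) : TangentSpace 𝓘(ℝ, E) (f x) :=
  roughLaplacian h g f V x -
    metricTrace h x (fun u v ↦ curvature g (f x) (V x) (diff f x u) (diff f x v))

/-- The bitension field. -/
def bitension (h : BilinField E' N) (g : BilinField E M) (f : N → M) (x : N) :
    TangentSpace 𝓘(ℝ, E) (f x) :=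
  -jacobi h g f (tension h g f) x

/-- The first fundamental form `f^* g`. -/
def inducedMetric (g : BilinField E M) (f : N → M) : BilinField E' N := fun x ↦
  ((formAt g (f x)).bilinearComp (diffModel f x) (diffModel f x) : E' →L[ℝ] E' →L[ℝ] ℝ)

/-! ### Curves -/

/-- The velocity of a curve. -/
def velocity (γ : ℝ → M) (s : ℝ) : TangentSpace 𝓘(ℝ, E) (γ s) :=
  mfderiv 𝓘(ℝ, ℝ) 𝓘(ℝ, E) γ s (1 : ℝ)

/-- The covariant derivative `∇_{γ'} V` of a vector field along a curve. -/
def curveCov (g : BilinField E M) (γ : ℝ → M) (V : ∀ s : ℝ, TangentSpace 𝓘(ℝ, E) (γ s)) (s : ℝ) :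
    TangentSpace 𝓘(ℝ, E) (γ s) :=
  covAlong g γ V s (1 : ℝ)

/-- `γ` is a smooth curve on the open interval `J`, parametrised by arc length. -/
structure IsUnitSpeedCurve (g : RMetric E M) (γ : ℝ → M) (J : Set ℝ) : Prop where
  isOpen : IsOpen J
  ordConnected : J.OrdConnected
  nonempty : J.Nonempty
  smooth : ContMDiffOn 𝓘(ℝ, ℝ) 𝓘(ℝ, E) ∞ γ J
  unit_speed : ∀ s ∈ J, g.inner (γ s) (velocity γ s) (velocity γ s) = 1

/-- `γ` is a geodesic on `J`. -/
def IsGeodesic (g : RMetric E M) (γ : ℝ → M) (J : Set ℝ) : Prop :=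
  ∀ s ∈ J, curveCov g.inner γ (velocity γ) s = 0

/-- The unit speed curve `γ` is a Riemannian circle of curvature `k` on `J`: it has a smooth unit
normal field `n` with the Frenet equations `∇_{γ'} γ' = k n`, `∇_{γ'} n = - k γ'` for the
constant `k > 0`. -/
def IsRiemannianCircle (g : RMetric E M) (γ : ℝ → M) (J : Set ℝ) (k : ℝ) : Prop :=
  0 < k ∧ ∃ n : ∀ s : ℝ, TangentSpace 𝓘(ℝ, E) (γ s),
    ContMDiffOn 𝓘(ℝ, ℝ) (𝓘(ℝ, E).prod 𝓘(ℝ, E)) ∞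
      (fun s ↦ (⟨γ s, n s⟩ : TangentBundle 𝓘(ℝ, E) M)) J ∧
    ∀ s ∈ J,
      g.inner (γ s) (n s) (n s) = 1 ∧ g.inner (γ s) (n s) (velocity γ s) = 0 ∧
      curveCov g.inner γ (velocity γ) s = k • n s ∧
      curveCov g.inner γ n s = -(k • velocity γ s)

end Riemannian

/-! ### Three-dimensional Sasakian space forms and their Boothby-Wang fibrations -/

/-- Euclidean `n`-space. -/
abbrev Euc (n : ℕ) : Type := EuclideanSpace ℝ (Fin n)

section Sasaki

variable {M : Type*} [TopologicalSpace M] [ChartedSpace (Euc 3) M]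
  [IsManifold 𝓘(ℝ, Euc 3) ∞ M]
  {B : Type*} [TopologicalSpace B] [ChartedSpace (Euc 2) B] [IsManifold 𝓘(ℝ, Euc 2) ∞ B]

/-- `(η, ξ, φ, g)` is a Sasaki structure on the `3`-manifold `M`. -/
structure IsSasaki (g : RMetric (Euc 3) M)
    (η : ∀ x : M, TangentSpace 𝓘(ℝ, Euc 3) x →L[ℝ] ℝ)
    (ξ : ∀ x : M, TangentSpace 𝓘(ℝ, Euc 3) x)
    (φ : ∀ x : M, TangentSpace 𝓘(ℝ, Euc 3) x →L[ℝ] TangentSpace 𝓘(ℝ, Euc 3) x) : Prop where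
  smooth_eta : ContMDiff 𝓘(ℝ, Euc 3) (𝓘(ℝ, Euc 3).prod 𝓘(ℝ, Euc 3 →L[ℝ] ℝ)) ∞
    (fun x ↦ TotalSpace.mk' (Euc 3 →L[ℝ] ℝ)
      (E := fun x : M ↦ TangentSpace 𝓘(ℝ, Euc 3) x →L[ℝ] Bundle.Trivial M ℝ x) x (η x))
  smooth_xi : ContMDiff 𝓘(ℝ, Euc 3) (𝓘(ℝ, Euc 3).prod 𝓘(ℝ, Euc 3)) ∞
    (fun x ↦ (⟨x, ξ x⟩ : TangentBundle 𝓘(ℝ, Euc 3) M))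
  smooth_phi : ContMDiff 𝓘(ℝ, Euc 3) (𝓘(ℝ, Euc 3).prod 𝓘(ℝ, Euc 3 →L[ℝ] Euc 3)) ∞
    (fun x ↦ TotalSpace.mk' (Euc 3 →L[ℝ] Euc 3)
      (E := fun x : M ↦ TangentSpace 𝓘(ℝ, Euc 3) x →L[ℝ] TangentSpace 𝓘(ℝ, Euc 3) x) x (φ x))
  /-- `η` is a contact form: `dη ∧ η` has no zero. -/
  contact : ∀ x, ∃ u v w : TangentSpace 𝓘(ℝ, Euc 3) x,
    extDerivOne η x u v * η x w + extDerivOne η x v w * η x u + extDerivOne η x w u * η x v ≠ 0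
  /-- `ξ` is the Reeb vector field. -/
  eta_xi : ∀ x, η x (ξ x) = 1
  deta_xi : ∀ x u, extDerivOne η x (ξ x) u = 0
  phi_sq : ∀ x u, φ x (φ x u) = -u + η x u • ξ x
  compatible : ∀ x u v, g.inner x (φ x u) (φ x v) = g.inner x u v - η x u * η x v
  metric_xi : ∀ x u, g.inner x (ξ x) u = η x u
  associated : ∀ x u v, extDerivOne η x u v = 2 * g.inner x u (φ x v)
  sasaki : ∀ x u v, covEndo g.inner φ x u v = g.inner x u v • ξ x - η x v • u

/-- `M` is a `3`-dimensional Sasakian space form `M^3(c)`: a complete connected Sasaki manifold,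
all of whose `φ`-invariant tangent planes have sectional curvature `c`. -/
structure IsSasakianSpaceForm (g : RMetric (Euc 3) M)
    (η : ∀ x : M, TangentSpace 𝓘(ℝ, Euc 3) x →L[ℝ] ℝ)
    (ξ : ∀ x : M, TangentSpace 𝓘(ℝ, Euc 3) x)
    (φ : ∀ x : M, TangentSpace 𝓘(ℝ, Euc 3) x →L[ℝ] TangentSpace 𝓘(ℝ, Euc 3) x) (c : ℝ) :
    Prop where
  connected : ConnectedSpace M
  complete : IsCompleteMetric g
  isSasaki : IsSasaki g η ξ φ
  holomorphic : ∀ (x : M) (u v : TangentSpace 𝓘(ℝ, Euc 3) x), LinearIndependent ℝ ![u, v] →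
    (∀ w ∈ Submodule.span ℝ {u, v}, φ x w ∈ Submodule.span ℝ {u, v}) →
      sectionalCurvature g.inner x u v = c

/-- `pr : M → B` is the Boothby-Wang fibration of a regular contact Riemannian `3`-manifold: the
Reeb field is complete, `B` is its orbit space, and `pr` is a Riemannian submersion, that is, it is
isometric on the contact distribution `ker η`, the orthogonal complement of `ξ`. -/
structure IsBoothbyWang (g : RMetric (Euc 3) M)
    (η : ∀ x : M, TangentSpace 𝓘(ℝ, Euc 3) x →L[ℝ] ℝ)
    (ξ : ∀ x : M, TangentSpace 𝓘(ℝ, Euc 3) x)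
    (gB : RMetric (Euc 2) B) (pr : M → B) : Prop where
  smooth : ContMDiff 𝓘(ℝ, Euc 3) 𝓘(ℝ, Euc 2) ∞ pr
  surjective : Function.Surjective pr
  submersion : ∀ x, Function.Surjective (diff (E' := Euc 3) (E := Euc 2) pr x)
  /-- The fibres are the orbits of the flow of `ξ`. -/
  fibre : ∀ p q, pr p = pr q ↔
    ∃ α : ℝ → M, IsMIntegralCurve (I := 𝓘(ℝ, Euc 3)) α ξ ∧ α 0 = p ∧ ∃ t, α t = q
  isometric : ∀ x u v, η x u = 0 → η x v = 0 →
    gB.inner (pr x) (diff (E' := Euc 3) (E := Euc 2) pr x u) (diff (E' := Euc 3) (E := Euc 2) pr x v) = g.inner x u v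

/-! ### Hopf cylinders -/

/-- The Hopf cylinder `S_γ = pr⁻¹(γ)` over a curve `γ : J → B`, as the pull-back
`{(s, p) : pr p = γ s}`; its immersion `ι` into `M` is `(s, p) ↦ p`. For injective `γ` it is the
inverse image of the trace of `γ`. -/
def hopfCylinder (pr : M → B) (γ : ℝ → B) (J : Set ℝ) : Set (ℝ × M) :=
  {z | z.1 ∈ J ∧ pr z.2 = γ z.1}

/-- `x ↦ (σ x, F x)`, on the open set `U` of the plane `ℝ × ℝ`, is a local parametrisation of the Hopf
cylinder; in this parametrisation the immersion `ι` is `F`. -/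
structure IsHopfPatch (pr : M → B) (γ : ℝ → B) (J : Set ℝ) (U : Set (ℝ × ℝ)) (σ : ℝ × ℝ → ℝ)
    (F : ℝ × ℝ → M) : Prop where
  isOpen : IsOpen U
  smooth_sigma : ContDiffOn ℝ ∞ σ U
  smooth : ContMDiffOn 𝓘(ℝ, ℝ × ℝ) 𝓘(ℝ, Euc 3) ∞ F U
  immersion : ∀ x ∈ U, Function.Injective (diff (E' := ℝ × ℝ) (E := Euc 3) F x)
  mem : ∀ x ∈ U, (σ x, F x) ∈ hopfCylinder pr γ J

/-- The Hopf cylinder is covered by local parametrisations `F` such that `P F x` holds at each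
point `x` of their domain. -/
def HopfLocally (pr : M → B) (γ : ℝ → B) (J : Set ℝ) (P : (ℝ × ℝ → M) → ℝ × ℝ → Prop) : Prop :=
  ∀ z ∈ hopfCylinder pr γ J, ∃ (U : Set (ℝ × ℝ)) (σ : ℝ × ℝ → ℝ) (F : ℝ × ℝ → M),
    IsHopfPatch pr γ J U σ F ∧ (∃ x ∈ U, (σ x, F x) = z) ∧ ∀ x ∈ U, P F x

/-- The Hopf cylinder, with its induced metric, is polyharmonic (of order two): the bitension
field of `ι` vanishes. -/
def IsPolyharmonicHopf (g : RMetric (Euc 3) M) (pr : M → B) (γ : ℝ → B) (J : Set ℝ) : Prop :=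
  HopfLocally pr γ J fun F x ↦ bitension (inducedMetric (E' := ℝ × ℝ) g.inner F) g.inner F x = 0

/-- The Hopf cylinder is minimal: its mean curvature vector, half the tension field of the
isometric immersion `ι`, vanishes. -/
def IsMinimalHopf (g : RMetric (Euc 3) M) (pr : M → B) (γ : ℝ → B) (J : Set ℝ) : Prop :=
  HopfLocally pr γ J fun F x ↦ tension (inducedMetric (E' := ℝ × ℝ) g.inner F) g.inner F x = 0

/-- The Hopf cylinder is totally umbilical: its second fundamental form is the induced metric
times the mean curvature vector. -/
def IsTotallyUmbilicalHopf (g : RMetric (Euc 3) M) (pr : M → B) (γ : ℝ → B) (J : Set ℝ) : Prop :=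
  HopfLocally pr γ J fun F x ↦ ∀ u v : TangentSpace 𝓘(ℝ, ℝ × ℝ) x,
    secondFundamentalForm (inducedMetric (E' := ℝ × ℝ) g.inner F) g.inner F x u v =
      inducedMetric (E' := ℝ × ℝ) g.inner F x u v •
        ((1 / 2 : ℝ) • tension (inducedMetric (E' := ℝ × ℝ) g.inner F) g.inner F x)

/-- Some Hopf cylinder of `pr : M → B` is polyharmonic, but neither minimal nor totally
umbilical. -/
def HasProperPolyharmonicHopf (g : RMetric (Euc 3) M) (gB : RMetric (Euc 2) B) (pr : M → B) : Prop :=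
  ∃ (γ : ℝ → B) (J : Set ℝ), IsUnitSpeedCurve gB γ J ∧ IsPolyharmonicHopf g pr γ J ∧
    ¬ IsMinimalHopf g pr γ J ∧ ¬ IsTotallyUmbilicalHopf g pr γ J

end Sasaki

end HopfCyl

end

open Bundle Manifold
open scoped ContDiff Topology

noncomputable section

namespace HopfCyl

set_option linter.unusedSectionVars false

/-! ### Derivatives of maps into vector spaces: chain and Leibniz rules. -/

section Calculus

variable {E : Type*} [NormedAddCommGroup E] [NormedSpace ℝ E]
  {M : Type*} [TopologicalSpace M] [ChartedSpace E M]
  {E' : Type*} [NormedAddCommGroup E'] [NormedSpace ℝ E']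
  {N : Type*} [TopologicalSpace N] [ChartedSpace E' N]
  {G₁ G₂ G : Type*} [NormedAddCommGroup G₁] [NormedSpace ℝ G₁]
  [NormedAddCommGroup G₂] [NormedSpace ℝ G₂] [NormedAddCommGroup G] [NormedSpace ℝ G]

/-! A Hopf cylinder carries a canonical orthonormal frame: the horizontal lift T of the velocity of
the base curve, and the Reeb field ξ. Its unit normal is N = φT; put k = g(∇_T T, N). The Sasaki
formulas ∇ξ = -φ and (∇_X φ)Y = g(X,Y)ξ - η(Y)X determine all derivatives of the frame: ∇_T T = kN,
∇_T N = -kT + ξ, ∇_T ξ = -N, ∇_ξ T = -N, ∇_ξ N = T, ∇_ξ ξ = 0. Hence the tension field is kN. With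
R(N,T)T = cN and R(N,ξ)ξ = N the bitension field is (TTk + ξξk - k³ + (c-1)k) N + (2ξk - 3k Tk) T +
2(Tk) ξ; this is `AdaptedFrame.bitension_eq`. If it vanishes, then Tk = 0, next ξk = 0, and what
remains is k(k² - (c-1)) = 0.

A Riemannian submersion has no second fundamental form on horizontal vectors, so k² is the squared
geodesic curvature of the base curve (`IsHopfPatch.frameCurv_sq`). This is a continuous function on
an interval with values in {0, c-1}, hence constant, and it is nonnegative. In dimension two,
constant nonzero curvature yields the Frenet equations of a circle (`isRiemannianCircle_of_curvSq`).
The two classification statements follow in `curve_of_polyharmonic`.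

Conversely, an ordinary differential equation provides base curves of curvature √(c-1)
(`exists_curve_of_curvature`), the inverse function theorem provides patches of the cylinder over
them (`exists_hopfPatch`), and the same formula shows that these patches are biharmonic. They are
not minimal since k ≠ 0, and not umbilical since the second fundamental form is -N on the orthogonal
pair T, ξ. The space forms themselves are Berger spheres: a left invariant frame of the
three-sphere, rescaled by a parameter α, has φ-sectional curvature 4α - 3, and the Hopf map is its
Boothby-Wang fibration.

All of this rests on three facts about the connection along a map, which is given by Christoffel
symbols in charts: it is metric (`diff_inner`), torsion free (`covAlong_torsion`), and satisfies a
Leibniz rule for bundle maps (`covAlong_bundleMap`). The last is the source of the tensoriality of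
∇φ, ∇df and the Hessian. -/

lemma diffModel_congr {f f' : N → M} {x : N} (h : f =ᶠ[𝓝 x] f') :
    diffModel (E := E) (E' := E') f x = diffModel (E := E) (E' := E') f' x := by
  unfold diffModel
  exact h.mfderiv_eq

lemma diffModel_comp {f : M → G} {F : N → M} {x : N}
    (hf : MDifferentiableAt 𝓘(ℝ, E) 𝓘(ℝ, G) f (F x))
    (hF : MDifferentiableAt 𝓘(ℝ, E') 𝓘(ℝ, E) F x) (v : E') :
    diffModel (E := G) (E' := E') (fun y ↦ f (F y)) x v =
      diffModel (E := G) (E' := E) f (F x) (diffModel (E := E) (E' := E') F x v) := by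
  have := mfderiv_comp x hf hF
  unfold diffModel
  change mfderiv 𝓘(ℝ, E') 𝓘(ℝ, G) (f ∘ F) x v = _
  rw [this]; rfl

lemma diffModel_comp' {E'' : Type*} [NormedAddCommGroup E''] [NormedSpace ℝ E'']
    {M' : Type*} [TopologicalSpace M'] [ChartedSpace E'' M'] {f : M → M'} {F : N → M} {x : N}
    (hf : MDifferentiableAt 𝓘(ℝ, E) 𝓘(ℝ, E'') f (F x))
    (hF : MDifferentiableAt 𝓘(ℝ, E') 𝓘(ℝ, E) F x) (v : E') :
    diffModel (E := E'') (E' := E') (fun y ↦ f (F y)) x v =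
      diffModel (E := E'') (E' := E) f (F x) (diffModel (E := E) (E' := E') F x v) := by
  have := mfderiv_comp x hf hF
  unfold diffModel
  change mfderiv 𝓘(ℝ, E') 𝓘(ℝ, E'') (f ∘ F) x v = _
  rw [this]; rfl

lemma diffModel_eq_fderiv (f : G₁ → G₂) (x : G₁) :
    diffModel (E := G₂) (E' := G₁) f x = fderiv ℝ f x := by
  unfold diffModel
  exact mfderiv_eq_fderiv

lemma diffModel_clm (L : G₁ →L[ℝ] G) {f : N → G₁} {x : N}
    (hf : MDifferentiableAt 𝓘(ℝ, E') 𝓘(ℝ, G₁) f x) (v : E') :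
    diffModel (E := G) (E' := E') (fun y ↦ L (f y)) x v =
      L (diffModel (E := G₁) (E' := E') f x v) := by
  rw [diffModel_comp (f := L) L.differentiableAt.mdifferentiableAt hf, diffModel_eq_fderiv,
    L.fderiv]

lemma diffModel_prodMk {f : N → G₁} {h : N → G₂} {x : N}
    (hf : MDifferentiableAt 𝓘(ℝ, E') 𝓘(ℝ, G₁) f x)
    (hh : MDifferentiableAt 𝓘(ℝ, E') 𝓘(ℝ, G₂) h x) (v : E') :
    diffModel (E := G₁ × G₂) (E' := E') (fun y ↦ (f y, h y)) x v =
      (diffModel (E := G₁) (E' := E') f x v, diffModel (E := G₂) (E' := E') h x v) := by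
  have hp := hf.prodMk_space hh
  refine Prod.ext ?_ ?_
  · exact (diffModel_clm (ContinuousLinearMap.fst ℝ G₁ G₂) hp v).symm
  · exact (diffModel_clm (ContinuousLinearMap.snd ℝ G₁ G₂) hp v).symm

lemma mdifferentiableAt_bilin (B : G₁ →L[ℝ] G₂ →L[ℝ] G) {f : N → G₁} {h : N → G₂} {x : N}
    (hf : MDifferentiableAt 𝓘(ℝ, E') 𝓘(ℝ, G₁) f x)
    (hh : MDifferentiableAt 𝓘(ℝ, E') 𝓘(ℝ, G₂) h x) :
    MDifferentiableAt 𝓘(ℝ, E') 𝓘(ℝ, G) (fun y ↦ B (f y) (h y)) x :=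
  MDifferentiableAt.comp x (g := fun p : G₁ × G₂ ↦ B p.1 p.2)
    (B.isBoundedBilinearMap.differentiableAt _).mdifferentiableAt (hf.prodMk_space hh)

lemma diffModel_bilin (B : G₁ →L[ℝ] G₂ →L[ℝ] G) {f : N → G₁} {h : N → G₂} {x : N}
    (hf : MDifferentiableAt 𝓘(ℝ, E') 𝓘(ℝ, G₁) f x)
    (hh : MDifferentiableAt 𝓘(ℝ, E') 𝓘(ℝ, G₂) h x) (v : E') :
    diffModel (E := G) (E' := E') (fun y ↦ B (f y) (h y)) x v =
      B (diffModel (E := G₁) (E' := E') f x v) (h x) +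
        B (f x) (diffModel (E := G₂) (E' := E') h x v) := by
  have h1 : DifferentiableAt ℝ (fun p : G₁ × G₂ ↦ B p.1 p.2) (f x, h x) :=
    B.isBoundedBilinearMap.differentiableAt _
  have := diffModel_comp (f := fun p : G₁ × G₂ ↦ B p.1 p.2) (F := fun y ↦ (f y, h y)) (x := x)
    h1.mdifferentiableAt (hf.prodMk_space hh) v
  rw [this, diffModel_prodMk hf hh, diffModel_eq_fderiv, B.isBoundedBilinearMap.fderiv]
  simp [add_comm, IsBoundedBilinearMap.deriv]

lemma diffModel_add {f h : N → G} {x : N}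
    (hf : MDifferentiableAt 𝓘(ℝ, E') 𝓘(ℝ, G) f x)
    (hh : MDifferentiableAt 𝓘(ℝ, E') 𝓘(ℝ, G) h x) (v : E') :
    diffModel (E := G) (E' := E') (fun y ↦ f y + h y) x v =
      diffModel (E := G) (E' := E') f x v + diffModel (E := G) (E' := E') h x v := by
  have := diffModel_clm (ContinuousLinearMap.fst ℝ G G + ContinuousLinearMap.snd ℝ G G)
    (hf.prodMk_space hh) v
  rw [diffModel_prodMk hf hh] at this
  simpa using this

lemma diffModel_const (c : G) (x : N) :
    diffModel (E := G) (E' := E') (fun _ : N ↦ c) x = 0 := by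
  unfold diffModel
  exact mfderiv_const

lemma diffModel_id (x : M) (v : E) : diffModel (E := E) (E' := E) (fun y : M ↦ y) x v = v := by
  unfold diffModel
  change mfderiv 𝓘(ℝ, E) 𝓘(ℝ, E) (@id M) x v = v
  rw [mfderiv_id]; rfl

lemma diffModel_smul {f : N → ℝ} {h : N → G} {x : N}
    (hf : MDifferentiableAt 𝓘(ℝ, E') 𝓘(ℝ, ℝ) f x)
    (hh : MDifferentiableAt 𝓘(ℝ, E') 𝓘(ℝ, G) h x) (v : E') :
    diffModel (E := G) (E' := E') (fun y ↦ f y • h y) x v =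
      diffModel (E := ℝ) (E' := E') f x v • h x + f x • diffModel (E := G) (E' := E') h x v := by
  simpa using diffModel_bilin (ContinuousLinearMap.lsmul ℝ ℝ) hf hh v

lemma diffModel_mul {f h : N → ℝ} {x : N}
    (hf : MDifferentiableAt 𝓘(ℝ, E') 𝓘(ℝ, ℝ) f x)
    (hh : MDifferentiableAt 𝓘(ℝ, E') 𝓘(ℝ, ℝ) h x) (v : E') :
    diffModel (E := ℝ) (E' := E') (fun y ↦ f y * h y) x v =
      diffModel (E := ℝ) (E' := E') f x v * h x + f x * diffModel (E := ℝ) (E' := E') h x v :=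
  diffModel_smul hf hh v

lemma mdifferentiableAt_clm_app {f : N → G₁ →L[ℝ] G} {h : N → G₁} {x : N}
    (hf : MDifferentiableAt 𝓘(ℝ, E') 𝓘(ℝ, G₁ →L[ℝ] G) f x)
    (hh : MDifferentiableAt 𝓘(ℝ, E') 𝓘(ℝ, G₁) h x) :
    MDifferentiableAt 𝓘(ℝ, E') 𝓘(ℝ, G) (fun y ↦ f y (h y)) x :=
  mdifferentiableAt_bilin (ContinuousLinearMap.id ℝ (G₁ →L[ℝ] G)) hf hh

lemma diffModel_clm_app {f : N → G₁ →L[ℝ] G} {h : N → G₁} {x : N}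
    (hf : MDifferentiableAt 𝓘(ℝ, E') 𝓘(ℝ, G₁ →L[ℝ] G) f x)
    (hh : MDifferentiableAt 𝓘(ℝ, E') 𝓘(ℝ, G₁) h x) (v : E') :
    diffModel (E := G) (E' := E') (fun y ↦ f y (h y)) x v =
      diffModel (E := G₁ →L[ℝ] G) (E' := E') f x v (h x) +
        f x (diffModel (E := G₁) (E' := E') h x v) :=
  diffModel_bilin (ContinuousLinearMap.id ℝ (G₁ →L[ℝ] G)) hf hh v

end Calculus

/-! ### Vector fields along a map and their components in a chart. -/

section Fields

variable {E : Type*} [NormedAddCommGroup E] [NormedSpace ℝ E]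
  {M : Type*} [TopologicalSpace M] [ChartedSpace E M] [IsManifold 𝓘(ℝ, E) ∞ M]
  {E' : Type*} [NormedAddCommGroup E'] [NormedSpace ℝ E']
  {N : Type*} [TopologicalSpace N] [ChartedSpace E' N] [IsManifold 𝓘(ℝ, E') ∞ N]

variable (E') in
/-- The vector field `V` along `f` is differentiable at `x`. -/
def FieldDiffAt (f : N → M) (V : ∀ y : N, TangentSpace 𝓘(ℝ, E) (f y)) (x : N) : Prop :=
  MDifferentiableAt 𝓘(ℝ, E') (𝓘(ℝ, E).prod 𝓘(ℝ, E))
    (fun y ↦ (⟨f y, V y⟩ : TangentBundle 𝓘(ℝ, E) M)) x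

variable (E') in
/-- The vector field `V` along `f` is smooth at `x`. -/
def FieldSmoothAt (f : N → M) (V : ∀ y : N, TangentSpace 𝓘(ℝ, E) (f y)) (x : N) : Prop :=
  ContMDiffAt 𝓘(ℝ, E') (𝓘(ℝ, E).prod 𝓘(ℝ, E)) ∞
    (fun y ↦ (⟨f y, V y⟩ : TangentBundle 𝓘(ℝ, E) M)) x

variable {f : N → M} {V W : ∀ y : N, TangentSpace 𝓘(ℝ, E) (f y)} {x : N}

lemma FieldSmoothAt.diffAt (h : FieldSmoothAt E' f V x) : FieldDiffAt E' f V x :=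
  ContMDiffAt.mdifferentiableAt h (by simp)

lemma fieldDiffAt_iff : FieldDiffAt E' f V x ↔ MDifferentiableAt 𝓘(ℝ, E') 𝓘(ℝ, E) f x ∧
    MDifferentiableAt 𝓘(ℝ, E') 𝓘(ℝ, E) (fun y ↦ components (f x) (V y)) x :=
  mdifferentiableAt_totalSpace _ _

lemma fieldSmoothAt_iff : FieldSmoothAt E' f V x ↔ ContMDiffAt 𝓘(ℝ, E') 𝓘(ℝ, E) ∞ f x ∧
    ContMDiffAt 𝓘(ℝ, E') 𝓘(ℝ, E) ∞ (fun y ↦ components (f x) (V y)) x :=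
  Bundle.contMDiffAt_totalSpace

lemma fieldSmoothAt_iff' {q : M} (hq : f x ∈ (chartAt E q).source) :
    FieldSmoothAt E' f V x ↔ ContMDiffAt 𝓘(ℝ, E') 𝓘(ℝ, E) ∞ f x ∧
    ContMDiffAt 𝓘(ℝ, E') 𝓘(ℝ, E) ∞ (fun y ↦ components q (V y)) x :=
  Bundle.Trivialization.contMDiffAt_iff (e := trivializationAt E (TangentSpace 𝓘(ℝ, E)) q)
    (f := fun y ↦ (⟨f y, V y⟩ : TangentBundle 𝓘(ℝ, E) M)) (by simpa using hq)

/-- `components` as a continuous linear map. -/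
def componentsL (q y : M) : E →L[ℝ] E :=
  fderivWithin ℝ ((chartAt E q).extend 𝓘(ℝ, E) ∘ ((chartAt E y).extend 𝓘(ℝ, E)).symm)
    (Set.range 𝓘(ℝ, E)) ((chartAt E y).extend 𝓘(ℝ, E) y)

lemma components_eq (q : M) {y : M} (v : TangentSpace 𝓘(ℝ, E) y) :
    components q v = componentsL (E := E) q y v := rfl

lemma componentsL_self (q : M) (v : E) : componentsL q q v = v := by
  have h := (tangentBundleCore 𝓘(ℝ, E) M).coordChange_self (achart E q) q (mem_chart_source E q) v
  exact h

lemma components_self {q : M} (v : TangentSpace 𝓘(ℝ, E) q) : components q v = v :=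
  componentsL_self (E := E) q v

lemma frameAt_apply {q y : M} (hy : y ∈ (chartAt E q).source) (v : E) :
    frameAt q y v = (trivializationAt E (fun x : M ↦ TangentSpace 𝓘(ℝ, E) x) q).symm y v :=
  Bundle.Trivialization.symmL_apply _ (by simpa using hy) v

lemma componentsL_frameAt {q y : M} (hy : y ∈ (chartAt E q).source) (v : E) :
    componentsL q y (frameAt q y v) = v := by
  have h := (trivializationAt E (fun x : M ↦ TangentSpace 𝓘(ℝ, E) x) q).apply_mk_symm
    (b := y) (by simpa using hy) v
  rw [frameAt_apply hy]
  exact congrArg Prod.snd h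

lemma frameAt_componentsL {q y : M} (hy : y ∈ (chartAt E q).source) (v : E) :
    frameAt q y (componentsL q y v) = v := by
  have h := (trivializationAt E (fun x : M ↦ TangentSpace 𝓘(ℝ, E) x) q).symm_apply_apply_mk
    (b := y) (by simpa using hy) v
  rw [frameAt_apply hy]
  exact h

lemma frameAt_self (q : M) (v : E) : frameAt q q v = v := by
  have := frameAt_componentsL (mem_chart_source E q) v
  rwa [componentsL_self] at this

lemma coordField_eq {q y : M} (hy : y ∈ (chartAt E q).source) (v : TangentSpace 𝓘(ℝ, E) q) :
    coordField v y = frameAt (E := E) q y v := by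
  have h : coordField v y = (trivializationAt E (fun x : M ↦ TangentSpace 𝓘(ℝ, E) x) q).symm y
    (components q v) := rfl
  rw [h, components_self]
  exact (frameAt_apply (E := E) hy _).symm

lemma coordField_self {q : M} (v : TangentSpace 𝓘(ℝ, E) q) : coordField v q = v :=
  FiberBundle.extend_apply_self E v

end Fields

/-! ### The Levi-Civita connection along a map: linearity, locality, compatibility with the metric.
-/

section Connection

variable {E'' : Type*} [NormedAddCommGroup E''] [NormedSpace ℝ E'']
  {N' : Type*} [TopologicalSpace N'] [ChartedSpace E'' N'] [IsManifold 𝓘(ℝ, E'') ∞ N']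
  {E : Type*} [NormedAddCommGroup E] [NormedSpace ℝ E]
  {M : Type*} [TopologicalSpace M] [ChartedSpace E M] [IsManifold 𝓘(ℝ, E) ∞ M]
  {E' : Type*} [NormedAddCommGroup E'] [NormedSpace ℝ E']
  {N : Type*} [TopologicalSpace N] [ChartedSpace E' N] [IsManifold 𝓘(ℝ, E') ∞ N]

/-- The Christoffel symbols as a map on the model space. -/
def chris (g : BilinField E M) (q : M) (u v : E) : E :=
  (formAt g q).inverse (christoffelFirst g q u v)

lemma covAlong_eq (g : BilinField E M) (f : N → M) (V : ∀ y : N, TangentSpace 𝓘(ℝ, E) (f y))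
    (x : N) (v : TangentSpace 𝓘(ℝ, E') x) :
    covAlong g f V x v =
      (diffModel (E := E) (E' := E') (fun y ↦ components (f x) (V y)) x v +
        chris g (f x) (diffModel (E := E) (E' := E') f x v) (V x) : E) := rfl

lemma christoffelFirst_apply (g : BilinField E M) (q : M) (u v w : E) :
    christoffelFirst g q u v w =
      (1 / 2 : ℝ) * (metricDeriv g q u v w + metricDeriv g q v u w - metricDeriv g q w u v) := rfl

/-- `metricDeriv` as a trilinear function. -/
lemma metricDeriv_linear (g : BilinField E M) (q : M) :
    (∀ u u' v w, metricDeriv g q (u + u') v w = metricDeriv g q u v w + metricDeriv g q u' v w) ∧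
    (∀ u v v' w, metricDeriv g q u (v + v') w = metricDeriv g q u v w + metricDeriv g q u v' w) ∧
    (∀ (a : ℝ) u v w, metricDeriv g q (a • u) v w = a * metricDeriv g q u v w) ∧
    (∀ (a : ℝ) u v w, metricDeriv g q u (a • v) w = a * metricDeriv g q u v w) := by
  refine ⟨fun u u' v w ↦ ?_, fun u v v' w ↦ ?_, fun a u v w ↦ ?_, fun a u v w ↦ ?_⟩
  · rw [(metricDeriv g q).map_add]; rfl
  · rw [(metricDeriv g q u).map_add]; rfl
  · rw [(metricDeriv g q).map_smul]; rfl
  · rw [(metricDeriv g q u).map_smul]; rfl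

lemma chris_add_left (g : BilinField E M) (q : M) (u u' v : E) :
    chris g q (u + u') v = chris g q u v + chris g q u' v := by
  obtain ⟨h1, h2, h3, h4⟩ := metricDeriv_linear g q
  have : christoffelFirst g q (u + u') v = christoffelFirst g q u v + christoffelFirst g q u' v := by
    ext w
    rw [add_apply]
    simp only [christoffelFirst_apply, h1, h2]
    ring
  rw [chris, this, map_add]; rfl

lemma chris_smul_left (g : BilinField E M) (q : M) (a : ℝ) (u v : E) :
    chris g q (a • u) v = a • chris g q u v := by
  obtain ⟨h1, h2, h3, h4⟩ := metricDeriv_linear g q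
  have : christoffelFirst g q (a • u) v = a • christoffelFirst g q u v := by
    ext w
    rw [smul_apply]
    simp only [christoffelFirst_apply, h3, h4, smul_eq_mul]
    ring
  rw [chris, this, map_smul]; rfl

lemma chris_add_right (g : BilinField E M) (q : M) (u v v' : E) :
    chris g q u (v + v') = chris g q u v + chris g q u v' := by
  obtain ⟨h1, h2, h3, h4⟩ := metricDeriv_linear g q
  have : christoffelFirst g q u (v + v') = christoffelFirst g q u v + christoffelFirst g q u v' := by
    ext w
    rw [add_apply]
    simp only [christoffelFirst_apply, h1, h2]
    rw [(metricDeriv g q w u).map_add]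
    ring
  rw [chris, this, map_add]; rfl

lemma chris_smul_right (g : BilinField E M) (q : M) (a : ℝ) (u v : E) :
    chris g q u (a • v) = a • chris g q u v := by
  obtain ⟨h1, h2, h3, h4⟩ := metricDeriv_linear g q
  have : christoffelFirst g q u (a • v) = a • christoffelFirst g q u v := by
    ext w
    rw [smul_apply]
    simp only [christoffelFirst_apply, h3, h4, smul_eq_mul]
    rw [(metricDeriv g q w u).map_smul, smul_eq_mul]
    ring
  rw [chris, this, map_smul]; rfl

section
variable (g : BilinField E M) {f : N → M} {V W : ∀ y : N, TangentSpace 𝓘(ℝ, E) (f y)} {x : N}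

lemma covAlong_add_vec (u v : TangentSpace 𝓘(ℝ, E') x) :
    covAlong g f V x (u + v) = covAlong g f V x u + covAlong g f V x v := by
  simp only [covAlong_eq]
  erw [map_add, map_add, chris_add_left]
  exact add_add_add_comm (G := E) _ _ _ _

lemma covAlong_smul_vec (a : ℝ) (v : TangentSpace 𝓘(ℝ, E') x) :
    covAlong g f V x (a • v) = a • covAlong g f V x v := by
  simp only [covAlong_eq]
  erw [map_smul, map_smul, chris_smul_left, smul_add]
  rfl

lemma covAlong_zero_vec : covAlong (E' := E') g f V x 0 = 0 := by
  have := covAlong_smul_vec (E' := E') g (f := f) (V := V) (x := x) 0 0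
  simpa using this

lemma covAlong_add (hV : FieldDiffAt E' f V x) (hW : FieldDiffAt E' f W x)
    (v : TangentSpace 𝓘(ℝ, E') x) :
    covAlong g f (fun y ↦ V y + W y) x v = covAlong g f V x v + covAlong g f W x v := by
  have h := diffModel_add (fieldDiffAt_iff.1 hV).2 (fieldDiffAt_iff.1 hW).2 v
  have h2 : (fun y ↦ components (f x) (V y + W y)) =
    fun y ↦ components (f x) (V y) + components (f x) (W y) := by
    funext y; simp only [components_eq]; exact map_add _ _ _
  simp only [covAlong_eq, h2]
  erw [h, chris_add_right]
  exact add_add_add_comm (G := E) _ _ _ _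

lemma covAlong_smul {k : N → ℝ} (hk : MDifferentiableAt 𝓘(ℝ, E') 𝓘(ℝ, ℝ) k x)
    (hV : FieldDiffAt E' f V x) (v : TangentSpace 𝓘(ℝ, E') x) :
    covAlong g f (fun y ↦ k y • V y) x v =
      diffModel (E := ℝ) (E' := E') k x v • V x + k x • covAlong g f V x v := by
  have h := diffModel_smul hk (fieldDiffAt_iff.1 hV).2 v
  have h2 : (fun y ↦ components (f x) (k y • V y)) =
    fun y ↦ k y • components (f x) (V y) := by
    funext y; simp only [components_eq]; exact map_smul _ _ _
  simp only [covAlong_eq, h2]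
  erw [h, chris_smul_right, smul_add, components_self]
  exact add_assoc (G := E) _ _ _

/-- Fields along two maps that merely agree near `x` have values in formally different tangent
spaces, so the equality lives in the total space of the tangent bundle. This form allows `pr ∘ F` to
be exchanged for `γ ∘ σ` on a Hopf patch. -/
lemma covAlong_congr_raw {f' : N → M} {V' : ∀ y : N, TangentSpace 𝓘(ℝ, E) (f' y)}
    (h : ∀ᶠ y in 𝓝 x, (⟨f y, V y⟩ : TangentBundle 𝓘(ℝ, E) M) = ⟨f' y, V' y⟩)
    (v : TangentSpace 𝓘(ℝ, E') x) :
    (⟨f x, covAlong g f V x v⟩ : TangentBundle 𝓘(ℝ, E) M) = ⟨f' x, covAlong g f' V' x v⟩ := by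
  have hx := h.self_of_nhds
  have e1 : f x = f' x := congrArg TotalSpace.proj hx
  have e2 : f =ᶠ[𝓝 x] f' := h.mono fun y hy ↦ congrArg TotalSpace.proj hy
  have key : ∀ (q q' : M) (a a' : E), q = q' → a = a' →
      (⟨q, a⟩ : TangentBundle 𝓘(ℝ, E) M) = ⟨q', a'⟩ := by
    rintro q _ a _ rfl rfl; rfl
  have e3 : ∀ (p p' : TangentBundle 𝓘(ℝ, E) M), p = p' → (p.2 : E) = p'.2 := by
    rintro p _ rfl; rfl
  apply key _ _ _ _ e1
  have e4 : (fun y ↦ components (f x) (V y)) =ᶠ[𝓝 x] (fun y ↦ components (f' x) (V' y)) := by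
    filter_upwards [h] with y hy
    rw [e1]
    exact congrArg (fun p ↦ (trivializationAt E (fun x : M ↦ TangentSpace 𝓘(ℝ, E) x) (f' x) p).2) hy
  simp only [covAlong_eq]
  rw [diffModel_congr e4, diffModel_congr e2, e1]
  congr 2
  exact e3 _ _ hx

lemma covAlong_congr (h : ∀ᶠ y in 𝓝 x, V y = W y) (v : TangentSpace 𝓘(ℝ, E') x) :
    covAlong g f V x v = covAlong g f W x v := by
  have := covAlong_congr_raw g (f := f) (f' := f) (V := V) (V' := W) (x := x)
    (h.mono fun y hy ↦ by rw [hy]) v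
  simpa using this

/-- Restriction of a field along `f` to a field along `f ∘ h`. -/
lemma covAlong_comp {h : N' → N} {z : N'} (hV : FieldDiffAt E' f V (h z))
    (hh : MDifferentiableAt 𝓘(ℝ, E'') 𝓘(ℝ, E') h z) (v : TangentSpace 𝓘(ℝ, E'') z) :
    covAlong g (fun y ↦ f (h y)) (fun y ↦ V (h y)) z v =
      covAlong g f V (h z) (diffModel (E := E') (E' := E'') h z v) := by
  simp only [covAlong_eq]
  have h1 := diffModel_comp (fieldDiffAt_iff.1 hV).2 hh v
  have h2 := diffModel_comp' (fieldDiffAt_iff.1 hV).1 hh v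
  erw [h1, h2]
  rfl

end

/-- The properties of a field of bilinear forms at `q` needed for its Levi-Civita connection
to be well-behaved at `q`. -/
structure NondegAt (g : BilinField E M) (q : M) : Prop where
  symm : ∀ y u v, g y u v = g y v u
  inv : (formAt g q).IsInvertible
  diff : MDifferentiableAt 𝓘(ℝ, E) 𝓘(ℝ, E →L[ℝ] E →L[ℝ] ℝ) (metricComponents g q) q

/-- Lowering the index undoes the inverse of `g` in `chris`. Invertibility matters here: the inverse
of a non-invertible operator is zero by convention. -/
lemma NondegAt.formAt_chris {g : BilinField E M} {q : M} (h : NondegAt g q) (u v w : E) :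
    formAt g q (chris g q u v) w = christoffelFirst g q u v w := by
  have : formAt g q ((formAt g q).inverse (christoffelFirst g q u v)) = christoffelFirst g q u v := by
    obtain ⟨e, he⟩ := h.inv
    rw [← he, ContinuousLinearMap.inverse_equiv]
    simp
  rw [chris, this]

lemma metricDeriv_apply {g : BilinField E M} {q : M} (h : NondegAt g q) (u v w : E) :
    metricDeriv g q u v w =
      diffModel (E := ℝ) (E' := E) (fun y ↦ metricComponents g q y v w) q u := by
  have c : ∀ a : E, MDifferentiableAt 𝓘(ℝ, E) 𝓘(ℝ, E) (fun _ : M ↦ a) q :=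
    fun a ↦ mdifferentiableAt_const
  rw [diffModel_clm_app (mdifferentiableAt_clm_app h.diff (c v)) (c w),
    diffModel_clm_app h.diff (c v), diffModel_const, diffModel_const]
  simp only [zero_apply, map_zero, add_zero]
  rfl

lemma metricDeriv_symm {g : BilinField E M} {q : M} (h : NondegAt g q) (u v w : E) :
    metricDeriv g q u v w = metricDeriv g q u w v := by
  have h1 : (fun y ↦ metricComponents g q y v w) = fun y ↦ metricComponents g q y w v := by
    funext y
    exact h.symm y _ _
  rw [metricDeriv_apply h, metricDeriv_apply h, h1]

lemma chris_symm {g : BilinField E M} {q : M} (h : NondegAt g q) (u v : E) :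
    chris g q u v = chris g q v u := by
  unfold chris
  congr 1
  ext w
  rw [christoffelFirst_apply, christoffelFirst_apply, metricDeriv_symm h w u v]
  ring

/-- The terms in which `v` or `w` is the direction of differentiation occur with opposite signs and
cancel. This is metric compatibility at the level of symbols of the first kind. -/
lemma christoffelFirst_add {g : BilinField E M} {q : M} (h : NondegAt g q) (u v w : E) :
    christoffelFirst g q u v w + christoffelFirst g q u w v = metricDeriv g q u v w := by
  rw [christoffelFirst_apply, christoffelFirst_apply, metricDeriv_symm h u w v,
    metricDeriv_symm h w u v, metricDeriv_symm h v u w]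
  ring

lemma formAt_chris_add {g : BilinField E M} {q : M} (h : NondegAt g q) (u v w : E) :
    formAt g q (chris g q u v) w + formAt g q (chris g q u w) v = metricDeriv g q u v w := by
  rw [h.formAt_chris, h.formAt_chris, christoffelFirst_add h]

lemma inner_eq_metricComponents (g : BilinField E M) {q y : M} (hy : y ∈ (chartAt E q).source)
    (v w : TangentSpace 𝓘(ℝ, E) y) :
    g y v w = metricComponents g q y (components q v) (components q w) := by
  have key : ∀ a b : E, formAt g y a b = metricComponents g q y (componentsL q y a)
      (componentsL q y b) := by
    intro a b
    rw [metricComponents, ContinuousLinearMap.bilinearComp_apply, frameAt_componentsL hy,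
      frameAt_componentsL hy]
  exact key v w

/-- Compatibility of the Levi-Civita connection with the metric. -/
lemma diff_inner {g : BilinField E M} {f : N → M}
    {V W : ∀ y : N, TangentSpace 𝓘(ℝ, E) (f y)} {x : N} (hg : NondegAt g (f x))
    (hV : FieldDiffAt E' f V x) (hW : FieldDiffAt E' f W x) (v : TangentSpace 𝓘(ℝ, E') x) :
    diffModel (E := ℝ) (E' := E') (fun y ↦ g (f y) (V y) (W y)) x v =
      g (f x) (covAlong g f V x v) (W x) + g (f x) (V x) (covAlong g f W x v) := by
  obtain ⟨hf, hV2⟩ := fieldDiffAt_iff.1 hV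
  obtain ⟨-, hW2⟩ := fieldDiffAt_iff.1 hW
  have hG : MDifferentiableAt 𝓘(ℝ, E') 𝓘(ℝ, E →L[ℝ] E →L[ℝ] ℝ)
    (fun y ↦ metricComponents g (f x) (f y)) x :=
    MDifferentiableAt.comp (g := metricComponents g (f x)) (f := f) x hg.diff hf
  have he : (fun y ↦ g (f y) (V y) (W y)) =ᶠ[𝓝 x] fun y ↦ metricComponents g (f x) (f y)
      (components (f x) (V y)) (components (f x) (W y)) := by
    filter_upwards [hf.continuousAt.preimage_mem_nhds (chart_source_mem_nhds E (f x))] with y hy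
    exact inner_eq_metricComponents g hy _ _
  have h0 : ∀ a b : E, metricComponents g (f x) (f x) a b = formAt g (f x) a b := by
    intro a b
    simp only [metricComponents, ContinuousLinearMap.bilinearComp_apply, frameAt_self]
  have h1 := diffModel_clm_app (mdifferentiableAt_clm_app hG hV2) hW2 v
  have h2 := diffModel_clm_app hG hV2 v
  have h3 := diffModel_comp hg.diff hf v
  have h4 := formAt_chris_add hg (diffModel (E := E) (E' := E') f x v) (V x) (W x)
  have h5 : metricDeriv g (f x) (diffModel (E := E) (E' := E') f x v) =
    diffModel (E := E →L[ℝ] E →L[ℝ] ℝ) (E' := E') (fun y ↦ metricComponents g (f x) (f y)) x v :=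
    h3.symm
  rw [diffModel_congr he]
  have h7 : ∀ a b : E, formAt g (f x) a b = formAt g (f x) b a := hg.symm (f x)
  -- Here `a`, `b` are the derivatives of the components of the two fields and `c`, `d` the
  -- Christoffel corrections; the hypothesis says that the corrections absorb the derivative `D` of
  -- the metric.
  have key : ∀ (a b c d va vb : E) (D : E →L[ℝ] E →L[ℝ] ℝ),
      formAt g (f x) c vb + formAt g (f x) d va = D va vb →
      D va vb + formAt g (f x) a vb + formAt g (f x) va b =
        formAt g (f x) (a + c) vb + formAt g (f x) va (b + d) := by
    intro a b c d va vb D h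
    rw [← h, map_add, map_add, add_apply, h7 d]
    ring
  have h8 := key (diffModel (E := E) (E' := E') (fun y ↦ components (f x) (V y)) x v)
    (diffModel (E := E) (E' := E') (fun y ↦ components (f x) (W y)) x v) _ _ _ _ _ h4
  refine Eq.trans (h1.trans ?_) h8
  rw [h2, add_apply, h0, h0, h5, components_self, components_self]

end Connection

/-! ### Lie brackets in charts and vanishing of the torsion. -/

section Bracket

variable {E : Type*} [NormedAddCommGroup E] [NormedSpace ℝ E]
  {M : Type*} [TopologicalSpace M] [ChartedSpace E M] [IsManifold 𝓘(ℝ, E) ∞ M]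
  {E' : Type*} [NormedAddCommGroup E'] [NormedSpace ℝ E']
  {N : Type*} [TopologicalSpace N] [ChartedSpace E' N] [IsManifold 𝓘(ℝ, E') ∞ N]
  {G : Type*} [NormedAddCommGroup G] [NormedSpace ℝ G]

lemma diffModel_extChartAt {q y : M} (hy : y ∈ (chartAt E q).source) (v : E) :
    diffModel (E := E) (E' := E) (extChartAt 𝓘(ℝ, E) q) y v = componentsL q y v := by
  have h := TangentBundle.continuousLinearMapAt_trivializationAt (I := 𝓘(ℝ, E)) hy
  have h2 := (trivializationAt E (TangentSpace 𝓘(ℝ, E)) q).continuousLinearMapAt_apply_of_mem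
    (R := ℝ) (b := y) (by simpa using hy) v
  rw [h] at h2
  exact h2

/-- The derivative of a vector valued map at the centre of a chart. -/
lemma diffModel_eq_fderiv_chart {φ : N → G} {x : N}
    (hφ : MDifferentiableAt 𝓘(ℝ, E') 𝓘(ℝ, G) φ x) :
    diffModel (E := G) (E' := E') φ x =
      fderiv ℝ (φ ∘ (extChartAt 𝓘(ℝ, E') x).symm) (extChartAt 𝓘(ℝ, E') x x) := by
  unfold diffModel
  rw [hφ.mfderiv, ← fderivWithin_univ, ← ModelWithCorners.range_eq_univ 𝓘(ℝ, E')]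
  rfl

lemma frameAt_inverse {q y : M} (hy : y ∈ (chartAt E q).source) :
    (frameAt (E := E) q y).inverse = componentsL q y := by
  apply ContinuousLinearMap.inverse_eq
  · ext v; simp [frameAt_componentsL hy]
  · ext v; simp [componentsL_frameAt hy]

/-- The bracket on a manifold is defined by pulling fields back to a chart; these pull-backs are
simply the component functions. -/
lemma mpullbackWithin_extChartAt_symm (X : ∀ y : N, TangentSpace 𝓘(ℝ, E') y) (x : N) {z : E'}
    (hz : z ∈ (extChartAt 𝓘(ℝ, E') x).target) :
    (VectorField.mpullbackWithin 𝓘(ℝ, E') 𝓘(ℝ, E') (extChartAt 𝓘(ℝ, E') x).symm X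
      (Set.range 𝓘(ℝ, E')) z : E') = components x (X ((extChartAt 𝓘(ℝ, E') x).symm z)) := by
  have hy : (extChartAt 𝓘(ℝ, E') x).symm z ∈ (chartAt E' x).source := by
    have := (extChartAt 𝓘(ℝ, E') x).map_target hz
    rwa [extChartAt_source] at this
  have h := TangentBundle.symmL_trivializationAt (I := 𝓘(ℝ, E')) hy
  rw [(extChartAt 𝓘(ℝ, E') x).right_inv hz] at h
  have h2 := frameAt_inverse hy
  rw [VectorField.mpullbackWithin_apply]
  erw [← h]
  exact congrArg (fun L : E' →L[ℝ] E' ↦ L (X ((extChartAt 𝓘(ℝ, E') x).symm z))) h2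

/-- At the centre of a chart its derivative is the identity, so the bracket reduces to that of the
component functions in the model space. -/
lemma mlieBracket_eq {X Y : ∀ y : N, TangentSpace 𝓘(ℝ, E') y} {x : N}
    (hX : FieldDiffAt E' (fun y : N ↦ y) X x) (hY : FieldDiffAt E' (fun y : N ↦ y) Y x) :
    VectorField.mlieBracket 𝓘(ℝ, E') X Y x =
      (diffModel (E := E') (E' := E') (fun y ↦ components x (Y y)) x (X x) -
        diffModel (E := E') (E' := E') (fun y ↦ components x (X y)) x (Y x) : E') := by
  have e : ∀ Z : ∀ y : N, TangentSpace 𝓘(ℝ, E') y,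
      (fun z ↦ (VectorField.mpullbackWithin 𝓘(ℝ, E') 𝓘(ℝ, E') (extChartAt 𝓘(ℝ, E') x).symm Z
      (Set.range 𝓘(ℝ, E')) z : E')) =ᶠ[𝓝 (extChartAt 𝓘(ℝ, E') x x)]
      ((fun y ↦ components x (Z y)) ∘ (extChartAt 𝓘(ℝ, E') x).symm) := by
    intro Z
    filter_upwards [extChartAt_target_mem_nhds (I := 𝓘(ℝ, E')) x] with z hz
    exact mpullbackWithin_extChartAt_symm Z x hz
  have e0 : ∀ Z : ∀ y : N, TangentSpace 𝓘(ℝ, E') y,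
      (VectorField.mpullbackWithin 𝓘(ℝ, E') 𝓘(ℝ, E') (extChartAt 𝓘(ℝ, E') x).symm Z
      (Set.range 𝓘(ℝ, E')) (extChartAt 𝓘(ℝ, E') x x) : E') = Z x := by
    intro Z
    have := (e Z).self_of_nhds
    refine this.trans ?_
    have h2 : (extChartAt 𝓘(ℝ, E') x).symm (extChartAt 𝓘(ℝ, E') x x) = x := by simp
    have h3 : ∀ y : N, y = x → components x (Z y) = Z x := by
      rintro y rfl; exact components_self _
    exact h3 _ h2
  rw [← VectorField.mlieBracketWithin_univ, VectorField.mlieBracketWithin_apply,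
    mfderiv_extChartAt_self]
  rw [diffModel_eq_fderiv_chart (fieldDiffAt_iff.1 hX).2,
    diffModel_eq_fderiv_chart (fieldDiffAt_iff.1 hY).2, ← (e X).fderiv_eq, ← (e Y).fderiv_eq]
  have h5 : (ContinuousLinearMap.id ℝ E').inverse = ContinuousLinearMap.id ℝ E' :=
    ContinuousLinearMap.inverse_id
  have h6 : (Set.univ ∩ Set.range 𝓘(ℝ, E') : Set E') = Set.univ := by simp
  have key : ∀ A B : E' → E',  A (extChartAt 𝓘(ℝ, E') x x) = X x → B (extChartAt 𝓘(ℝ, E') x x) = Y x →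
    (ContinuousLinearMap.id ℝ E').inverse (VectorField.lieBracketWithin ℝ A B
      ((extChartAt 𝓘(ℝ, E') x).symm ⁻¹' Set.univ ∩ Set.range 𝓘(ℝ, E')) (extChartAt 𝓘(ℝ, E') x x)) =
      fderiv ℝ B (extChartAt 𝓘(ℝ, E') x x) (X x) - fderiv ℝ A (extChartAt 𝓘(ℝ, E') x x) (Y x) := by
    intro A B hA hB
    rw [h5, Set.preimage_univ, h6, VectorField.lieBracketWithin_univ, VectorField.lieBracket, hA, hB]
    rfl
  exact key _ _ (e0 X) (e0 Y)

/-- A differentiable vector field along a map, expressed through the derivative of a vector valued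
map in a chart. -/
lemma diffModel_chart {φ : N → G} {x y : N} (hy : y ∈ (chartAt E' x).source)
    (hφ : MDifferentiableAt 𝓘(ℝ, E') 𝓘(ℝ, G) φ y) (v : TangentSpace 𝓘(ℝ, E') y) :
    diffModel (E := G) (E' := E') φ y v =
      fderiv ℝ (φ ∘ (extChartAt 𝓘(ℝ, E') x).symm) (extChartAt 𝓘(ℝ, E') x y) (components x v) := by
  have hs : y ∈ (extChartAt 𝓘(ℝ, E') x).source := by rwa [extChartAt_source]
  have hl : (extChartAt 𝓘(ℝ, E') x).symm (extChartAt 𝓘(ℝ, E') x y) = y :=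
    (extChartAt 𝓘(ℝ, E') x).left_inv hs
  have hsymm : MDifferentiableAt 𝓘(ℝ, E') 𝓘(ℝ, E') (extChartAt 𝓘(ℝ, E') x).symm
      (extChartAt 𝓘(ℝ, E') x y) :=
    (contMDiffOn_extChartAt_symm (I := 𝓘(ℝ, E')) (n := ∞) x).contMDiffAt
      (extChartAt_target_mem_nhds' ((extChartAt 𝓘(ℝ, E') x).map_source hs)) |>.mdifferentiableAt (by simp)
  have hφ' : MDifferentiableAt 𝓘(ℝ, E') 𝓘(ℝ, G) φ
      ((extChartAt 𝓘(ℝ, E') x).symm (extChartAt 𝓘(ℝ, E') x y)) := by rwa [hl]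
  have hc : MDifferentiableAt 𝓘(ℝ, E') 𝓘(ℝ, G) (φ ∘ (extChartAt 𝓘(ℝ, E') x).symm)
      (extChartAt 𝓘(ℝ, E') x y) := MDifferentiableAt.comp _ hφ' hsymm
  have h1 := diffModel_comp (f := φ ∘ (extChartAt 𝓘(ℝ, E') x).symm)
    (F := extChartAt 𝓘(ℝ, E') x) (x := y) hc (mdifferentiableAt_extChartAt hy)
  have h2 : (fun y ↦ (φ ∘ (extChartAt 𝓘(ℝ, E') x).symm) (extChartAt 𝓘(ℝ, E') x y)) =ᶠ[𝓝 y] φ := by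
    filter_upwards [extChartAt_source_mem_nhds' (I := 𝓘(ℝ, E')) hs] with z hz
    exact congrArg φ ((extChartAt 𝓘(ℝ, E') x).left_inv hz)
  have key : ∀ w : E', diffModel (E := G) (E' := E') φ y w =
      fderiv ℝ (φ ∘ (extChartAt 𝓘(ℝ, E') x).symm) (extChartAt 𝓘(ℝ, E') x y) (componentsL x y w) := by
    intro w
    rw [← diffModel_congr h2, h1 w, diffModel_eq_fderiv, diffModel_extChartAt hy]
  exact key v

/-- `X (Y φ) - Y (X φ) = [X, Y] φ` for vector valued maps `φ`. -/
lemma diffModel_mlieBracket {φ : N → G} {X Y : ∀ y : N, TangentSpace 𝓘(ℝ, E') y} {x : N}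
    (hφ : ContMDiffAt 𝓘(ℝ, E') 𝓘(ℝ, G) 2 φ x)
    (hX : FieldDiffAt E' (fun y : N ↦ y) X x) (hY : FieldDiffAt E' (fun y : N ↦ y) Y x) :
    diffModel (E := G) (E' := E') (fun y ↦ diffModel (E := G) (E' := E') φ y (Y y)) x (X x) -
      diffModel (E := G) (E' := E') (fun y ↦ diffModel (E := G) (E' := E') φ y (X y)) x (Y x) =
      diffModel (E := G) (E' := E') φ x (VectorField.mlieBracket 𝓘(ℝ, E') X Y x) := by
  set c := extChartAt 𝓘(ℝ, E') x with hc
  set ψ : E' → G := φ ∘ c.symm with hψ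
  have hψs : ContDiffAt ℝ 2 ψ (c x) := by
    have := (contMDiffAt_iff.1 hφ).2
    rw [ModelWithCorners.range_eq_univ, contDiffWithinAt_univ] at this
    exact this
  have hψd : DifferentiableAt ℝ (fderiv ℝ ψ) (c x) :=
    (hψs.fderiv_right (m := 1) (by norm_num)).differentiableAt (by norm_num)
  have hcd : MDifferentiableAt 𝓘(ℝ, E') 𝓘(ℝ, E') c x :=
    mdifferentiableAt_extChartAt (mem_chart_source E' x)
  have hev : ∀ᶠ y in 𝓝 x, MDifferentiableAt 𝓘(ℝ, E') 𝓘(ℝ, G) φ y := by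
    have := (contMDiffAt_iff_contMDiffAt_nhds (by simp)).1 hφ
    exact this.mono fun y hy ↦ hy.mdifferentiableAt (by simp)
  have step : ∀ (v : E') (Y : ∀ y : N, TangentSpace 𝓘(ℝ, E') y)
      (_ : FieldDiffAt E' (fun y : N ↦ y) Y x),
      diffModel (E := G) (E' := E') (fun y ↦ diffModel (E := G) (E' := E') φ y (Y y)) x v =
      fderiv ℝ (fderiv ℝ ψ) (c x) v (components x (Y x)) +
        fderiv ℝ ψ (c x) (diffModel (E := E') (E' := E') (fun y ↦ components x (Y y)) x v) := by
    intro v Y hY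
    have h1 : (fun y ↦ diffModel (E := G) (E' := E') φ y (Y y)) =ᶠ[𝓝 x]
        fun y ↦ fderiv ℝ ψ (c y) (components x (Y y)) := by
      filter_upwards [hev, chart_source_mem_nhds E' x] with y hy hy'
      exact diffModel_chart hy' hy (Y y)
    have h2 : MDifferentiableAt 𝓘(ℝ, E') 𝓘(ℝ, E' →L[ℝ] G) (fun y ↦ fderiv ℝ ψ (c y)) x :=
      MDifferentiableAt.comp (g := fderiv ℝ ψ) x hψd.mdifferentiableAt hcd
    rw [diffModel_congr h1, diffModel_clm_app h2 (fieldDiffAt_iff.1 hY).2,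
      diffModel_comp (f := fderiv ℝ ψ) hψd.mdifferentiableAt hcd, diffModel_eq_fderiv,
      diffModel_extChartAt (mem_chart_source E' x), componentsL_self]
  -- Symmetry of the second derivative in the chart cancels the terms without derivatives of `X` and
  -- `Y`.
  have hsym : ∀ u v : E', fderiv ℝ (fderiv ℝ ψ) (c x) u v = fderiv ℝ (fderiv ℝ ψ) (c x) v u :=
    hψs.isSymmSndFDerivAt (by simp)
  have key : ∀ u v a b : E', components x (X x) = u → components x (Y x) = v →
      diffModel (E := E') (E' := E') (fun y ↦ components x (Y y)) x u = a →
      diffModel (E := E') (E' := E') (fun y ↦ components x (X y)) x v = b →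
      diffModel (E := G) (E' := E') (fun y ↦ diffModel (E := G) (E' := E') φ y (Y y)) x u -
        diffModel (E := G) (E' := E') (fun y ↦ diffModel (E := G) (E' := E') φ y (X y)) x v =
        diffModel (E := G) (E' := E') φ x (a - b) := by
    intro u v a b hu hv ha hb
    rw [step u Y hY, step v X hX, hu, hv, ha, hb, hsym v u,
      diffModel_eq_fderiv_chart (hφ.mdifferentiableAt (by simp)), map_sub]
    abel
  rw [mlieBracket_eq hX hY]
  exact key _ _ _ _ (components_self _) (components_self _) rfl rfl

/-- The Levi-Civita connection is torsion free, for the pull-back by a map `f`. -/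
lemma covAlong_torsion {g : BilinField E M} {f : N → M} {X Y : ∀ y : N, TangentSpace 𝓘(ℝ, E') y}
    {x : N} (hg : NondegAt g (f x)) (hf : ContMDiffAt 𝓘(ℝ, E') 𝓘(ℝ, E) 2 f x)
    (hX : FieldDiffAt E' (fun y : N ↦ y) X x) (hY : FieldDiffAt E' (fun y : N ↦ y) Y x) :
    covAlong g f (fun y ↦ diff f y (Y y)) x (X x) - covAlong g f (fun y ↦ diff f y (X y)) x (Y x) =
      diff f x (VectorField.mlieBracket 𝓘(ℝ, E') X Y x) := by
  -- `dφ` applied to a field gives the components of its image under `df`. The non-Christoffel terms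
  -- are therefore a commutator of derivatives of `φ`, and the Christoffel terms cancel by symmetry.
  set φ : N → E := fun y ↦ extChartAt 𝓘(ℝ, E) (f x) (f y) with hφ
  have hcs : ContMDiffAt 𝓘(ℝ, E) 𝓘(ℝ, E) 2 (extChartAt 𝓘(ℝ, E) (f x)) (f x) := contMDiffAt_extChartAt
  have hφs : ContMDiffAt 𝓘(ℝ, E') 𝓘(ℝ, E) 2 φ x := hcs.comp x hf
  have hev : ∀ᶠ y in 𝓝 x, MDifferentiableAt 𝓘(ℝ, E') 𝓘(ℝ, E) f y :=
    ((contMDiffAt_iff_contMDiffAt_nhds (by simp)).1 hf).mono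
      fun y hy ↦ hy.mdifferentiableAt (by simp)
  have hsrc : ∀ᶠ y in 𝓝 x, f y ∈ (chartAt E (f x)).source :=
    hf.continuousAt.preimage_mem_nhds (chart_source_mem_nhds E (f x))
  have hcomp : ∀ Z : ∀ y : N, TangentSpace 𝓘(ℝ, E') y,
      (fun y ↦ components (f x) (diff f y (Z y))) =ᶠ[𝓝 x]
      fun y ↦ diffModel (E := E) (E' := E') φ y (Z y) := by
    intro Z
    filter_upwards [hev, hsrc] with y hy hy'
    have h1 := diffModel_comp (f := extChartAt 𝓘(ℝ, E) (f x)) (F := f) (x := y)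
      (mdifferentiableAt_extChartAt hy') hy (Z y)
    rw [diffModel_extChartAt hy'] at h1
    exact h1.symm
  have h0 : ∀ v : E', diffModel (E := E) (E' := E') φ x v = diffModel (E := E) (E' := E') f x v := by
    intro v
    have h1 := diffModel_comp (f := extChartAt 𝓘(ℝ, E) (f x)) (F := f) (x := x)
      (mdifferentiableAt_extChartAt (mem_chart_source E (f x))) (hf.mdifferentiableAt (by simp)) v
    rw [diffModel_extChartAt (mem_chart_source E (f x)), componentsL_self] at h1
    exact h1
  have hb := diffModel_mlieBracket hφs hX hY
  have key : ∀ (A B : N → E) (u v w : E'),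
      A =ᶠ[𝓝 x] (fun y ↦ diffModel (E := E) (E' := E') φ y (Y y)) →
      B =ᶠ[𝓝 x] (fun y ↦ diffModel (E := E) (E' := E') φ y (X y)) →
      diffModel (E := E) (E' := E') (fun y ↦ diffModel (E := E) (E' := E') φ y (Y y)) x u -
        diffModel (E := E) (E' := E') (fun y ↦ diffModel (E := E) (E' := E') φ y (X y)) x v =
        diffModel (E := E) (E' := E') φ x w →
      (diffModel (E := E) (E' := E') A x u + chris g (f x) (diffModel (E := E) (E' := E') f x u)
        (diffModel (E := E) (E' := E') f x v)) -
      (diffModel (E := E) (E' := E') B x v + chris g (f x) (diffModel (E := E) (E' := E') f x v)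
        (diffModel (E := E) (E' := E') f x u)) = diffModel (E := E) (E' := E') f x w := by
    intro A B u v w hA hB h
    rw [diffModel_congr hA, diffModel_congr hB, chris_symm hg, ← h0 w, ← h]
    abel
  exact key _ _ _ _ _ (hcomp Y) (hcomp X) hb

lemma cov_torsion {g : BilinField E M} {X Y : ∀ y : M, TangentSpace 𝓘(ℝ, E) y}
    {x : M} (hg : NondegAt g x)
    (hX : FieldDiffAt E (fun y : M ↦ y) X x) (hY : FieldDiffAt E (fun y : M ↦ y) Y x) :
    cov g Y x (X x) - cov g X x (Y x) = VectorField.mlieBracket 𝓘(ℝ, E) X Y x := by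
  rw [mlieBracket_eq hX hY]
  have key : ∀ a b u v u' v' : E, u' = u → v' = v →
      (a + chris g x u' v) - (b + chris g x v' u) = a - b := by
    rintro a b u v _ _ rfl rfl
    rw [chris_symm hg]
    abel
  exact key _ _ _ _ _ _ (diffModel_id (E := E) x (X x))
    (diffModel_id (E := E) x (Y x))

end Bracket

/-! ### Smooth vector fields along maps, and smoothness of the metric components. -/

section Smooth

variable {E : Type*} [NormedAddCommGroup E] [NormedSpace ℝ E]
  {M : Type*} [TopologicalSpace M] [ChartedSpace E M] [IsManifold 𝓘(ℝ, E) ∞ M]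
  {E' : Type*} [NormedAddCommGroup E'] [NormedSpace ℝ E']
  {N : Type*} [TopologicalSpace N] [ChartedSpace E' N] [IsManifold 𝓘(ℝ, E') ∞ N]
  {E'' : Type*} [NormedAddCommGroup E''] [NormedSpace ℝ E'']
  {N' : Type*} [TopologicalSpace N'] [ChartedSpace E'' N'] [IsManifold 𝓘(ℝ, E'') ∞ N']
  {G : Type*} [NormedAddCommGroup G] [NormedSpace ℝ G]

section Algebra
variable {f : N → M} {V W : ∀ y : N, TangentSpace 𝓘(ℝ, E) (f y)} {x : N}

lemma FieldSmoothAt.base (h : FieldSmoothAt E' f V x) : ContMDiffAt 𝓘(ℝ, E') 𝓘(ℝ, E) ∞ f x :=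
  (fieldSmoothAt_iff.1 h).1

lemma FieldSmoothAt.add (hV : FieldSmoothAt E' f V x) (hW : FieldSmoothAt E' f W x) :
    FieldSmoothAt E' f (fun y ↦ V y + W y) x := by
  rw [fieldSmoothAt_iff] at *
  refine ⟨hV.1, (hV.2.add hW.2).congr_of_eventuallyEq (.of_forall fun y ↦ ?_)⟩
  exact map_add (componentsL (E := E) (f x) (f y)) _ _

lemma FieldSmoothAt.smul {k : N → ℝ} (hk : ContMDiffAt 𝓘(ℝ, E') 𝓘(ℝ, ℝ) ∞ k x)
    (hV : FieldSmoothAt E' f V x) : FieldSmoothAt E' f (fun y ↦ k y • V y) x := by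
  rw [fieldSmoothAt_iff] at *
  refine ⟨hV.1, (hk.smul hV.2).congr_of_eventuallyEq (.of_forall fun y ↦ ?_)⟩
  exact map_smul (componentsL (E := E) (f x) (f y)) _ _

lemma FieldSmoothAt.neg (hV : FieldSmoothAt E' f V x) :
    FieldSmoothAt E' f (fun y ↦ - V y) x := by
  simpa using FieldSmoothAt.smul (k := fun _ ↦ (-1 : ℝ)) contMDiffAt_const hV

lemma FieldSmoothAt.sub (hV : FieldSmoothAt E' f V x) (hW : FieldSmoothAt E' f W x) :
    FieldSmoothAt E' f (fun y ↦ V y - W y) x := by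
  simpa [sub_eq_add_neg] using hV.add hW.neg

lemma FieldSmoothAt.zero (hf : ContMDiffAt 𝓘(ℝ, E') 𝓘(ℝ, E) ∞ f x) :
    FieldSmoothAt E' f (fun y ↦ (0 : TangentSpace 𝓘(ℝ, E) (f y))) x := by
  rw [fieldSmoothAt_iff]
  refine ⟨hf, (contMDiffAt_const (c := (0 : E))).congr_of_eventuallyEq (.of_forall fun y ↦ ?_)⟩
  exact map_zero (componentsL (E := E) (f x) (f y))

lemma FieldSmoothAt.sum {ι : Type*} (s : Finset ι) {U : ι → ∀ y : N, TangentSpace 𝓘(ℝ, E) (f y)}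
    (hf : ContMDiffAt 𝓘(ℝ, E') 𝓘(ℝ, E) ∞ f x)
    (h : ∀ i ∈ s, FieldSmoothAt E' f (U i) x) :
    FieldSmoothAt E' f (fun y ↦ ∑ i ∈ s, U i y) x := by
  classical
  induction s using Finset.induction_on with
  | empty => simpa using FieldSmoothAt.zero hf
  | insert a s ha ih =>
    simp only [Finset.sum_insert ha]
    exact (h a (by simp)).add (ih fun i hi ↦ h i (by simp [hi]))

lemma FieldSmoothAt.congr (hV : FieldSmoothAt E' f V x) (h : ∀ᶠ y in 𝓝 x, W y = V y) :
    FieldSmoothAt E' f W x :=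
  ContMDiffAt.congr_of_eventuallyEq hV (h.mono fun y hy ↦ by simp [hy])

lemma FieldDiffAt.add (hV : FieldDiffAt E' f V x) (hW : FieldDiffAt E' f W x) :
    FieldDiffAt E' f (fun y ↦ V y + W y) x := by
  rw [fieldDiffAt_iff] at *
  refine ⟨hV.1, (hV.2.add hW.2).congr_of_eventuallyEq (.of_forall fun y ↦ ?_)⟩
  exact map_add (componentsL (E := E) (f x) (f y)) _ _

lemma FieldDiffAt.smul {k : N → ℝ} (hk : MDifferentiableAt 𝓘(ℝ, E') 𝓘(ℝ, ℝ) k x)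
    (hV : FieldDiffAt E' f V x) : FieldDiffAt E' f (fun y ↦ k y • V y) x := by
  rw [fieldDiffAt_iff] at *
  refine ⟨hV.1, (mdifferentiableAt_bilin (ContinuousLinearMap.lsmul ℝ ℝ) hk
    hV.2).congr_of_eventuallyEq (.of_forall fun y ↦ ?_)⟩
  exact map_smul (componentsL (E := E) (f x) (f y)) _ _

lemma FieldDiffAt.zero (hf : MDifferentiableAt 𝓘(ℝ, E') 𝓘(ℝ, E) f x) :
    FieldDiffAt E' f (fun y ↦ (0 : TangentSpace 𝓘(ℝ, E) (f y))) x := by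
  rw [fieldDiffAt_iff]
  refine ⟨hf, (mdifferentiableAt_const (c := (0 : E))).congr_of_eventuallyEq
    (.of_forall fun y ↦ ?_)⟩
  exact map_zero (componentsL (E := E) (f x) (f y))

lemma FieldDiffAt.sum {ι : Type*} (s : Finset ι) {U : ι → ∀ y : N, TangentSpace 𝓘(ℝ, E) (f y)}
    (hf : MDifferentiableAt 𝓘(ℝ, E') 𝓘(ℝ, E) f x)
    (h : ∀ i ∈ s, FieldDiffAt E' f (U i) x) :
    FieldDiffAt E' f (fun y ↦ ∑ i ∈ s, U i y) x := by
  classical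
  induction s using Finset.induction_on with
  | empty => simpa using FieldDiffAt.zero hf
  | insert a s ha ih =>
    simp only [Finset.sum_insert ha]
    exact (h a (by simp)).add (ih fun i hi ↦ h i (by simp [hi]))

lemma FieldSmoothAt.comp {h : N' → N} {z : N'} (hV : FieldSmoothAt E' f V (h z))
    (hh : ContMDiffAt 𝓘(ℝ, E'') 𝓘(ℝ, E') ∞ h z) :
    FieldSmoothAt E'' (fun y ↦ f (h y)) (fun y ↦ V (h y)) z :=
  ContMDiffAt.comp (f := h) z hV hh

lemma FieldDiffAt.comp {h : N' → N} {z : N'} (hV : FieldDiffAt E' f V (h z))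
    (hh : MDifferentiableAt 𝓘(ℝ, E'') 𝓘(ℝ, E') h z) :
    FieldDiffAt E'' (fun y ↦ f (h y)) (fun y ↦ V (h y)) z :=
  MDifferentiableAt.comp (f := h) z hV hh

lemma FieldSmoothAt.eventually_diffAt (hV : FieldSmoothAt E' f V x) :
    ∀ᶠ y in 𝓝 x, FieldDiffAt E' f V y := by
  have h1 : ContMDiffAt 𝓘(ℝ, E') (𝓘(ℝ, E).prod 𝓘(ℝ, E)) 1
    (fun y ↦ (⟨f y, V y⟩ : TangentBundle 𝓘(ℝ, E) M)) x := ContMDiffAt.of_le hV (by simp)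
  exact ((contMDiffAt_iff_contMDiffAt_nhds (by simp)).1 h1).mono
    fun y hy ↦ hy.mdifferentiableAt (by simp)

lemma covAlong_sum (g : BilinField E M) {ι : Type*} (s : Finset ι)
    {U : ι → ∀ y : N, TangentSpace 𝓘(ℝ, E) (f y)}
    (hf : MDifferentiableAt 𝓘(ℝ, E') 𝓘(ℝ, E) f x)
    (h : ∀ i ∈ s, FieldDiffAt E' f (U i) x) (v : TangentSpace 𝓘(ℝ, E') x) :
    covAlong g f (fun y ↦ ∑ i ∈ s, U i y) x v = ∑ i ∈ s, covAlong g f (U i) x v := by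
  classical
  induction s using Finset.induction_on with
  | empty =>
    have := covAlong_smul g (k := fun _ : N ↦ (0 : ℝ)) (x := x) mdifferentiableAt_const
      (FieldDiffAt.zero hf) v
    simp only [diffModel_const] at this
    simpa using this
  | insert a s ha ih =>
    simp only [Finset.sum_insert ha]
    rw [covAlong_add g (h a (by simp)) (FieldDiffAt.sum s hf fun i hi ↦ h i (by simp [hi])),
      ih fun i hi ↦ h i (by simp [hi])]

end Algebra

lemma eventually_mdifferentiableAt {f : N → M} {x : N} (hf : ContMDiffAt 𝓘(ℝ, E') 𝓘(ℝ, E) ∞ f x) :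
    ∀ᶠ y in 𝓝 x, MDifferentiableAt 𝓘(ℝ, E') 𝓘(ℝ, E) f y :=
  ((contMDiffAt_iff_contMDiffAt_nhds (by simp)).1 (hf.of_le (m := 1) (by simp))).mono
    fun y hy ↦ hy.mdifferentiableAt (by simp)

/-- Fields along maps into a vector space are just vector valued maps. -/
lemma fieldSmoothAt_vector {f : N → G} {V : ∀ y : N, TangentSpace 𝓘(ℝ, G) (f y)} {x : N}
    (hf : ContMDiffAt 𝓘(ℝ, E') 𝓘(ℝ, G) ∞ f x) : FieldSmoothAt E' f V x ↔
      ContMDiffAt 𝓘(ℝ, E') 𝓘(ℝ, G) ∞ (fun y ↦ (V y : G)) x := by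
  rw [fieldSmoothAt_iff]
  have h : (fun y ↦ components (f x) (V y)) = fun y ↦ (V y : G) := by
    funext y
    have := trivializationAt_model_space_apply (I := 𝓘(ℝ, G)) (⟨f y, V y⟩ : TangentBundle 𝓘(ℝ, G) G) (f x)
    exact congrArg Prod.snd this
  rw [h]
  exact ⟨fun h ↦ h.2, fun h ↦ ⟨hf, h⟩⟩

/-- `df (X)` is smooth. -/
lemma fieldSmoothAt_diff {f : N → M} {X : ∀ y : N, TangentSpace 𝓘(ℝ, E') y} {x : N}
    (hf : ContMDiffAt 𝓘(ℝ, E') 𝓘(ℝ, E) ∞ f x) (hX : FieldSmoothAt E' (fun y : N ↦ y) X x) :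
    FieldSmoothAt E' f (fun y ↦ diff (E := E) (E' := E') f y (X y)) x := by
  have h1 := hf.mfderiv_const (m := ∞) (by simp)
  exact ContMDiffAt.clm_apply_of_inCoordinates h1 hX hf

lemma contMDiffAt_diffModel_apply {f : N → G} {X : ∀ y : N, TangentSpace 𝓘(ℝ, E') y} {x : N}
    (hf : ContMDiffAt 𝓘(ℝ, E') 𝓘(ℝ, G) ∞ f x) (hX : FieldSmoothAt E' (fun y : N ↦ y) X x) :
    ContMDiffAt 𝓘(ℝ, E') 𝓘(ℝ, G) ∞ (fun y ↦ diffModel (E := G) (E' := E') f y (X y)) x :=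
  (fieldSmoothAt_vector hf).1 (fieldSmoothAt_diff hf hX)

/-- The vector fields of the coordinate frame of the chart at `q`. -/
def frameField (q : M) (a : E) (y : M) : TangentSpace 𝓘(ℝ, E) y := frameAt (E := E) q y a

lemma fieldSmoothAt_frameField (q : M) {y : M} (hy : y ∈ (chartAt E q).source) (a : E) :
    FieldSmoothAt E (fun y : M ↦ y) (frameField q a) y := by
  rw [fieldSmoothAt_iff' (q := q) hy]
  refine ⟨contMDiffAt_id, (contMDiffAt_const (c := a)).congr_of_eventuallyEq ?_⟩
  filter_upwards [(chartAt E q).open_source.mem_nhds hy] with z hz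
  exact componentsL_frameAt hz a

lemma fieldSmoothAt_coordField {q y : M} (hy : y ∈ (chartAt E q).source)
    (v : TangentSpace 𝓘(ℝ, E) q) : FieldSmoothAt E (fun y : M ↦ y) (coordField v) y := by
  refine (fieldSmoothAt_frameField q hy v).congr ?_
  filter_upwards [(chartAt E q).open_source.mem_nhds hy] with z hz
  exact coordField_eq hz v

lemma RMetric.contMDiffAt_inner (g : RMetric E M) {f : N → M}
    {V W : ∀ y : N, TangentSpace 𝓘(ℝ, E) (f y)} {x : N}
    (hV : FieldSmoothAt E' f V x) (hW : FieldSmoothAt E' f W x) :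
    ContMDiffAt 𝓘(ℝ, E') 𝓘(ℝ, ℝ) ∞ (fun y ↦ g.inner (f y) (V y) (W y)) x := by
  have : ContMDiffAt 𝓘(ℝ, E') (𝓘(ℝ, E).prod 𝓘(ℝ)) ∞
      (fun m ↦ TotalSpace.mk' ℝ (E := Bundle.Trivial M ℝ) (f m) (g.inner (f m) (V m) (W m))) x := by
    apply ContMDiffAt.clm_bundle_apply₂ (F₁ := E) (F₂ := E)
    · exact ContMDiffAt.comp (f := f) x g.contMDiff.contMDiffAt hV.base
    · exact hV
    · exact hW
  simp only [contMDiffAt_totalSpace] at this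
  exact this.2

variable [FiniteDimensional ℝ E]

/-- An operator on a finite-dimensional space is the sum of rank-one operators formed from
coordinate functionals and its values on a basis, so smoothness may be tested on fixed vectors. -/
lemma contMDiffAt_clm_of_apply {f : N → E →L[ℝ] G} {x : N}
    (h : ∀ a, ContMDiffAt 𝓘(ℝ, E') 𝓘(ℝ, G) ∞ (fun y ↦ f y a) x) :
    ContMDiffAt 𝓘(ℝ, E') 𝓘(ℝ, E →L[ℝ] G) ∞ f x := by
  let b := Module.finBasis ℝ E
  have hf : f = fun y ↦ ∑ i, ContinuousLinearMap.smulRightL ℝ E G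
      (LinearMap.toContinuousLinearMap (b.coord i)) (f y (b i)) := by
    funext y; ext v
    conv_lhs => rw [← b.sum_repr v, map_sum]
    simp
  rw [hf]
  refine contMDiffAt_finsetSum fun i _ ↦ ?_
  exact (ContinuousLinearMap.contDiff _).contMDiff.contMDiffAt.comp x (h (b i))

lemma RMetric.contMDiffAt_metricComponents (g : RMetric E M) {q y : M}
    (hy : y ∈ (chartAt E q).source) :
    ContMDiffAt 𝓘(ℝ, E) 𝓘(ℝ, E →L[ℝ] E →L[ℝ] ℝ) ∞ (metricComponents g.inner q) y := by
  refine contMDiffAt_clm_of_apply fun a ↦ contMDiffAt_clm_of_apply fun b ↦ ?_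
  exact g.contMDiffAt_inner (fieldSmoothAt_frameField q hy a) (fieldSmoothAt_frameField q hy b)

/-- Nondegeneracy makes `B` injective into the dual space, which has the same dimension. -/
lemma isInvertible_of_posDef (B : E →L[ℝ] E →L[ℝ] ℝ) (h : ∀ v, B v = 0 → v = 0) :
    B.IsInvertible := by
  have h1 : Module.finrank ℝ E = Module.finrank ℝ (E →L[ℝ] ℝ) := by
    rw [← (LinearMap.toContinuousLinearMap (𝕜 := ℝ) (E := E) (F' := ℝ)).finrank_eq]
    exact (Subspace.dual_finrank_eq (K := ℝ) (V := E)).symm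
  have : FiniteDimensional ℝ (E →L[ℝ] ℝ) :=
    (LinearMap.toContinuousLinearMap (𝕜 := ℝ) (E := E) (F' := ℝ)).finiteDimensional
  have hinj : Function.Injective (B : E →ₗ[ℝ] (E →L[ℝ] ℝ)) :=
    (injective_iff_map_eq_zero _).2 h
  refine ⟨(LinearEquiv.ofInjectiveOfFinrankEq (B : E →ₗ[ℝ] (E →L[ℝ] ℝ)) hinj h1).toContinuousLinearEquiv, ?_⟩
  ext v w
  rfl

lemma RMetric.eq_zero (g : RMetric E M) {q : M} {v : TangentSpace 𝓘(ℝ, E) q}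
    (h : g.inner q v v = 0) : v = 0 := by
  by_contra hv
  exact (g.pos q v hv).ne' h

lemma RMetric.ext (g : RMetric E M) {q : M} {v w : TangentSpace 𝓘(ℝ, E) q}
    (h : ∀ u, g.inner q v u = g.inner q w u) : v = w := by
  rw [← sub_eq_zero]
  apply g.eq_zero
  rw [(g.inner q).map_sub, sub_apply, h, sub_self]

lemma RMetric.nondegAt (g : RMetric E M) (q : M) : NondegAt g.inner q where
  symm y u v := g.symm y u v
  inv := isInvertible_of_posDef _ fun v hv ↦ g.eq_zero (q := q) (v := v) (by
    change formAt g.inner q v v = 0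
    rw [hv]; rfl)
  diff := (g.contMDiffAt_metricComponents (mem_chart_source E q)).mdifferentiableAt (by simp)

end Smooth

/-! ### Koszul formula, smoothness of covariant derivatives, skew-symmetry of the curvature. -/

section LeviCivita

variable {E : Type*} [NormedAddCommGroup E] [NormedSpace ℝ E] [FiniteDimensional ℝ E]
  {M : Type*} [TopologicalSpace M] [ChartedSpace E M] [IsManifold 𝓘(ℝ, E) ∞ M]
  {E' : Type*} [NormedAddCommGroup E'] [NormedSpace ℝ E']
  {N : Type*} [TopologicalSpace N] [ChartedSpace E' N] [IsManifold 𝓘(ℝ, E') ∞ N]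

/-- Koszul formula. -/
lemma koszul {g : BilinField E M} {X Y Z : ∀ y : M, TangentSpace 𝓘(ℝ, E) y} {p : M}
    (hg : NondegAt g p) (hX : FieldDiffAt E (fun y : M ↦ y) X p)
    (hY : FieldDiffAt E (fun y : M ↦ y) Y p) (hZ : FieldDiffAt E (fun y : M ↦ y) Z p) :
    2 * g p (cov g Y p (X p)) (Z p) =
      diffModel (E := ℝ) (E' := E) (fun y ↦ g y (Y y) (Z y)) p (X p) +
      diffModel (E := ℝ) (E' := E) (fun y ↦ g y (X y) (Z y)) p (Y p) -
      diffModel (E := ℝ) (E' := E) (fun y ↦ g y (X y) (Y y)) p (Z p) +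
      g p (VectorField.mlieBracket 𝓘(ℝ, E) X Y p) (Z p) -
      g p (VectorField.mlieBracket 𝓘(ℝ, E) X Z p) (Y p) -
      g p (VectorField.mlieBracket 𝓘(ℝ, E) Y Z p) (X p) := by
  -- Compatibility with the metric expands the three derivatives and absence of torsion the three
  -- brackets; up to symmetry of `g` all but two equal terms cancel.
  rw [diff_inner (f := fun y : M ↦ y) hg hY hZ, diff_inner (f := fun y : M ↦ y) hg hX hZ,
    diff_inner (f := fun y : M ↦ y) hg hX hY, ← cov_torsion hg hX hY, ← cov_torsion hg hX hZ,
    ← cov_torsion hg hY hZ]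
  simp only [map_sub, sub_apply, cov]
  rw [hg.symm p (Y p), hg.symm p (X p), hg.symm p (X p)]
  ring

lemma RMetric.isInvertible_metricComponents (g : RMetric E M) {q y : M}
    (hy : y ∈ (chartAt E q).source) : (metricComponents g.inner q y).IsInvertible := by
  refine isInvertible_of_posDef _ fun v hv ↦ ?_
  have h1 : metricComponents g.inner q y v v = 0 := by rw [hv]; rfl
  have h2 : frameAt (E := E) q y v = 0 :=
    g.eq_zero (q := y) (v := (frameAt (E := E) q y v : E)) h1
  rw [← componentsL_frameAt hy v, h2, map_zero]

/-- A vector field is smooth if its inner products with a coordinate frame are. -/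
lemma fieldSmoothAt_of_inner (g : RMetric E M) {q : M} {W : ∀ y : M, TangentSpace 𝓘(ℝ, E) y}
    (h : ∀ a : E, ContMDiffAt 𝓘(ℝ, E) 𝓘(ℝ, ℝ) ∞ (fun y ↦ g.inner y (W y) (frameField q a y)) q) :
    FieldSmoothAt E (fun y : M ↦ y) W q := by
  rw [fieldSmoothAt_iff]
  refine ⟨contMDiffAt_id, ?_⟩
  have hsrc := chart_source_mem_nhds E q
  have h1 : ContMDiffAt 𝓘(ℝ, E) 𝓘(ℝ, E →L[ℝ] ℝ) ∞
      (fun y ↦ metricComponents g.inner q y (components q (W y))) q := by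
    refine contMDiffAt_clm_of_apply fun a ↦ (h a).congr_of_eventuallyEq ?_
    filter_upwards [hsrc] with y hy
    rw [inner_eq_metricComponents g.inner hy]
    exact congrArg _ (componentsL_frameAt hy a).symm
  -- The index is raised by the inverse matrix of the metric, and inversion is smooth at invertible
  -- operators.
  have h2 : ContMDiffAt 𝓘(ℝ, E) 𝓘(ℝ, (E →L[ℝ] ℝ) →L[ℝ] E) ∞
      (fun y ↦ (metricComponents g.inner q y).inverse) q :=
    ContMDiffAt.comp (g := ContinuousLinearMap.inverse) q
      ((g.isInvertible_metricComponents (mem_chart_source E q)).contDiffAt_map_inverse).contMDiffAt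
      (g.contMDiffAt_metricComponents (mem_chart_source E q))
  refine (h2.clm_apply h1).congr_of_eventuallyEq ?_
  filter_upwards [hsrc] with y hy
  obtain ⟨e, he⟩ := g.isInvertible_metricComponents hy
  rw [← he, ContinuousLinearMap.inverse_equiv]
  exact (e.symm_apply_apply _).symm

lemma fieldSmoothAt_mlieBracket {X Y : ∀ y : M, TangentSpace 𝓘(ℝ, E) y} {p : M}
    (hX : FieldSmoothAt E (fun y : M ↦ y) X p) (hY : FieldSmoothAt E (fun y : M ↦ y) Y p) :
    FieldSmoothAt E (fun y : M ↦ y) (VectorField.mlieBracket 𝓘(ℝ, E) X Y) p := by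
  have : IsManifold 𝓘(ℝ, E) (minSmoothness ℝ 2) M := by
    rw [minSmoothness_of_isRCLikeNormedField]
    infer_instance
  have : IsManifold 𝓘(ℝ, E) (((⊤ : ℕ∞) : WithTop ℕ∞) + 1) M :=
    inferInstanceAs (IsManifold 𝓘(ℝ, E) ∞ M)
  exact ContMDiffAt.mlieBracket_vectorField (n := ⊤) (m := ⊤) hX hY (by simp)

/-- `∇_X Y` is smooth for smooth vector fields `X` and `Y`. -/
lemma fieldSmoothAt_cov (g : RMetric E M) {X Y : ∀ y : M, TangentSpace 𝓘(ℝ, E) y} {p : M}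
    (hX : FieldSmoothAt E (fun y : M ↦ y) X p) (hY : FieldSmoothAt E (fun y : M ↦ y) Y p) :
    FieldSmoothAt E (fun y : M ↦ y) (fun y ↦ cov g.inner Y y (X y)) p := by
  -- The Christoffel symbols are taken at each point in the chart centred there, so their dependence
  -- on the point is not directly visible. The Koszul formula expresses the products of ∇_X Y with
  -- frame fields through functions known to be smooth.
  refine fieldSmoothAt_of_inner g fun a ↦ ?_
  have hZ := fieldSmoothAt_frameField p (mem_chart_source E p) a
  set Z := frameField p a
  have hXY := g.contMDiffAt_inner hX hY
  have hXZ := g.contMDiffAt_inner hX hZ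
  have hYZ := g.contMDiffAt_inner hY hZ
  have hb1 := g.contMDiffAt_inner (fieldSmoothAt_mlieBracket hX hY) hZ
  have hb2 := g.contMDiffAt_inner (fieldSmoothAt_mlieBracket hX hZ) hY
  have hb3 := g.contMDiffAt_inner (fieldSmoothAt_mlieBracket hY hZ) hX
  have h1 := contMDiffAt_diffModel_apply hYZ hX
  have h2 := contMDiffAt_diffModel_apply hXZ hY
  have h3 := contMDiffAt_diffModel_apply hXY hZ
  have h4 := ContMDiffAt.smul (contMDiffAt_const (I := 𝓘(ℝ, E)) (I' := 𝓘(ℝ, ℝ)) (x := p) (c := (1 / 2 : ℝ)))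
    (((((h1.add h2).sub h3).add hb1).sub hb2).sub hb3)
  refine h4.congr_of_eventuallyEq ?_
  filter_upwards [hX.eventually_diffAt, hY.eventually_diffAt, hZ.eventually_diffAt] with y h1 h2 h3
  have := koszul (g.nondegAt y) h1 h2 h3
  simp only [Pi.add_apply, smul_eq_mul, Pi.smul_apply']
  rw [← this]
  ring

lemma cov_sum_vec (g : BilinField E M) (Y : ∀ y : M, TangentSpace 𝓘(ℝ, E) y) (p : M) {ι : Type*}
    (s : Finset ι) (v : ι → TangentSpace 𝓘(ℝ, E) p) :
    cov g Y p (∑ i ∈ s, v i) = ∑ i ∈ s, cov g Y p (v i) := by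
  classical
  induction s using Finset.induction_on with
  | empty => exact covAlong_zero_vec g
  | insert a s ha ih =>
    rw [Finset.sum_insert ha, Finset.sum_insert ha, ← ih]
    exact covAlong_add_vec g _ _

lemma cov_smul_vec (g : BilinField E M) (Y : ∀ y : M, TangentSpace 𝓘(ℝ, E) y) (p : M) (a : ℝ)
    (v : TangentSpace 𝓘(ℝ, E) p) : cov g Y p (a • v) = a • cov g Y p v :=
  covAlong_smul_vec g a v

/-- The coefficients of a vector in the coordinate frame of the chart at `q`. -/
def coeffs (q : M) {y : M} (v : TangentSpace 𝓘(ℝ, E) y) (i : Fin (Module.finrank ℝ E)) : ℝ :=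
  (Module.finBasis ℝ E).repr (components q v) i

lemma sum_coeffs {q y : M} (hy : y ∈ (chartAt E q).source) (v : TangentSpace 𝓘(ℝ, E) y) :
    v = ∑ i, coeffs q v i • frameField q (Module.finBasis ℝ E i) y := by
  have key : ∀ w : E, w = ∑ i, (Module.finBasis ℝ E).repr (componentsL q y w) i •
      frameAt (E := E) q y (Module.finBasis ℝ E i) := by
    intro w
    conv_lhs => rw [← frameAt_componentsL hy w, ← (Module.finBasis ℝ E).sum_repr (componentsL q y w)]
    rw [map_sum]
    simp only [map_smul]
  exact key v

lemma contMDiffAt_coeffs {f : N → M} {V : ∀ y : N, TangentSpace 𝓘(ℝ, E) (f y)} {x : N}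
    (hV : FieldSmoothAt E' f V x) (i : Fin (Module.finrank ℝ E)) :
    ContMDiffAt 𝓘(ℝ, E') 𝓘(ℝ, ℝ) ∞ (fun y ↦ coeffs (f x) (V y) i) x :=
  (LinearMap.toContinuousLinearMap
    ((Module.finBasis ℝ E).coord i)).contDiff.contMDiff.contMDiffAt.comp x (fieldSmoothAt_iff.1 hV).2

/-- `∇^f_X V` is smooth for smooth `X` and `V`. -/
lemma fieldSmoothAt_covAlong (g : RMetric E M) {f : N → M}
    {V : ∀ y : N, TangentSpace 𝓘(ℝ, E) (f y)} {X : ∀ y : N, TangentSpace 𝓘(ℝ, E') y} {x : N}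
    (hX : FieldSmoothAt E' (fun y : N ↦ y) X x) (hV : FieldSmoothAt E' f V x) :
    FieldSmoothAt E' f (fun y ↦ covAlong g.inner f V y (X y)) x := by
  let b := Module.finBasis ℝ E
  set q := f x with hq
  have hf := hV.base
  have hsrc : ∀ᶠ y in 𝓝 x, f y ∈ (chartAt E q).source :=
    hf.continuousAt.preimage_mem_nhds (chart_source_mem_nhds E q)
  have hfr : ∀ i, FieldSmoothAt E (fun y : M ↦ y) (frameField q (b i)) (f x) := fun i ↦
    fieldSmoothAt_frameField q (mem_chart_source E q) (b i)
  -- When `V` is expanded in the coordinate frame of one fixed chart of `M`, the Leibniz rule leaves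
  -- derivatives of the coefficients and covariant derivatives of fields on `M`, which
  -- `fieldSmoothAt_cov` covers.
  have hEV : ∀ᶠ y in 𝓝 x, covAlong g.inner f V y (X y) =
      ∑ i, (diffModel (E := ℝ) (E' := E') (fun z ↦ coeffs q (V z) i) y (X y) •
        frameField q (b i) (f y) + coeffs q (V y) i • ∑ j, coeffs q (diff (E := E) (E' := E') f y (X y)) j •
          cov g.inner (frameField q (b i)) (f y) (frameField q (b j) (f y))) := by
    have hc : ∀ᶠ y in 𝓝 x, ∀ i, MDifferentiableAt 𝓘(ℝ, E') 𝓘(ℝ, ℝ) (fun z ↦ coeffs q (V z) i) y :=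
      Filter.eventually_all.2 fun i ↦ eventually_mdifferentiableAt (contMDiffAt_coeffs hV i)
    filter_upwards [eventually_eventually_nhds.2 hsrc, hc, eventually_mdifferentiableAt hf]
      with y hy hcy hfy
    have hy' := hy.self_of_nhds
    have e1 : ∀ᶠ z in 𝓝 y, V z = ∑ i, coeffs q (V z) i • frameField q (b i) (f z) :=
      hy.mono fun z hz ↦ sum_coeffs hz (V z)
    have hd : ∀ i, FieldDiffAt E' f (fun z ↦ frameField q (b i) (f z)) y := fun i ↦
      FieldDiffAt.comp (f := fun y : M ↦ y) (h := f)
        (fieldSmoothAt_frameField q hy' (b i)).diffAt hfy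
    rw [covAlong_congr g.inner e1, covAlong_sum g.inner _ hfy fun i _ ↦ (hd i).smul (hcy i)]
    refine Finset.sum_congr rfl fun i _ ↦ ?_
    rw [covAlong_smul g.inner (hcy i) (hd i)]
    congr 2
    have h3 := covAlong_comp g.inner (f := fun y : M ↦ y) (h := f)
        (fieldSmoothAt_frameField q hy' (b i)).diffAt hfy (X y)
    refine h3.trans ?_
    have h4 := sum_coeffs hy' (diff (E := E) (E' := E') f y (X y))
    refine (congrArg (cov g.inner (frameField q (b i)) (f y)) h4).trans ?_
    rw [cov_sum_vec]
    simp only [cov_smul_vec]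
    rfl
  refine FieldSmoothAt.congr ?_ hEV
  refine FieldSmoothAt.sum _ hf fun i _ ↦ ?_
  have hfi : FieldSmoothAt E' f (fun z ↦ frameField q (b i) (f z)) x :=
    FieldSmoothAt.comp (f := fun y : M ↦ y) (h := f) (hfr i) hf
  refine FieldSmoothAt.add ?_ ?_
  · exact FieldSmoothAt.smul (contMDiffAt_diffModel_apply (contMDiffAt_coeffs hV i) hX) hfi
  · refine FieldSmoothAt.smul (contMDiffAt_coeffs hV i) (FieldSmoothAt.sum _ hf fun j _ ↦ ?_)
    refine FieldSmoothAt.smul (contMDiffAt_coeffs (fieldSmoothAt_diff hf hX) j) ?_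
    exact FieldSmoothAt.comp (f := fun y : M ↦ y) (h := f)
      (fieldSmoothAt_cov g (hfr j) (hfr i)) hf

/-- The curvature endomorphisms are skew-symmetric. -/
lemma curvatureField_skew (g : RMetric E M) {X Y Z W : ∀ y : M, TangentSpace 𝓘(ℝ, E) y} {p : M}
    (hX : FieldSmoothAt E (fun y : M ↦ y) X p) (hY : FieldSmoothAt E (fun y : M ↦ y) Y p)
    (hZ : FieldSmoothAt E (fun y : M ↦ y) Z p) (hW : FieldSmoothAt E (fun y : M ↦ y) W p) :
    g.inner p (curvatureField g.inner X Y Z p) (W p) =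
      - g.inner p (Z p) (curvatureField g.inner X Y W p) := by
  have hZW := g.contMDiffAt_inner hZ hW
  -- The operator XY - YX - [X,Y] annihilates the function g(Z,W). Expanded by metric compatibility,
  -- this identity leaves only the two curvature terms.
  have hb := diffModel_mlieBracket (hZW.of_le (m := 2) (by norm_cast)) hX.diffAt hY.diffAt
  have step : ∀ (X Y : ∀ y : M, TangentSpace 𝓘(ℝ, E) y) (_ : FieldSmoothAt E (fun y : M ↦ y) Y p),
      diffModel (E := ℝ) (E' := E) (fun y ↦ diffModel (E := ℝ) (E' := E)
        (fun y ↦ g.inner y (Z y) (W y)) y (Y y)) p (X p) =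
      g.inner p (cov g.inner (fun y ↦ cov g.inner Z y (Y y)) p (X p)) (W p) +
        g.inner p (cov g.inner Z p (Y p)) (cov g.inner W p (X p)) +
        (g.inner p (cov g.inner Z p (X p)) (cov g.inner W p (Y p)) +
        g.inner p (Z p) (cov g.inner (fun y ↦ cov g.inner W y (Y y)) p (X p))) := by
    intro X Y hY
    have h1 : (fun y ↦ diffModel (E := ℝ) (E' := E) (fun y ↦ g.inner y (Z y) (W y)) y (Y y)) =ᶠ[𝓝 p]
        fun y ↦ g.inner y (cov g.inner Z y (Y y)) (W y) + g.inner y (Z y) (cov g.inner W y (Y y)) := by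
      filter_upwards [hZ.eventually_diffAt, hW.eventually_diffAt] with y h1 h2
      exact diff_inner (f := fun y : M ↦ y) (g.nondegAt y) h1 h2 (Y y)
    have hcZ := fieldSmoothAt_cov g hY hZ
    have hcW := fieldSmoothAt_cov g hY hW
    rw [diffModel_congr h1]
    have h2 := diff_inner (f := fun y : M ↦ y) (g.nondegAt p) hcZ.diffAt hW.diffAt (X p)
    have h3 := diff_inner (f := fun y : M ↦ y) (g.nondegAt p) hZ.diffAt hcW.diffAt (X p)
    have h4 := diffModel_add ((g.contMDiffAt_inner hcZ hW).mdifferentiableAt (by simp))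
      ((g.contMDiffAt_inner hZ hcW).mdifferentiableAt (by simp)) (X p)
    exact h4.trans (congrArg₂ (· + ·) h2 h3)
  have h5 := diff_inner (f := fun y : M ↦ y) (g.nondegAt p) hZ.diffAt hW.diffAt
    (VectorField.mlieBracket 𝓘(ℝ, E) X Y p)
  have h6 : _ = g.inner p (cov g.inner Z p (VectorField.mlieBracket 𝓘(ℝ, E) X Y p)) (W p) +
    g.inner p (Z p) (cov g.inner W p (VectorField.mlieBracket 𝓘(ℝ, E) X Y p)) := hb.trans h5
  rw [step X Y hY, step Y X hX] at h6
  simp only [curvatureField, map_sub, sub_apply]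
  linarith

/-- The curvature `R(X, Y) Z` at `p` depends only on the value of `Z` at `p`. -/
lemma curvatureField_congr_right (g : RMetric E M) {X Y Z Z' : ∀ y : M, TangentSpace 𝓘(ℝ, E) y}
    {p : M}
    (hX : FieldSmoothAt E (fun y : M ↦ y) X p) (hY : FieldSmoothAt E (fun y : M ↦ y) Y p)
    (hZ : FieldSmoothAt E (fun y : M ↦ y) Z p) (hZ' : FieldSmoothAt E (fun y : M ↦ y) Z' p)
    (h : Z p = Z' p) : curvatureField g.inner X Y Z p = curvatureField g.inner X Y Z' p := by
  -- Skew-symmetry moves `Z` to the slot where it is not differentiated, and there only its value at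
  -- `p` enters.
  refine g.ext fun u ↦ ?_
  have hu := fieldSmoothAt_coordField (mem_chart_source E p) u
  have h1 := curvatureField_skew g hX hY hZ hu
  have h2 := curvatureField_skew g hX hY hZ' hu
  rw [coordField_self] at h1 h2
  rw [h1, h2, h]

end LeviCivita

/-! ### Leibniz rules for bundle maps, in particular for endomorphism fields and differentials. -/

section BundleMap

variable {E : Type*} [NormedAddCommGroup E] [NormedSpace ℝ E] [FiniteDimensional ℝ E]
  {M : Type*} [TopologicalSpace M] [ChartedSpace E M] [IsManifold 𝓘(ℝ, E) ∞ M]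
  {E' : Type*} [NormedAddCommGroup E'] [NormedSpace ℝ E']
  {N : Type*} [TopologicalSpace N] [ChartedSpace E' N] [IsManifold 𝓘(ℝ, E') ∞ N]
  {E₁ : Type*} [NormedAddCommGroup E₁] [NormedSpace ℝ E₁]
  {B : Type*} [TopologicalSpace B] [ChartedSpace E₁ B] [IsManifold 𝓘(ℝ, E₁) ∞ B]

lemma diffModel_const_apply {G : Type*} [NormedAddCommGroup G] [NormedSpace ℝ G] (c : G) (x : N)
    (v : TangentSpace 𝓘(ℝ, E') x) : diffModel (E := G) (E' := E') (fun _ : N ↦ c) x v = 0 := by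
  rw [diffModel_const]; rfl

lemma covAlong_const_smul (g : BilinField E M) {f : N → M} {V : ∀ y : N, TangentSpace 𝓘(ℝ, E) (f y)}
    {x : N} (a : ℝ) (hV : FieldDiffAt E' f V x) (v : TangentSpace 𝓘(ℝ, E') x) :
    covAlong g f (fun y ↦ a • V y) x v = a • covAlong g f V x v := by
  rw [covAlong_smul g (k := fun _ : N ↦ a) mdifferentiableAt_const hV, diffModel_const_apply,
    zero_smul, zero_add]

lemma covAlong_zero (g : BilinField E M) {f : N → M} {x : N}
    (hf : MDifferentiableAt 𝓘(ℝ, E') 𝓘(ℝ, E) f x) (v : TangentSpace 𝓘(ℝ, E') x) :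
    covAlong g f (fun y ↦ (0 : TangentSpace 𝓘(ℝ, E) (f y))) x v = 0 := by
  have := covAlong_const_smul g (0 : ℝ) (FieldDiffAt.zero hf) v
  simpa using this

/-- Leibniz rule for a family of vector fields along `r`, depending linearly on a parameter. -/
lemma covAlong_family (gB : BilinField E₁ B) {r : M → B} {F : N → M} {x : N}
    (L : ∀ z : M, E →L[ℝ] TangentSpace 𝓘(ℝ, E₁) (r z))
    (hL : ∀ a, FieldSmoothAt E r (fun z ↦ L z a) (F x))
    (hF : MDifferentiableAt 𝓘(ℝ, E') 𝓘(ℝ, E) F x)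
    {w : N → E} (hw : MDifferentiableAt 𝓘(ℝ, E') 𝓘(ℝ, E) w x) (v : TangentSpace 𝓘(ℝ, E') x) :
    covAlong gB (fun y ↦ r (F y)) (fun y ↦ L (F y) (w y)) x v =
      L (F x) (diffModel (E := E) (E' := E') w x v) +
        covAlong gB r (fun z ↦ L z (w x)) (F x) (diffModel (E := E) (E' := E') F x v) := by
  -- The components of `L` in the chart at `r (F x)`; the ordinary product rule applies to `A` and
  -- `w`, and the Christoffel term, which sees only values at `x`, is the same on both sides.
  set A : M → E →L[ℝ] E₁ := fun z ↦ (componentsL (r (F x)) (r z)).comp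
    (L z : E →L[ℝ] E₁) with hA
  have hAs : ContMDiffAt 𝓘(ℝ, E) 𝓘(ℝ, E →L[ℝ] E₁) ∞ A (F x) :=
    contMDiffAt_clm_of_apply fun a ↦ (fieldSmoothAt_iff.1 (hL a)).2
  have hAd : MDifferentiableAt 𝓘(ℝ, E) 𝓘(ℝ, E →L[ℝ] E₁) A (F x) := hAs.mdifferentiableAt (by simp)
  have hAF : MDifferentiableAt 𝓘(ℝ, E') 𝓘(ℝ, E →L[ℝ] E₁) (fun y ↦ A (F y)) x :=
    MDifferentiableAt.comp (g := A) (f := F) x hAd hF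
  have h3 := fun u ↦ diffModel_clm_app hAd
    (mdifferentiableAt_const (c := w x) (I := 𝓘(ℝ, E)) (I' := 𝓘(ℝ, E))) u
  let Lx : E →L[ℝ] E₁ := L (F x)
  have h5 : ∀ a, A (F x) a = Lx a := fun a ↦ componentsL_self (E := E₁) (r (F x)) _
  have key : ∀ u : E', diffModel (E := E₁) (E' := E') (fun y ↦ A (F y) (w y)) x u +
      chris gB (r (F x)) (diffModel (E := E₁) (E' := E') (fun y ↦ r (F y)) x u) (Lx (w x)) =
      Lx (diffModel (E := E) (E' := E') w x u) +
      (diffModel (E := E₁) (E' := E) (fun z ↦ A z (w x)) (F x) (diffModel (E := E) (E' := E') F x u) +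
      chris gB (r (F x)) (diffModel (E := E₁) (E' := E) r (F x) (diffModel (E := E) (E' := E') F x u))
        (Lx (w x))) := by
    intro u
    rw [diffModel_clm_app hAF hw u, diffModel_comp hAd hF u, h3, diffModel_const,
      diffModel_comp' ((hL 0).base.mdifferentiableAt (by simp)) hF u, h5]
    simp only [zero_apply, map_zero, add_zero]
    abel
  exact key v

/-- The covariant derivative of `Φ V`, for a bundle map `Φ` over `r` and a field `V` along `F`. -/
lemma covAlong_bundleMap (g : BilinField E M) (gB : BilinField E₁ B) {r : M → B} {F : N → M} {x : N}
    (Φ : ∀ z : M, TangentSpace 𝓘(ℝ, E) z →L[ℝ] TangentSpace 𝓘(ℝ, E₁) (r z))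
    (hΦ : ∀ a, FieldSmoothAt E r (fun z ↦ Φ z (frameField (F x) a z)) (F x))
    {V : ∀ y : N, TangentSpace 𝓘(ℝ, E) (F y)} (hV : FieldDiffAt E' F V x)
    (v : TangentSpace 𝓘(ℝ, E') x) :
    covAlong gB (fun y ↦ r (F y)) (fun y ↦ Φ (F y) (V y)) x v =
      Φ (F x) (covAlong g F V x v) +
        (covAlong gB r (fun z ↦ Φ z (coordField (V x) z)) (F x)
          (diff (E := E) (E' := E') F x v) -
          Φ (F x) (cov g (coordField (V x)) (F x) (diff (E := E) (E' := E') F x v))) := by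
  obtain ⟨hF, hw⟩ := fieldDiffAt_iff.1 hV
  set w : N → E := fun y ↦ components (F x) (V y)
  have hsrc : ∀ᶠ y in 𝓝 x, F y ∈ (chartAt E (F x)).source :=
    hF.continuousAt.preimage_mem_nhds (chart_source_mem_nhds E (F x))
  have hVw : ∀ᶠ y in 𝓝 x, V y = frameField (F x) (w y) (F y) :=
    hsrc.mono fun y hy ↦ (frameAt_componentsL (E := E) hy (V y)).symm
  have hco : ∀ᶠ z in 𝓝 (F x), coordField (V x) z = frameField (F x) (w x) z := by
    filter_upwards [chart_source_mem_nhds E (F x)] with z hz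
    rw [coordField_eq hz]
    exact congrArg (frameAt (E := E) (F x) z) (components_self (V x)).symm
  -- Both ∇(ΦV) and ∇V are computed in the coordinate frame at `F x`. The derivatives of the
  -- components of `V` match, and the difference involves only the extension of `V x` with constant
  -- components, that is, the covariant derivative of Φ.
  have h1 := covAlong_family gB (r := r) (F := F) (x := x)
    (fun z ↦ (Φ z).comp (frameAt (E := E) (F x) z : E →L[ℝ] TangentSpace 𝓘(ℝ, E) z)) hΦ hF hw v
  have h2 := covAlong_family g (r := fun z : M ↦ z) (F := F) (x := x)
    (fun z ↦ (frameAt (E := E) (F x) z : E →L[ℝ] TangentSpace 𝓘(ℝ, E) z))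
    (fun a ↦ fieldSmoothAt_frameField (F x) (mem_chart_source E (F x)) a) hF hw v
  rw [covAlong_congr gB (hVw.mono fun y hy ↦ congrArg (Φ (F y)) hy),
    covAlong_congr g hVw, cov, covAlong_congr g hco,
    covAlong_congr gB (hco.mono fun z hz ↦ congrArg (Φ z) hz)]
  refine h1.trans ?_
  have h3 : covAlong g F (fun y ↦ frameField (F x) (w y) (F y)) x v = _ := h2
  rw [h3, map_add]
  have key : ∀ a b c : TangentSpace 𝓘(ℝ, E₁) (r (F x)), a + b = a + c + (b - c) := by
    intro a b c; abel
  exact key _ _ _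

lemma fieldSmoothAt_clm (Φ : ∀ z : M, TangentSpace 𝓘(ℝ, E) z →L[ℝ] TangentSpace 𝓘(ℝ, E) z)
    (hΦ : ContMDiff 𝓘(ℝ, E) (𝓘(ℝ, E).prod 𝓘(ℝ, E →L[ℝ] E)) ∞
    (fun x ↦ TotalSpace.mk' (E →L[ℝ] E)
      (E := fun x : M ↦ TangentSpace 𝓘(ℝ, E) x →L[ℝ] TangentSpace 𝓘(ℝ, E) x) x (Φ x)))
    {F : N → M} {x : N} {V : ∀ y : N, TangentSpace 𝓘(ℝ, E) (F y)} (hV : FieldSmoothAt E' F V x) :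
    FieldSmoothAt E' F (fun y ↦ Φ (F y) (V y)) x := by
  apply ContMDiffAt.clm_bundle_apply (F₁ := E) (F₂ := E)
  · exact ContMDiffAt.comp (f := F) x hΦ.contMDiffAt hV.base
  · exact hV

lemma contMDiffAt_form (θ : ∀ z : M, TangentSpace 𝓘(ℝ, E) z →L[ℝ] ℝ)
    (hθ : ContMDiff 𝓘(ℝ, E) (𝓘(ℝ, E).prod 𝓘(ℝ, E →L[ℝ] ℝ)) ∞
    (fun x ↦ TotalSpace.mk' (E →L[ℝ] ℝ)
      (E := fun x : M ↦ TangentSpace 𝓘(ℝ, E) x →L[ℝ] Bundle.Trivial M ℝ x) x (θ x)))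
    {F : N → M} {x : N} {V : ∀ y : N, TangentSpace 𝓘(ℝ, E) (F y)} (hV : FieldSmoothAt E' F V x) :
    ContMDiffAt 𝓘(ℝ, E') 𝓘(ℝ, ℝ) ∞ (fun y ↦ θ (F y) (V y)) x := by
  have : ContMDiffAt 𝓘(ℝ, E') (𝓘(ℝ, E).prod 𝓘(ℝ)) ∞
      (fun m ↦ TotalSpace.mk' ℝ (E := Bundle.Trivial M ℝ) (F m) (θ (F m) (V m))) x := by
    apply ContMDiffAt.clm_bundle_apply (F₁ := E)
    · exact ContMDiffAt.comp (f := F) x hθ.contMDiffAt hV.base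
    · exact hV
  simp only [contMDiffAt_totalSpace] at this
  exact this.2

/-- `covAlong_bundleMap` over the identity of `M`; its correction term is `covEndo` by definition.
-/
lemma covAlong_endo (g : RMetric E M)
    (Φ : ∀ z : M, TangentSpace 𝓘(ℝ, E) z →L[ℝ] TangentSpace 𝓘(ℝ, E) z)
    (hΦ : ContMDiff 𝓘(ℝ, E) (𝓘(ℝ, E).prod 𝓘(ℝ, E →L[ℝ] E)) ∞
    (fun x ↦ TotalSpace.mk' (E →L[ℝ] E)
      (E := fun x : M ↦ TangentSpace 𝓘(ℝ, E) x →L[ℝ] TangentSpace 𝓘(ℝ, E) x) x (Φ x)))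
    {F : N → M} {x : N} {V : ∀ y : N, TangentSpace 𝓘(ℝ, E) (F y)} (hV : FieldDiffAt E' F V x)
    (v : TangentSpace 𝓘(ℝ, E') x) :
    covAlong g.inner F (fun y ↦ Φ (F y) (V y)) x v =
      Φ (F x) (covAlong g.inner F V x v) + covEndo g.inner Φ (F x) (diff F x v) (V x) :=
  covAlong_bundleMap g.inner g.inner (r := fun z : M ↦ z) Φ
    (fun a ↦ fieldSmoothAt_clm Φ hΦ (fieldSmoothAt_frameField (F x) (mem_chart_source E (F x)) a)) hV v

/-- `covAlong_bundleMap` for the differential of `r`; the correction term is ∇dr. This is how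
derivatives of T on the cylinder are compared with derivatives of the velocity of the base curve. -/
lemma covAlong_diff (g : RMetric E M) (gB : RMetric E₁ B) {r : M → B} {F : N → M} {x : N}
    (hr : ContMDiffAt 𝓘(ℝ, E) 𝓘(ℝ, E₁) ∞ r (F x))
    {V : ∀ y : N, TangentSpace 𝓘(ℝ, E) (F y)} (hV : FieldDiffAt E' F V x)
    (v : TangentSpace 𝓘(ℝ, E') x) :
    covAlong gB.inner (fun y ↦ r (F y)) (fun y ↦ diff (E := E₁) (E' := E) r (F y) (V y)) x v =
      diff (E := E₁) (E' := E) r (F x) (covAlong g.inner F V x v) +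
        secondFundamentalForm g.inner gB.inner r (F x) (diff F x v) (V x) :=
  covAlong_bundleMap g.inner gB.inner (r := r) (fun z ↦ diff (E := E₁) (E' := E) r z)
    (fun a ↦ fieldSmoothAt_diff hr (fieldSmoothAt_frameField (F x) (mem_chart_source E (F x)) a)) hV v

end BundleMap

/-! ### Algebra of a Sasaki structure; derivative and curvature of the Reeb field. -/

section Sasaki

variable {M : Type*} [TopologicalSpace M] [ChartedSpace (Euc 3) M]
  [IsManifold 𝓘(ℝ, Euc 3) ∞ M]
  {E' : Type*} [NormedAddCommGroup E'] [NormedSpace ℝ E']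
  {N : Type*} [TopologicalSpace N] [ChartedSpace E' N] [IsManifold 𝓘(ℝ, E') ∞ N]
  {g : RMetric (Euc 3) M}
  {η : ∀ x : M, TangentSpace 𝓘(ℝ, Euc 3) x →L[ℝ] ℝ}
  {ξ : ∀ x : M, TangentSpace 𝓘(ℝ, Euc 3) x}
  {φ : ∀ x : M, TangentSpace 𝓘(ℝ, Euc 3) x →L[ℝ] TangentSpace 𝓘(ℝ, Euc 3) x}

lemma IsSasaki.inner_xi_xi (S : IsSasaki g η ξ φ) (x : M) : g.inner x (ξ x) (ξ x) = 1 := by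
  rw [S.metric_xi, S.eta_xi]

/-- By compatibility |φξ|² = |ξ|² - η(ξ)² = 0. -/
lemma IsSasaki.phi_xi (S : IsSasaki g η ξ φ) (x : M) : φ x (ξ x) = 0 := by
  apply g.eq_zero
  rw [S.compatible, S.inner_xi_xi, S.eta_xi]
  norm_num

/-- Evaluating φ³u as φ²(φu) and as φ(φ²u) gives η(φu)ξ = 0. -/
lemma IsSasaki.eta_phi (S : IsSasaki g η ξ φ) (x : M) (u : TangentSpace 𝓘(ℝ, Euc 3) x) :
    η x (φ x u) = 0 := by
  have h1 := S.phi_sq x (φ x u)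
  rw [S.phi_sq x u, map_add, map_neg, map_smul, S.phi_xi, smul_zero, add_zero] at h1
  have h2 := congrArg (η x) h1
  simp only [map_neg, map_add, map_smul, S.eta_xi, smul_eq_mul, mul_one] at h2
  linarith

/-- Compatibility for the pair u, φv, together with φ²v = -v + η(v)ξ and η∘φ = 0. -/
lemma IsSasaki.inner_phi (S : IsSasaki g η ξ φ) (x : M) (u v : TangentSpace 𝓘(ℝ, Euc 3) x) :
    g.inner x (φ x u) v = - g.inner x u (φ x v) := by
  have h1 := S.compatible x u (φ x v)
  rw [S.phi_sq, S.eta_phi, map_add, map_neg, map_smul, g.symm x (φ x u) (ξ x), S.metric_xi,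
    S.eta_phi] at h1
  simp only [smul_zero, mul_zero] at h1
  linarith

lemma IsSasaki.inner_phi_self (S : IsSasaki g η ξ φ) (x : M) (u : TangentSpace 𝓘(ℝ, Euc 3) x) :
    g.inner x u (φ x u) = 0 := by
  have h1 := S.inner_phi x u u
  rw [g.symm] at h1
  linarith

/-- `∇ ξ = - φ`. -/
lemma IsSasaki.covAlong_xi (S : IsSasaki g η ξ φ) {F : N → M} {x : N}
    (hF : MDifferentiableAt 𝓘(ℝ, E') 𝓘(ℝ, Euc 3) F x) (v : TangentSpace 𝓘(ℝ, E') x) :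
    covAlong g.inner F (fun y ↦ ξ (F y)) x v = - φ (F x) (diff F x v) := by
  have hξ : FieldDiffAt E' F (fun y ↦ ξ (F y)) x :=
    FieldDiffAt.comp (f := fun y : M ↦ y) (h := F) (S.smooth_xi.contMDiffAt.mdifferentiableAt (by simp)) hF
  have h1 := covAlong_endo g φ S.smooth_phi hξ v
  have h0 : covAlong g.inner F (fun y ↦ φ (F y) (ξ (F y))) x v = 0 := by
    simp only [S.phi_xi]
    exact covAlong_zero g.inner hF v
  rw [h0, S.sasaki, S.eta_xi, g.symm, S.metric_xi, one_smul] at h1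
  -- Since |ξ| = 1, ∇ξ is orthogonal to ξ and φ² acts on it as -1. Applying φ to the derivative of
  -- φξ = 0 therefore isolates ∇ξ.
  have h3 : g.inner (F x) (covAlong g.inner F (fun y ↦ ξ (F y)) x v) (ξ (F x)) = 0 := by
    have h2 := diff_inner (g.nondegAt (F x)) hξ hξ v
    have h4 : (fun y ↦ g.inner (F y) (ξ (F y)) (ξ (F y))) = fun _ ↦ (1 : ℝ) :=
      funext fun y ↦ S.inner_xi_xi (F y)
    rw [h4, diffModel_const_apply, g.symm (F x) (ξ (F x))] at h2
    linarith
  have h5 := congrArg (φ (F x)) h1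
  rw [g.symm, S.metric_xi] at h3
  simp only [map_zero, map_add, map_sub, map_smul, S.phi_xi, S.phi_sq, h3] at h5
  simp only [zero_smul, smul_zero, add_zero, zero_sub] at h5
  rw [eq_comm, ← sub_eq_add_neg, neg_sub_left, neg_eq_zero] at h5
  rw [eq_neg_iff_add_eq_zero, add_comm]
  exact h5

lemma IsSasaki.fieldSmoothAt_xi (S : IsSasaki g η ξ φ) {F : N → M} {x : N}
    (hF : ContMDiffAt 𝓘(ℝ, E') 𝓘(ℝ, Euc 3) ∞ F x) :
    FieldSmoothAt E' F (fun y ↦ ξ (F y)) x :=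
  FieldSmoothAt.comp (f := fun y : M ↦ y) (h := F) (S.smooth_xi.contMDiffAt) hF

/-- `R(u, v) ξ = η(v) u - η(u) v`. -/
lemma IsSasaki.curvature_xi (S : IsSasaki g η ξ φ) (p : M) (u v : TangentSpace 𝓘(ℝ, Euc 3) p) :
    curvature g.inner p u v (ξ p) = η p v • u - η p u • v := by
  have hs : ∀ w : TangentSpace 𝓘(ℝ, Euc 3) p, FieldSmoothAt (Euc 3) (fun y : M ↦ y) (coordField w) p :=
    fun w ↦ fieldSmoothAt_coordField (mem_chart_source _ p) w
  have hξ : FieldSmoothAt (Euc 3) (fun y : M ↦ y) ξ p := S.smooth_xi.contMDiffAt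
  rw [curvature, curvatureField_congr_right g (hs u) (hs v) (hs (ξ p)) hξ (coordField_self _)]
  have hcov : ∀ (y : M) (w : TangentSpace 𝓘(ℝ, Euc 3) y), cov g.inner ξ y w = - φ y w := by
    intro y w
    have := S.covAlong_xi (F := fun y : M ↦ y) (x := y) mdifferentiableAt_id w
    refine this.trans ?_
    congr 2
    exact diffModel_id (E := Euc 3) y w
  -- ∇_a∇_bξ = -∇_a(φb) = -φ(∇_a b) - (∇_a φ)b. After antisymmetrisation the φ-terms cancel against
  -- the bracket term, by absence of torsion, and the terms in g(a,b)ξ cancel each other.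
  have hstep : ∀ a b : TangentSpace 𝓘(ℝ, Euc 3) p,
      cov g.inner (fun y ↦ cov g.inner ξ y (coordField b y)) p (coordField a p) =
      - (φ p (cov g.inner (coordField b) p a) + (g.inner p a b • ξ p - η p b • a)) := by
    intro a b
    have hφ : FieldSmoothAt (Euc 3) (fun y : M ↦ y) (fun y ↦ φ y (coordField b y)) p :=
      fieldSmoothAt_clm φ S.smooth_phi (hs b)
    have e1 : (fun y ↦ cov g.inner ξ y (coordField b y)) = fun y ↦ (-1 : ℝ) • φ y (coordField b y) := by
      funext y; rw [hcov, neg_one_smul]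
    rw [e1, coordField_self]
    have h2 := covAlong_const_smul g.inner (f := fun y : M ↦ y) (x := p) (-1 : ℝ) hφ.diffAt a
    refine h2.trans ?_
    have h3 := covAlong_endo g φ S.smooth_phi (F := fun y : M ↦ y) (x := p) (hs b).diffAt a
    rw [h3]
    have h4 : diff (E := Euc 3) (E' := Euc 3) (fun y : M ↦ y) p a = a := diffModel_id (E := Euc 3) p a
    rw [h4, coordField_self, S.sasaki, neg_one_smul]
    rfl
  rw [curvatureField, hstep, hstep, hcov]
  have ht := cov_torsion (g.nondegAt p) (hs u).diffAt (hs v).diffAt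
  rw [coordField_self, coordField_self] at ht
  rw [← ht, map_sub, g.symm p v u]
  abel

end Sasaki

/-- The functionals β(·, e_j) are dual to the vectors e_i, which are thus independent and, by the
dimension count, a basis. Linearity in the first argument is all this takes. -/
lemma sum_orthonormal {V ι : Type*} [AddCommGroup V] [Module ℝ V] [FiniteDimensional ℝ V]
    [Fintype ι] [DecidableEq ι] (β : V → V → ℝ) (e : ι → V)
    (hadd : ∀ u v w, β (u + v) w = β u w + β v w) (hsmul : ∀ (a : ℝ) u w, β (a • u) w = a * β u w)
    (he : ∀ i j, β (e i) (e j) = if i = j then 1 else 0)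
    (hc : Fintype.card ι = Module.finrank ℝ V) (v : V) : v = ∑ i, β v (e i) • e i := by
  let L : ι → V →ₗ[ℝ] ℝ := fun j ↦
    { toFun := fun u ↦ β u (e j), map_add' := fun u w ↦ hadd u w _, map_smul' := fun a u ↦ hsmul a u _ }
  have hL : ∀ (a : ι → ℝ) (j : ι), L j (∑ i, a i • e i) = a j := by
    intro a j
    have : ∀ i, L j (e i) = if i = j then 1 else 0 := fun i ↦ he i j
    simp [map_sum, this]
  have hli : LinearIndependent ℝ e := by
    rw [Fintype.linearIndependent_iff]
    intro a ha i
    rw [← hL a i, ha, map_zero]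
  have hv : v ∈ Submodule.span ℝ (Set.range e) := by
    rw [hli.span_eq_top_of_card_eq_finrank' hc]; trivial
  obtain ⟨a, ha⟩ := (Submodule.mem_span_range_iff_exists_fun ℝ).1 hv
  conv_lhs => rw [← ha]
  refine Finset.sum_congr rfl fun i _ ↦ ?_
  rw [← hL a i, ha]
  rfl

/-! ### Tensoriality of second fundamental forms and Hessians; multilinearity of the curvature. -/

section Tensor

variable {E : Type*} [NormedAddCommGroup E] [NormedSpace ℝ E]
  {M : Type*} [TopologicalSpace M] [ChartedSpace E M] [IsManifold 𝓘(ℝ, E) ∞ M]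
  {E' : Type*} [NormedAddCommGroup E'] [NormedSpace ℝ E']
  {N : Type*} [TopologicalSpace N] [ChartedSpace E' N] [IsManifold 𝓘(ℝ, E') ∞ N]

lemma eventually_coordField_add {q : M} (u v : TangentSpace 𝓘(ℝ, E) q) :
    ∀ᶠ y in 𝓝 q, coordField (u + v) y = coordField u y + coordField v y := by
  filter_upwards [chart_source_mem_nhds E q] with y hy
  rw [coordField_eq hy, coordField_eq hy, coordField_eq hy]
  exact map_add (frameAt (E := E) q y) _ _

lemma eventually_coordField_smul {q : M} (a : ℝ) (v : TangentSpace 𝓘(ℝ, E) q) :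
    ∀ᶠ y in 𝓝 q, coordField (a • v) y = a • coordField v y := by
  filter_upwards [chart_source_mem_nhds E q] with y hy
  rw [coordField_eq hy, coordField_eq hy]
  exact map_smul (frameAt (E := E) q y) _ _

variable [FiniteDimensional ℝ E'] [FiniteDimensional ℝ E]

/-- `v ↦ ∇_v V` as a continuous linear map. -/
def covL (g : BilinField E M) (f : N → M) (V : ∀ y : N, TangentSpace 𝓘(ℝ, E) (f y)) (y : N) :
    TangentSpace 𝓘(ℝ, E') y →L[ℝ] TangentSpace 𝓘(ℝ, E) (f y) :=
  LinearMap.toContinuousLinearMap (𝕜 := ℝ) (E := E') (F' := E)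
    { toFun := fun v ↦ covAlong g f V y v
      map_add' := fun u v ↦ covAlong_add_vec g u v
      map_smul' := fun a v ↦ covAlong_smul_vec g a v }

/-- `(∇ df)(u, X) = ∇_u (df X) - df (∇_u X)` for every vector field `X`. -/
lemma secondFundamentalForm_eq (h : BilinField E' N) (g : BilinField E M) {f : N → M} {x : N}
    (hf : ContMDiffAt 𝓘(ℝ, E') 𝓘(ℝ, E) ∞ f x) {X : ∀ y : N, TangentSpace 𝓘(ℝ, E') y}
    (hX : FieldDiffAt E' (fun y : N ↦ y) X x) (u : TangentSpace 𝓘(ℝ, E') x) :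
    secondFundamentalForm h g f x u (X x) =
      covAlong g f (fun y ↦ diff f y (X y)) x u - diff f x (cov h X x u) := by
  have := covAlong_bundleMap h g (r := f) (F := fun y : N ↦ y) (x := x)
    (fun z ↦ diff (E := E) (E' := E') f z)
    (fun a ↦ fieldSmoothAt_diff hf (fieldSmoothAt_frameField x (mem_chart_source E' x) a)) hX u
  have h1 : diff (E := E') (E' := E') (fun y : N ↦ y) x u = u := diffModel_id (E := E') x u
  rw [h1] at this
  rw [secondFundamentalForm]
  have key : ∀ a b c : TangentSpace 𝓘(ℝ, E) (f x), a = b + c → c = a - b := by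
    intro a b c h; rw [h]; abel
  exact key _ _ _ this

/-- The Hessian `∇_u ∇_X V - ∇_{∇_u X} V` depends on `X` only through its value. -/
lemma hessian_eq (h : BilinField E' N) (g : RMetric E M) {f : N → M} {x : N}
    {V : ∀ y : N, TangentSpace 𝓘(ℝ, E) (f y)} (hV : FieldSmoothAt E' f V x)
    {X : ∀ y : N, TangentSpace 𝓘(ℝ, E') y}
    (hX : FieldDiffAt E' (fun y : N ↦ y) X x) (u : TangentSpace 𝓘(ℝ, E') x) :
    covAlong g.inner f (fun y ↦ covAlong g.inner f V y (coordField (X x) y)) x u -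
        covAlong g.inner f V x (cov h (coordField (X x)) x u) =
      covAlong g.inner f (fun y ↦ covAlong g.inner f V y (X y)) x u -
        covAlong g.inner f V x (cov h X x u) := by
  have := covAlong_bundleMap h g.inner (r := f) (F := fun y : N ↦ y) (x := x)
    (fun z ↦ covL g.inner f V z)
    (fun a ↦ fieldSmoothAt_covAlong g (fieldSmoothAt_frameField x (mem_chart_source E' x) a) hV) hX u
  have h1 : diff (E := E') (E' := E') (fun y : N ↦ y) x u = u := diffModel_id (E := E') x u
  rw [h1] at this
  have key : ∀ a b c : TangentSpace 𝓘(ℝ, E) (f x), a = b + c → c = a - b := by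
    intro a b c h; rw [h]; abel
  exact key _ _ _ this

lemma secondFundamentalForm_add_left (h : BilinField E' N) (g : BilinField E M) (f : N → M) (x : N)
    (u u' v : TangentSpace 𝓘(ℝ, E') x) : secondFundamentalForm h g f x (u + u') v =
      secondFundamentalForm h g f x u v + secondFundamentalForm h g f x u' v := by
  rw [secondFundamentalForm, secondFundamentalForm, secondFundamentalForm, covAlong_add_vec, cov,
    covAlong_add_vec]
  erw [map_add]
  abel

lemma secondFundamentalForm_smul_left (h : BilinField E' N) (g : BilinField E M) (f : N → M) (x : N)
    (a : ℝ) (u v : TangentSpace 𝓘(ℝ, E') x) : secondFundamentalForm h g f x (a • u) v =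
      a • secondFundamentalForm h g f x u v := by
  rw [secondFundamentalForm, secondFundamentalForm, covAlong_smul_vec, cov,
    covAlong_smul_vec]
  erw [map_smul]
  rw [smul_sub]
  rfl

/-- By `secondFundamentalForm_eq` the sum v + v' may be extended by the sum of two coordinate
fields, where additivity of the derivative applies. The lemmas on multiples and on Hessians below
use the same device. -/
lemma secondFundamentalForm_add_right (h : BilinField E' N) (g : BilinField E M) {f : N → M} {x : N}
    (hf : ContMDiffAt 𝓘(ℝ, E') 𝓘(ℝ, E) ∞ f x)
    (u v v' : TangentSpace 𝓘(ℝ, E') x) : secondFundamentalForm h g f x u (v + v') =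
      secondFundamentalForm h g f x u v + secondFundamentalForm h g f x u v' := by
  have hs : ∀ w : TangentSpace 𝓘(ℝ, E') x, FieldSmoothAt E' (fun y : N ↦ y) (coordField w) x :=
    fun w ↦ fieldSmoothAt_coordField (mem_chart_source _ x) w
  have h1 := secondFundamentalForm_eq h g hf ((hs v).add (hs v')).diffAt u
  rw [coordField_self, coordField_self] at h1
  rw [h1, secondFundamentalForm, secondFundamentalForm, cov, cov, cov,
    covAlong_add h (hs v).diffAt (hs v').diffAt]
  have h2 := covAlong_add g (fieldSmoothAt_diff hf (hs v)).diffAt (fieldSmoothAt_diff hf (hs v')).diffAt u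
  have h3 : ∀ y, diff (E := E) (E' := E') f y (coordField v y + coordField v' y) =
    diff f y (coordField v y) + diff f y (coordField v' y) := fun y ↦ map_add _ _ _
  simp only [h3]
  rw [h2]
  erw [map_add]
  abel

lemma secondFundamentalForm_smul_right (h : BilinField E' N) (g : BilinField E M) {f : N → M} {x : N}
    (hf : ContMDiffAt 𝓘(ℝ, E') 𝓘(ℝ, E) ∞ f x) (a : ℝ)
    (u v : TangentSpace 𝓘(ℝ, E') x) : secondFundamentalForm h g f x u (a • v) =
      a • secondFundamentalForm h g f x u v := by
  have hs : ∀ w : TangentSpace 𝓘(ℝ, E') x, FieldSmoothAt E' (fun y : N ↦ y) (coordField w) x :=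
    fun w ↦ fieldSmoothAt_coordField (mem_chart_source _ x) w
  have h1 := secondFundamentalForm_eq h g hf ((hs v).smul (k := fun _ ↦ a) contMDiffAt_const).diffAt u
  rw [coordField_self] at h1
  rw [h1, secondFundamentalForm, cov, cov, covAlong_const_smul h a (hs v).diffAt]
  have h2 := covAlong_const_smul g a (fieldSmoothAt_diff hf (hs v)).diffAt u
  have h3 : ∀ y, diff (E := E) (E' := E') f y (a • coordField v y) =
    a • diff f y (coordField v y) := fun y ↦ map_smul _ _ _
  simp only [h3]
  rw [h2]
  erw [map_smul]
  rw [smul_sub]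

lemma hessian_add_right (h : BilinField E' N) (g : RMetric E M) {f : N → M} {x : N}
    {V : ∀ y : N, TangentSpace 𝓘(ℝ, E) (f y)} (hV : FieldSmoothAt E' f V x)
    (u v v' : TangentSpace 𝓘(ℝ, E') x) :
    covAlong g.inner f (fun y ↦ covAlong g.inner f V y (coordField (v + v') y)) x u -
        covAlong g.inner f V x (cov h (coordField (v + v')) x u) =
      (covAlong g.inner f (fun y ↦ covAlong g.inner f V y (coordField v y)) x u -
        covAlong g.inner f V x (cov h (coordField v) x u)) +
      (covAlong g.inner f (fun y ↦ covAlong g.inner f V y (coordField v' y)) x u -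
        covAlong g.inner f V x (cov h (coordField v') x u)) := by
  have hs : ∀ w : TangentSpace 𝓘(ℝ, E') x, FieldSmoothAt E' (fun y : N ↦ y) (coordField w) x :=
    fun w ↦ fieldSmoothAt_coordField (mem_chart_source _ x) w
  have h1 := hessian_eq h g hV ((hs v).add (hs v')).diffAt u
  rw [coordField_self, coordField_self] at h1
  have h2 := covAlong_add g.inner (fieldSmoothAt_covAlong g (hs v) hV).diffAt
    (fieldSmoothAt_covAlong g (hs v') hV).diffAt u
  have h3 : ∀ y, covAlong g.inner f V y (coordField v y + coordField v' y) = _ :=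
    fun y ↦ covAlong_add_vec g.inner _ _
  have h4 := covAlong_add h (hs v).diffAt (hs v').diffAt u
  rw [h1]
  simp only [h3]
  rw [h2, cov, cov, cov, h4]
  erw [covAlong_add_vec]
  abel

lemma hessian_smul_right (h : BilinField E' N) (g : RMetric E M) {f : N → M} {x : N}
    {V : ∀ y : N, TangentSpace 𝓘(ℝ, E) (f y)} (hV : FieldSmoothAt E' f V x) (a : ℝ)
    (u v : TangentSpace 𝓘(ℝ, E') x) :
    covAlong g.inner f (fun y ↦ covAlong g.inner f V y (coordField (a • v) y)) x u -
        covAlong g.inner f V x (cov h (coordField (a • v)) x u) =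
      a • (covAlong g.inner f (fun y ↦ covAlong g.inner f V y (coordField v y)) x u -
        covAlong g.inner f V x (cov h (coordField v) x u)) := by
  have hs : ∀ w : TangentSpace 𝓘(ℝ, E') x, FieldSmoothAt E' (fun y : N ↦ y) (coordField w) x :=
    fun w ↦ fieldSmoothAt_coordField (mem_chart_source _ x) w
  have h1 := hessian_eq h g hV ((hs v).smul (k := fun _ ↦ a) contMDiffAt_const).diffAt u
  rw [coordField_self] at h1
  have h2 := covAlong_const_smul g.inner a (fieldSmoothAt_covAlong g (hs v) hV).diffAt u
  have h3 : ∀ y, covAlong g.inner f V y (a • coordField v y) = _ :=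
    fun y ↦ covAlong_smul_vec g.inner _ _
  have h4 := covAlong_const_smul h a (hs v).diffAt u
  rw [h1]
  simp only [h3]
  rw [h2, cov, cov, h4]
  erw [covAlong_smul_vec]
  rw [smul_sub]

lemma mlieBracket_coordField {p : M} (u v : TangentSpace 𝓘(ℝ, E) p) :
    VectorField.mlieBracket 𝓘(ℝ, E) (coordField u) (coordField v) p = 0 := by
  have hs : ∀ w : TangentSpace 𝓘(ℝ, E) p, FieldSmoothAt E (fun y : M ↦ y) (coordField w) p :=
    fun w ↦ fieldSmoothAt_coordField (mem_chart_source _ p) w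
  have hc : ∀ w : TangentSpace 𝓘(ℝ, E) p,
      diffModel (E := E) (E' := E) (fun y ↦ components p (coordField w y)) p = 0 := by
    intro w
    refine (diffModel_congr (E := E) (M := E) (f' := fun _ : M ↦ (w : E)) ?_).trans (diffModel_const _ _)
    filter_upwards [chart_source_mem_nhds E p] with y hy
    rw [coordField_eq hy]
    exact componentsL_frameAt hy w
  rw [mlieBracket_eq (hs u).diffAt (hs v).diffAt, hc, hc]
  exact sub_self _

/-- Second covariant derivatives of coordinate fields. -/
def covCov (g : BilinField E M) (p : M) (u v w : TangentSpace 𝓘(ℝ, E) p) : TangentSpace 𝓘(ℝ, E) p :=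
  cov g (fun y ↦ cov g (coordField w) y (coordField v y)) p u

/-- Coordinate fields have constant components in their chart and therefore commute at its centre.
-/
lemma curvature_eq (g : BilinField E M) (p : M) (u v w : TangentSpace 𝓘(ℝ, E) p) :
    curvature g p u v w = covCov g p u v w - covCov g p v u w := by
  have h0 : cov g (coordField w) p (0 : TangentSpace 𝓘(ℝ, E) p) = 0 := covAlong_zero_vec g
  rw [curvature, curvatureField, mlieBracket_coordField, coordField_self, coordField_self, h0,
    sub_zero]
  rfl

/-- Only linearity over constants is claimed, as the coordinate extensions depend linearly, near
`p`, on the vectors they extend. This suffices for the multilinearity of `curvature`. -/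
lemma covCov_add_smul (g : RMetric E M) (p : M) (a : ℝ) (u u' v v' w w' : TangentSpace 𝓘(ℝ, E) p) :
    covCov g.inner p (u + a • u') v w = covCov g.inner p u v w + a • covCov g.inner p u' v w ∧
    covCov g.inner p u (v + a • v') w = covCov g.inner p u v w + a • covCov g.inner p u v' w ∧
    covCov g.inner p u v (w + a • w') = covCov g.inner p u v w + a • covCov g.inner p u v w' := by
  have hs : ∀ w : TangentSpace 𝓘(ℝ, E) p, FieldSmoothAt E (fun y : M ↦ y) (coordField w) p :=
    fun w ↦ fieldSmoothAt_coordField (mem_chart_source _ p) w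
  have hev : ∀ b b' : TangentSpace 𝓘(ℝ, E) p, ∀ᶠ y in 𝓝 p,
      coordField (b + a • b') y = coordField b y + a • coordField b' y := by
    intro b b'
    filter_upwards [eventually_coordField_add b (a • b'), eventually_coordField_smul a b'] with y h1 h2
    rw [h1, h2]
  have hcc : ∀ b c : TangentSpace 𝓘(ℝ, E) p, FieldSmoothAt E (fun y : M ↦ y)
      (fun y ↦ cov g.inner (coordField b) y (coordField c y)) p := fun b c ↦
    fieldSmoothAt_cov g (hs c) (hs b)
  have hlin : ∀ (Z Z' : ∀ y : M, TangentSpace 𝓘(ℝ, E) y), FieldDiffAt E (fun y : M ↦ y) Z p →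
      FieldDiffAt E (fun y : M ↦ y) Z' p → ∀ b : TangentSpace 𝓘(ℝ, E) p,
      cov g.inner (fun y ↦ Z y + a • Z' y) p b = cov g.inner Z p b + a • cov g.inner Z' p b := by
    intro Z Z' hZ hZ' b
    have h1 := covAlong_add g.inner hZ (hZ'.smul (k := fun _ ↦ a) mdifferentiableAt_const) b
    rw [covAlong_const_smul g.inner a hZ' b] at h1
    exact h1
  refine ⟨?_, ?_, ?_⟩
  · have h1 := covAlong_add_vec g.inner (f := fun y : M ↦ y) (x := p)
      (V := fun y ↦ cov g.inner (coordField w) y (coordField v y)) u (a • u')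
    rw [covAlong_smul_vec] at h1
    exact h1
  · rw [covCov, covCov, covCov, ← hlin _ _ (hcc w v).diffAt (hcc w v').diffAt]
    refine covAlong_congr g.inner ((hev v v').mono fun y hy ↦ ?_) u
    rw [hy]
    have h1 := covAlong_add_vec g.inner (f := fun y : M ↦ y) (x := y) (V := coordField w)
      (coordField v y) (a • coordField v' y)
    rw [covAlong_smul_vec] at h1
    exact h1
  · rw [covCov, covCov, covCov, ← hlin _ _ (hcc w v).diffAt (hcc w' v).diffAt]
    refine covAlong_congr g.inner ?_ u
    filter_upwards [(hev w w').eventually_nhds, (hs w).eventually_diffAt, (hs w').eventually_diffAt]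
      with y hy h1 h2
    have h3 := covAlong_add g.inner h1 (h2.smul (k := fun _ ↦ a) mdifferentiableAt_const) (coordField v y)
    rw [covAlong_const_smul g.inner a h2] at h3
    refine (covAlong_congr g.inner hy (coordField v y)).trans h3

lemma curvature_add_smul (g : RMetric E M) (p : M) (a : ℝ) (u u' v v' w w' : TangentSpace 𝓘(ℝ, E) p) :
    curvature g.inner p (u + a • u') v w = curvature g.inner p u v w + a • curvature g.inner p u' v w ∧
    curvature g.inner p u (v + a • v') w = curvature g.inner p u v w + a • curvature g.inner p u v' w ∧
    curvature g.inner p u v (w + a • w') = curvature g.inner p u v w + a • curvature g.inner p u v w' := by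
  simp only [curvature_eq]
  have h := covCov_add_smul g p a
  refine ⟨?_, ?_, ?_⟩
  · rw [(h u u' v v w w).1, (h v v u u' w w).2.1, smul_sub]; abel
  · rw [(h u u v v' w w).2.1, (h v v' u u w w).1, smul_sub]; abel
  · rw [(h u u v v w w').2.2, (h v v u u w w').2.2, smul_sub]; abel

end Tensor

/-! ### The basis T, φT, ξ and the curvature on horizontal vectors. -/

section Sasaki

variable {M : Type*} [TopologicalSpace M] [ChartedSpace (Euc 3) M]
  [IsManifold 𝓘(ℝ, Euc 3) ∞ M]
  {g : RMetric (Euc 3) M}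
  {η : ∀ x : M, TangentSpace 𝓘(ℝ, Euc 3) x →L[ℝ] ℝ}
  {ξ : ∀ x : M, TangentSpace 𝓘(ℝ, Euc 3) x}
  {φ : ∀ x : M, TangentSpace 𝓘(ℝ, Euc 3) x →L[ℝ] TangentSpace 𝓘(ℝ, Euc 3) x} {c : ℝ}

/-- The adapted frame `T, φ T, ξ`. -/
lemma IsSasaki.expand (S : IsSasaki g η ξ φ) {p : M} {T : TangentSpace 𝓘(ℝ, Euc 3) p}
    (hT : g.inner p T T = 1) (hη : η p T = 0) (v : TangentSpace 𝓘(ℝ, Euc 3) p) :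
    v = g.inner p v T • T + g.inner p v (φ p T) • φ p T + η p v • ξ p := by
  have h1 : g.inner p T (φ p T) = 0 := S.inner_phi_self p T
  have h2 : g.inner p (φ p T) T = 0 := by rw [g.symm, h1]
  have h3 : g.inner p (φ p T) (φ p T) = 1 := by rw [S.compatible, hT, hη]; ring
  have h4 : g.inner p (ξ p) T = 0 := by rw [S.metric_xi, hη]
  have h5 : g.inner p (ξ p) (φ p T) = 0 := by rw [S.metric_xi, S.eta_phi]
  have h6 : g.inner p T (ξ p) = 0 := by rw [g.symm, h4]
  have h7 : g.inner p (φ p T) (ξ p) = 0 := by rw [g.symm, h5]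
  have h := sum_orthonormal (V := Euc 3) (fun a b ↦ formAt g.inner p a b) ![T, φ p T, ξ p]
    (fun u v w ↦ by rw [map_add, add_apply])
    (fun a u w ↦ by rw [map_smul, smul_apply, smul_eq_mul])
    (by
      intro i j
      fin_cases i <;> fin_cases j
      exacts [hT, h1, h6, h2, h3, h7, h4, h5, S.inner_xi_xi p])
    (by simp) v
  have h8 : η p v = g.inner p v (ξ p) := by rw [g.symm, S.metric_xi]
  rw [h8]
  refine h.trans ?_
  rw [Fin.sum_univ_three]
  rfl

lemma IsSasaki.ext (S : IsSasaki g η ξ φ) {p : M} {T : TangentSpace 𝓘(ℝ, Euc 3) p}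
    (hT : g.inner p T T = 1) (hη : η p T = 0) {v w : TangentSpace 𝓘(ℝ, Euc 3) p}
    (h1 : g.inner p v T = g.inner p w T) (h2 : g.inner p v (φ p T) = g.inner p w (φ p T))
    (h3 : η p v = η p w) : v = w := by
  rw [S.expand hT hη v, S.expand hT hη w, h1, h2, h3]

/-- `R(φ T, T) T = c φ T` for horizontal unit vectors `T`. -/
lemma IsSasakianSpaceForm.curvature_horizontal (S : IsSasakianSpaceForm g η ξ φ c) {p : M}
    {T : TangentSpace 𝓘(ℝ, Euc 3) p} (hT : g.inner p T T = 1) (hη : η p T = 0) :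
    curvature g.inner p (φ p T) T T = c • φ p T := by
  have hs : ∀ w : TangentSpace 𝓘(ℝ, Euc 3) p, FieldSmoothAt (Euc 3) (fun y : M ↦ y) (coordField w) p :=
    fun w ↦ fieldSmoothAt_coordField (mem_chart_source _ p) w
  have hS := S.isSasaki
  have h1 : g.inner p T (φ p T) = 0 := hS.inner_phi_self p T
  have h2 : g.inner p (φ p T) T = 0 := by rw [g.symm, h1]
  have h3 : g.inner p (φ p T) (φ p T) = 1 := by rw [hS.compatible, hT, hη]; ring
  have hskew : ∀ w, g.inner p (curvature g.inner p (φ p T) T T) w =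
      - g.inner p T (curvature g.inner p (φ p T) T w) := by
    intro w
    have := curvatureField_skew g (hs (φ p T)) (hs T) (hs T) (hs w)
    rwa [coordField_self, coordField_self] at this
  have hphi : φ p (φ p T) = - T := by rw [hS.phi_sq, hη, zero_smul, add_zero]
  apply hS.ext hT hη
  · have := hskew T
    rw [g.symm p T] at this
    rw [map_smul, smul_apply, h2, smul_zero]
    linarith
  -- The plane of T and φT is φ-invariant, and by orthonormality its sectional curvature is exactly
  -- this component.
  · have hli : LinearIndependent ℝ ![φ p T, T] := by
      rw [LinearIndependent.pair_iff]
      intro a b hab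
      have ha := congrArg (fun w ↦ g.inner p w (φ p T)) hab
      have hb := congrArg (fun w ↦ g.inner p w T) hab
      simp only [map_add, map_smul, add_apply, smul_apply, h1, h2, h3, hT, map_zero, zero_apply,
        smul_eq_mul] at ha hb
      constructor <;> linarith
    have hk := S.holomorphic p (φ p T) T hli (by
      intro w hw
      obtain ⟨a, b, rfl⟩ := Submodule.mem_span_pair.1 hw
      rw [map_add, map_smul, map_smul, hphi]
      refine Submodule.mem_span_pair.2 ⟨b, -a, ?_⟩
      rw [smul_neg, neg_smul, add_comm])
    rw [sectionalCurvature, h3, hT, h2] at hk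
    rw [map_smul, smul_apply, h3]
    simpa using hk
  -- Skewness turns the ξ-component into -g(T, R(φT,T)ξ), and R(u,v)ξ vanishes for horizontal u, v.
  · rw [← hS.metric_xi, g.symm, hskew, hS.curvature_xi, hη, hS.eta_phi, map_smul, hS.eta_phi]
    simp

end Sasaki

/-! ### Second fundamental forms of isometric maps, and traces in orthonormal frames. -/

section Isometric

variable {E : Type*} [NormedAddCommGroup E] [NormedSpace ℝ E] [FiniteDimensional ℝ E]
  {M : Type*} [TopologicalSpace M] [ChartedSpace E M] [IsManifold 𝓘(ℝ, E) ∞ M]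
  {E' : Type*} [NormedAddCommGroup E'] [NormedSpace ℝ E'] [FiniteDimensional ℝ E']
  {N : Type*} [TopologicalSpace N] [ChartedSpace E' N] [IsManifold 𝓘(ℝ, E') ∞ N]

/-- Absence of torsion upstairs and downstairs: both antisymmetric parts equal df of the same
bracket. -/
lemma secondFundamentalForm_symm {h : BilinField E' N} {g : BilinField E M} {f : N → M} {x : N}
    (hh : NondegAt h x) (hg : NondegAt g (f x)) (hf : ContMDiffAt 𝓘(ℝ, E') 𝓘(ℝ, E) ∞ f x)
    (u v : TangentSpace 𝓘(ℝ, E') x) :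
    secondFundamentalForm h g f x u v = secondFundamentalForm h g f x v u := by
  have hs : ∀ w : TangentSpace 𝓘(ℝ, E') x, FieldDiffAt E' (fun y : N ↦ y) (coordField w) x :=
    fun w ↦ (fieldSmoothAt_coordField (mem_chart_source _ x) w).diffAt
  have h1 := covAlong_torsion hg (hf.of_le (by norm_cast)) (hs u) (hs v)
  have h2 := cov_torsion hh (hs u) (hs v)
  rw [coordField_self, coordField_self] at h1 h2
  rw [← h2, map_sub] at h1
  rw [secondFundamentalForm, secondFundamentalForm]
  have key : ∀ a b c d : TangentSpace 𝓘(ℝ, E) (f x), a - b = c - d → a - c = b - d := by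
    intro a b c d h
    rw [sub_eq_sub_iff_add_eq_add] at h ⊢
    rw [h]
    abel
  exact key _ _ _ _ h1

/-- The second fundamental form of a map that is isometric on a distribution `D`. -/
lemma secondFundamentalForm_isometric {h : BilinField E' N} {g : BilinField E M} {f : N → M} {x : N}
    (hh : NondegAt h x) (hg : NondegAt g (f x)) (hf : ContMDiffAt 𝓘(ℝ, E') 𝓘(ℝ, E) ∞ f x)
    (D : ∀ y : N, TangentSpace 𝓘(ℝ, E') y → Prop)
    (hD : ∀ᶠ y in 𝓝 x, ∀ a w, D y w →
      g (f y) (diff (E := E) (E' := E') f y a) (diff (E := E) (E' := E') f y w) = h y a w)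
    (hext : ∀ w, D x w → ∃ W : ∀ y : N, TangentSpace 𝓘(ℝ, E') y,
      FieldSmoothAt E' (fun y : N ↦ y) W x ∧ W x = w ∧ ∀ᶠ y in 𝓝 x, D y (W y))
    {u v w : TangentSpace 𝓘(ℝ, E') x} (hu : D x u) (hv : D x v) (hw : D x w) :
    g (f x) (secondFundamentalForm h g f x u v) (diff (E := E) (E' := E') f x w) = 0 := by
  have hskew : ∀ u v w, D x v → D x w →
      g (f x) (secondFundamentalForm h g f x u v) (diff (E := E) (E' := E') f x w) =
      - g (f x) (secondFundamentalForm h g f x u w) (diff (E := E) (E' := E') f x v) := by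
    intro u v w hv hw
    obtain ⟨V, hV, rfl, hVD⟩ := hext v hv
    obtain ⟨W, hW, rfl, hWD⟩ := hext w hw
    have h1 := diff_inner hg (fieldSmoothAt_diff hf hV).diffAt (fieldSmoothAt_diff hf hW).diffAt u
    have h2 := diff_inner (f := fun y : N ↦ y) hh hV.diffAt hW.diffAt u
    have h3 : diffModel (E := ℝ) (E' := E') (fun y ↦ g (f y) (diff (E := E) (E' := E') f y (V y))
        (diff (E := E) (E' := E') f y (W y))) x =
        diffModel (E := ℝ) (E' := E') (fun y ↦ h y (V y) (W y)) x := by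
      apply diffModel_congr
      filter_upwards [hD, hWD] with y hy hy'
      exact hy _ _ hy'
    rw [h3, h2] at h1
    have h4 := secondFundamentalForm_eq h g hf hV.diffAt u
    have h5 := secondFundamentalForm_eq h g hf hW.diffAt u
    have h6 := hD.self_of_nhds (cov h V x u) (W x) hw
    have h7 := hD.self_of_nhds (cov h W x u) (V x) hv
    rw [h4, h5, map_sub, map_sub, sub_apply, sub_apply, h6, h7]
    rw [hg.symm _ (diff (E := E) (E' := E') f x (V x)), hh.symm _ (V x)] at h1
    simp only [cov]
    linarith
  have hsym : ∀ u v w,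
      g (f x) (secondFundamentalForm h g f x u v) (diff (E := E) (E' := E') f x w) =
      g (f x) (secondFundamentalForm h g f x v u) (diff (E := E) (E' := E') f x w) := by
    intro u v w; rw [secondFundamentalForm_symm hh hg hf]
  -- On `D` the form g(∇df(u,v), df w) is symmetric in u, v and skew in v, w. Three alternating uses
  -- of each symmetry turn it into its own negative.
  have a1 := hskew u v w hv hw
  have a2 := hskew w u v hu hv
  have a3 := hskew v w u hw hu
  have b1 := hsym u w v
  have b2 := hsym w v u
  have b3 := hsym u v w
  linarith

lemma inducedMetric_apply (g : BilinField E M) (f : N → M) (x : N) (u v : TangentSpace 𝓘(ℝ, E') x) :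
    inducedMetric g f x u v =
      g (f x) (diff (E := E) (E' := E') f x u) (diff (E := E) (E' := E') f x v) := rfl

lemma inducedMetric_nondegAt (g : RMetric E M) {f : N → M} {x : N}
    (hf : ContMDiffAt 𝓘(ℝ, E') 𝓘(ℝ, E) ∞ f x)
    (hi : Function.Injective (diff (E := E) (E' := E') f x)) :
    NondegAt (inducedMetric (E' := E') g.inner f) x where
  symm _ _ _ := g.symm _ _ _
  inv := by
    apply isInvertible_of_posDef
    intro v hv
    have h1 : g.inner (f x) (diff (E := E) (E' := E') f x v) (diff (E := E) (E' := E') f x v) = 0 :=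
      DFunLike.congr_fun hv v
    have h2 := g.eq_zero h1
    rw [← (diff (E := E) (E' := E') f x).map_zero] at h2
    exact hi h2
  diff := by
    refine ContMDiffAt.mdifferentiableAt (n := ∞) ?_ (by simp)
    refine contMDiffAt_clm_of_apply fun a ↦ contMDiffAt_clm_of_apply fun b ↦ ?_
    exact g.contMDiffAt_inner
      (fieldSmoothAt_diff hf (fieldSmoothAt_frameField x (mem_chart_source E' x) a))
      (fieldSmoothAt_diff hf (fieldSmoothAt_frameField x (mem_chart_source E' x) b))

/-- The second fundamental form of an isometric immersion is normal. -/
lemma secondFundamentalForm_normal (g : RMetric E M) {f : N → M} {x : N}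
    (hf : ContMDiffAt 𝓘(ℝ, E') 𝓘(ℝ, E) ∞ f x)
    (hi : Function.Injective (diff (E := E) (E' := E') f x)) (u v w : TangentSpace 𝓘(ℝ, E') x) :
    g.inner (f x) (secondFundamentalForm (inducedMetric (E' := E') g.inner f) g.inner f x u v)
      (diff (E := E) (E' := E') f x w) = 0 :=
  secondFundamentalForm_isometric (inducedMetric_nondegAt g hf hi) (g.nondegAt _) hf
    (fun _ _ ↦ True) (Filter.Eventually.of_forall fun _ _ _ _ ↦ rfl)
    (fun w _ ↦ ⟨coordField w, fieldSmoothAt_coordField (mem_chart_source _ x) w, coordField_self w,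
      Filter.Eventually.of_forall fun _ ↦ trivial⟩) trivial trivial trivial

/-- Let Q be the matrix of products of the chosen basis with the orthonormal frame, and P the
coordinates of the frame in that basis. The Gram matrix is QQᵀ and P inverts Q, so the inverse Gram
matrix is PᵀP, which is exactly the change of basis in the trace. -/
lemma metricTrace_eq {W ι : Type*} [AddCommGroup W] [Module ℝ W] [Fintype ι] [DecidableEq ι]
    (h : BilinField E' N) (x : N) (e : ι → TangentSpace 𝓘(ℝ, E') x)
    (he : ∀ i j, h x (e i) (e j) = if i = j then 1 else 0)
    (hc : Fintype.card ι = Module.finrank ℝ E')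
    (β : TangentSpace 𝓘(ℝ, E') x → TangentSpace 𝓘(ℝ, E') x → W)
    (h1 : ∀ u v w, β (u + v) w = β u w + β v w) (h2 : ∀ (a : ℝ) u w, β (a • u) w = a • β u w)
    (h3 : ∀ u v w, β u (v + w) = β u v + β u w) (h4 : ∀ (a : ℝ) u w, β u (a • w) = a • β u w) :
    metricTrace h x β = ∑ i, β (e i) (e i) := by
  have key : ∀ (H : E' →L[ℝ] E' →L[ℝ] ℝ) (e : ι → E') (he : ∀ i j, H (e i) (e j) = if i = j then 1 else 0)
      (β : E' →ₗ[ℝ] E' →ₗ[ℝ] W), (let b := Module.finBasis ℝ E'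
        ∑ i, ∑ j, (Matrix.of fun i j ↦ H (b i) (b j))⁻¹ i j • β (b i) (b j)) = ∑ i, β (e i) (e i) := by
    intro H e he β
    set b := Module.finBasis ℝ E' with hbdef
    change ∑ i, ∑ j, (Matrix.of fun i j ↦ H (b i) (b j))⁻¹ i j • β (b i) (b j) = _
    let Q : Matrix (Fin (Module.finrank ℝ E')) ι ℝ := Matrix.of fun i a ↦ H (b i) (e a)
    let P : Matrix ι (Fin (Module.finrank ℝ E')) ℝ := Matrix.of fun a i ↦ b.repr (e a) i
    have hb : ∀ v, v = ∑ a, H v (e a) • e a := fun v ↦ sum_orthonormal (fun u v ↦ H u v) e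
      (fun u v w ↦ by rw [map_add, add_apply])
      (fun a u w ↦ by rw [map_smul, smul_apply, smul_eq_mul]) he hc v
    have hPQ : P * Q = 1 := by
      ext a a'
      rw [Matrix.mul_apply, Matrix.one_apply, ← he]
      conv_rhs => rw [← b.sum_repr (e a)]
      rw [map_sum, sum_apply]
      refine Finset.sum_congr rfl fun i _ ↦ ?_
      rw [map_smul, smul_apply, smul_eq_mul]
      rfl
    have hQP : Q * P = 1 := (Matrix.mul_eq_one_comm_of_card_eq _ _ _ (by simpa using hc)).1 hPQ
    have hH : (Matrix.of fun i j ↦ H (b i) (b j)) = Q * Q.transpose := by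
      ext i j
      rw [Matrix.mul_apply, Matrix.of_apply]
      conv_lhs => rw [hb (b i), hb (b j)]
      simp [map_sum, sum_apply, he, Q, mul_comm]
    have hinv : (Matrix.of fun i j ↦ H (b i) (b j))⁻¹ = P.transpose * P := by
      apply Matrix.inv_eq_right_inv
      rw [hH, Matrix.mul_assoc, ← Matrix.mul_assoc Q.transpose, ← Matrix.transpose_mul, hPQ,
        Matrix.transpose_one, Matrix.one_mul, hQP]
    have hee : ∀ a, e a = ∑ i, P a i • b i := fun a ↦ (b.sum_repr (e a)).symm
    rw [hinv]
    have : ∀ a, β (e a) (e a) = ∑ i, ∑ j, (P a i * P a j) • β (b i) (b j) := by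
      intro a
      conv_lhs => rw [hee a]
      simp only [map_sum, map_smul, LinearMap.sum_apply, LinearMap.smul_apply, Finset.smul_sum,
        smul_smul]
      rw [Finset.sum_comm]
      refine Finset.sum_congr rfl fun i _ ↦ Finset.sum_congr rfl fun j _ ↦ ?_
      rw [mul_comm]
    simp only [this]
    symm
    rw [Finset.sum_comm]
    refine Finset.sum_congr rfl fun i _ ↦ ?_
    rw [Finset.sum_comm]
    refine Finset.sum_congr rfl fun j _ ↦ ?_
    rw [Matrix.mul_apply, Finset.sum_smul]
    rfl
  exact key (h x) e he (LinearMap.mk₂ ℝ β h1 h2 h3 h4)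

end Isometric

/-! ### The Boothby-Wang fibration as a Riemannian submersion. -/

section Submersion

variable {M : Type*} [TopologicalSpace M] [ChartedSpace (Euc 3) M]
  [IsManifold 𝓘(ℝ, Euc 3) ∞ M]
  {B : Type*} [TopologicalSpace B] [ChartedSpace (Euc 2) B] [IsManifold 𝓘(ℝ, Euc 2) ∞ B]
  {g : RMetric (Euc 3) M}
  {η : ∀ x : M, TangentSpace 𝓘(ℝ, Euc 3) x →L[ℝ] ℝ}
  {ξ : ∀ x : M, TangentSpace 𝓘(ℝ, Euc 3) x}
  {φ : ∀ x : M, TangentSpace 𝓘(ℝ, Euc 3) x →L[ℝ] TangentSpace 𝓘(ℝ, Euc 3) x} {c : ℝ}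
  {gB : RMetric (Euc 2) B} {pr : M → B}

/-- The description of the fibres, applied to x and x itself, supplies an integral curve of ξ
through x, and `pr` is constant along it. -/
lemma IsBoothbyWang.diff_xi (b : IsBoothbyWang g η ξ gB pr) (x : M) :
    diff (E' := Euc 3) (E := Euc 2) pr x (ξ x) = 0 := by
  obtain ⟨α, hα, rfl, -⟩ := (b.fibre x x).1 rfl
  have h1 : ∀ t, pr (α t) = pr (α 0) := fun t ↦ ((b.fibre (α 0) (α t)).2 ⟨α, hα, rfl, t, rfl⟩).symm
  have h2 := hα 0
  have h3 := ((b.smooth.mdifferentiable (by simp)) (α 0)).hasMFDerivAt.comp 0 h2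
  have h4 : HasMFDerivAt 𝓘(ℝ, ℝ) 𝓘(ℝ, Euc 2) (pr ∘ α) 0 0 := by
    have : pr ∘ α = fun _ ↦ pr (α 0) := funext h1
    rw [this]
    exact hasMFDerivAt_const _ _
  have h5 := DFunLike.congr_fun (hasMFDerivAt_unique h3 h4) (1 : ℝ)
  have key : ∀ (L : Euc 3 →L[ℝ] Euc 2) (v : Euc 3),
    (L.comp ((1 : ℝ →L[ℝ] ℝ).smulRight v)) 1 = 0 → L v = 0 := by
    intro L v h; simpa using h
  exact key _ _ h5

/-- One horizontal vector suffices: removing the ξ-component of u affects neither dpr(u), since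
dpr(ξ) = 0, nor g(u,v), since v is orthogonal to ξ. -/
lemma IsBoothbyWang.inner_diff (b : IsBoothbyWang g η ξ gB pr) (S : IsSasaki g η ξ φ) (x : M)
    (u v : TangentSpace 𝓘(ℝ, Euc 3) x) (hv : η x v = 0) :
    gB.inner (pr x) (diff (E' := Euc 3) (E := Euc 2) pr x u)
      (diff (E' := Euc 3) (E := Euc 2) pr x v) = g.inner x u v := by
  have h1 := b.isometric x (u - η x u • ξ x) v (by simp [S.eta_xi]) hv
  rw [map_sub, map_smul, b.diff_xi, smul_zero, sub_zero] at h1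
  rw [h1, map_sub, map_smul, sub_apply, smul_apply, S.metric_xi, hv, smul_zero, sub_zero]

lemma IsSasaki.contMDiffAt_eta (S : IsSasaki g η ξ φ) {E' : Type*} [NormedAddCommGroup E'] [NormedSpace ℝ E']
    {N : Type*} [TopologicalSpace N] [ChartedSpace E' N] [IsManifold 𝓘(ℝ, E') ∞ N]
    {F : N → M} {x : N} {V : ∀ y : N, TangentSpace 𝓘(ℝ, Euc 3) (F y)} (hV : FieldSmoothAt E' F V x) :
    ContMDiffAt 𝓘(ℝ, E') 𝓘(ℝ, ℝ) ∞ (fun y ↦ η (F y) (V y)) x :=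
  contMDiffAt_form η S.smooth_eta hV

/-- The fibration has no second fundamental form on horizontal vectors. -/
lemma IsBoothbyWang.secondFundamentalForm_horizontal (b : IsBoothbyWang g η ξ gB pr)
    (S : IsSasaki g η ξ φ) {x : M} {u v : TangentSpace 𝓘(ℝ, Euc 3) x} (hu : η x u = 0)
    (hv : η x v = 0) : secondFundamentalForm g.inner gB.inner pr x u v = 0 := by
  apply gB.eq_zero
  obtain ⟨w, hw⟩ := b.submersion x (secondFundamentalForm g.inner gB.inner pr x u v)
  -- The value of ∇dpr is the image of a horizontal vector, so orthogonality to all such images,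
  -- given by `secondFundamentalForm_isometric`, makes it orthogonal to itself.
  have h1 : diff (E' := Euc 3) (E := Euc 2) pr x (w - η x w • ξ x) =
      secondFundamentalForm g.inner gB.inner pr x u v := by
    rw [map_sub, map_smul, b.diff_xi, smul_zero, sub_zero, hw]
  have h2 : η x (w - η x w • ξ x) = 0 := by simp [S.eta_xi]
  have h3 := secondFundamentalForm_isometric (g.nondegAt x) (gB.nondegAt (pr x)) b.smooth.contMDiffAt
    (fun y w ↦ η y w = 0) (Filter.Eventually.of_forall fun y a w hw ↦ b.inner_diff S y a w hw)
    (by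
      intro w hw
      have hs := fieldSmoothAt_coordField (mem_chart_source _ x) w
      refine ⟨fun y ↦ coordField w y - η y (coordField w y) • ξ y,
        hs.sub (FieldSmoothAt.smul (S.contMDiffAt_eta hs) (V := ξ) S.smooth_xi.contMDiffAt), ?_,
        Filter.Eventually.of_forall fun y ↦ ?_⟩
      · simp only [coordField_self]
        rw [hw, zero_smul, sub_zero]
      · simp [S.eta_xi]) hu hv h2
  rwa [h1] at h3

end Submersion

/-! ### Surfaces tangent to ξ: structure equations, tension and bitension fields. -/

section Adapted

variable {M : Type*} [TopologicalSpace M] [ChartedSpace (Euc 3) M]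
  [IsManifold 𝓘(ℝ, Euc 3) ∞ M]
  {E' : Type*} [NormedAddCommGroup E'] [NormedSpace ℝ E'] [FiniteDimensional ℝ E']
  {N : Type*} [TopologicalSpace N] [ChartedSpace E' N] [IsManifold 𝓘(ℝ, E') ∞ N]
  {g : RMetric (Euc 3) M}
  {η : ∀ x : M, TangentSpace 𝓘(ℝ, Euc 3) x →L[ℝ] ℝ}
  {ξ : ∀ x : M, TangentSpace 𝓘(ℝ, Euc 3) x}
  {φ : ∀ x : M, TangentSpace 𝓘(ℝ, Euc 3) x →L[ℝ] TangentSpace 𝓘(ℝ, Euc 3) x} {c : ℝ}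

/-- A frame `e₁, e₂` on an open set `U` of a surface immersed in a Sasaki manifold, with `e₁`
horizontal of unit length and `e₂` mapped to the Reeb field. -/
structure AdaptedFrame (g : RMetric (Euc 3) M) (η : ∀ x : M, TangentSpace 𝓘(ℝ, Euc 3) x →L[ℝ] ℝ)
    (ξ : ∀ x : M, TangentSpace 𝓘(ℝ, Euc 3) x) (F : N → M) (U : Set N)
    (e₁ e₂ : ∀ y : N, TangentSpace 𝓘(ℝ, E') y) : Prop where
  finrank : Module.finrank ℝ E' = 2
  isOpen : IsOpen U
  smooth : ∀ x ∈ U, ContMDiffAt 𝓘(ℝ, E') 𝓘(ℝ, Euc 3) ∞ F x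
  immersion : ∀ x ∈ U, Function.Injective (diff (E' := E') (E := Euc 3) F x)
  smooth₁ : ∀ x ∈ U, FieldSmoothAt E' (fun y : N ↦ y) e₁ x
  smooth₂ : ∀ x ∈ U, FieldSmoothAt E' (fun y : N ↦ y) e₂ x
  unit : ∀ x ∈ U, g.inner (F x) (diff (E' := E') (E := Euc 3) F x (e₁ x))
    (diff (E' := E') (E := Euc 3) F x (e₁ x)) = 1
  horizontal : ∀ x ∈ U, η (F x) (diff (E' := E') (E := Euc 3) F x (e₁ x)) = 0
  vertical : ∀ x ∈ U, diff (E' := E') (E := Euc 3) F x (e₂ x) = ξ (F x)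

/-- The unit tangent field `dF(e₁)`. -/
def frameT (F : N → M) (e₁ : ∀ y : N, TangentSpace 𝓘(ℝ, E') y) (y : N) :
    TangentSpace 𝓘(ℝ, Euc 3) (F y) := diff (E' := E') (E := Euc 3) F y (e₁ y)

/-- The unit normal field `φ dF(e₁)`. -/
def frameN (φ : ∀ x : M, TangentSpace 𝓘(ℝ, Euc 3) x →L[ℝ] TangentSpace 𝓘(ℝ, Euc 3) x)
    (F : N → M) (e₁ : ∀ y : N, TangentSpace 𝓘(ℝ, E') y) (y : N) :
    TangentSpace 𝓘(ℝ, Euc 3) (F y) := φ (F y) (frameT F e₁ y)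

/-- The curvature function `g(∇_{e₁} T, N)`. -/
def frameCurv (g : RMetric (Euc 3) M)
    (φ : ∀ x : M, TangentSpace 𝓘(ℝ, Euc 3) x →L[ℝ] TangentSpace 𝓘(ℝ, Euc 3) x)
    (F : N → M) (e₁ : ∀ y : N, TangentSpace 𝓘(ℝ, E') y) (y : N) : ℝ :=
  g.inner (F y) (covAlong g.inner F (frameT F e₁) y (e₁ y)) (frameN φ F e₁ y)

namespace AdaptedFrame

variable {F : N → M} {U : Set N} {e₁ e₂ : ∀ y : N, TangentSpace 𝓘(ℝ, E') y}

lemma smoothT (A : AdaptedFrame g η ξ F U e₁ e₂) {x : N} (hx : x ∈ U) :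
    FieldSmoothAt E' F (frameT F e₁) x := fieldSmoothAt_diff (A.smooth x hx) (A.smooth₁ x hx)

lemma smoothN (A : AdaptedFrame g η ξ F U e₁ e₂) (S : IsSasaki g η ξ φ) {x : N} (hx : x ∈ U) :
    FieldSmoothAt E' F (frameN φ F e₁) x := fieldSmoothAt_clm φ S.smooth_phi (A.smoothT hx)

lemma smoothCurv (A : AdaptedFrame g η ξ F U e₁ e₂) (S : IsSasaki g η ξ φ) {x : N} (hx : x ∈ U) :
    ContMDiffAt 𝓘(ℝ, E') 𝓘(ℝ, ℝ) ∞ (frameCurv g φ F e₁) x :=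
  g.contMDiffAt_inner (fieldSmoothAt_covAlong g (A.smooth₁ x hx) (A.smoothT hx)) (A.smoothN S hx)

lemma TT (A : AdaptedFrame g η ξ F U e₁ e₂) {x : N} (hx : x ∈ U) :
    g.inner (F x) (frameT F e₁ x) (frameT F e₁ x) = 1 := A.unit x hx

lemma etaT (A : AdaptedFrame g η ξ F U e₁ e₂) {x : N} (hx : x ∈ U) :
    η (F x) (frameT F e₁ x) = 0 := A.horizontal x hx

lemma TN (S : IsSasaki g η ξ φ) (x : N) :
    g.inner (F x) (frameT F e₁ x) (frameN φ F e₁ x) = 0 := S.inner_phi_self _ _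

lemma NT (S : IsSasaki g η ξ φ) (x : N) :
    g.inner (F x) (frameN φ F e₁ x) (frameT F e₁ x) = 0 := by rw [g.symm, TN S]

lemma NN (A : AdaptedFrame g η ξ F U e₁ e₂) (S : IsSasaki g η ξ φ) {x : N} (hx : x ∈ U) :
    g.inner (F x) (frameN φ F e₁ x) (frameN φ F e₁ x) = 1 := by
  rw [frameN, S.compatible, A.TT hx, A.etaT hx]; ring

lemma etaN (S : IsSasaki g η ξ φ) (x : N) : η (F x) (frameN φ F e₁ x) = 0 := S.eta_phi _ _

lemma phiN (A : AdaptedFrame g η ξ F U e₁ e₂) (S : IsSasaki g η ξ φ) {x : N} (hx : x ∈ U) :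
    φ (F x) (frameN φ F e₁ x) = - frameT F e₁ x := by
  rw [frameN, S.phi_sq, A.etaT hx, zero_smul, add_zero]

lemma orthonormal (A : AdaptedFrame g η ξ F U e₁ e₂) (S : IsSasaki g η ξ φ) {x : N} (hx : x ∈ U)
    (i j : Fin 2) :
    inducedMetric (E' := E') g.inner F x (![e₁ x, e₂ x] i) (![e₁ x, e₂ x] j) =
      if i = j then 1 else 0 := by
  have h12 : g.inner (F x) (ξ (F x)) (frameT F e₁ x) = 0 := by rw [S.metric_xi, A.etaT hx]
  have h21 : g.inner (F x) (frameT F e₁ x) (ξ (F x)) = 0 := by rw [g.symm, h12]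
  rw [inducedMetric_apply]
  fin_cases i <;> fin_cases j
  · exact A.TT hx
  · refine Eq.trans ?_ h21
    exact congrArg _ (A.vertical x hx)
  · refine Eq.trans ?_ h12
    exact congrArg (fun w ↦ g.inner (F x) w (frameT F e₁ x)) (A.vertical x hx)
  · refine Eq.trans ?_ (S.inner_xi_xi (F x))
    exact congrArg (fun w ↦ g.inner (F x) w w) (A.vertical x hx)

lemma expand (A : AdaptedFrame g η ξ F U e₁ e₂) (S : IsSasaki g η ξ φ) {x : N} (hx : x ∈ U)
    (w : TangentSpace 𝓘(ℝ, E') x) : ∃ a b : ℝ, w = a • e₁ x + b • e₂ x := by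
  have h := sum_orthonormal (V := E') (fun a b ↦ formAt (inducedMetric (E' := E') g.inner F) x a b)
    ![e₁ x, e₂ x] (fun u v w ↦ by rw [map_add, add_apply])
    (fun a u w ↦ by rw [map_smul, smul_apply, smul_eq_mul])
    (A.orthonormal S hx) (by simp [A.finrank]) w
  rw [Fin.sum_univ_two] at h
  exact ⟨_, _, h⟩

lemma trace (A : AdaptedFrame g η ξ F U e₁ e₂) (S : IsSasaki g η ξ φ) {x : N} (hx : x ∈ U)
    {W : Type*} [AddCommGroup W] [Module ℝ W]
    (β : TangentSpace 𝓘(ℝ, E') x → TangentSpace 𝓘(ℝ, E') x → W)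
    (h1 : ∀ u v w, β (u + v) w = β u w + β v w) (h2 : ∀ (a : ℝ) u w, β (a • u) w = a • β u w)
    (h3 : ∀ u v w, β u (v + w) = β u v + β u w) (h4 : ∀ (a : ℝ) u w, β u (a • w) = a • β u w) :
    metricTrace (inducedMetric (E' := E') g.inner F) x β = β (e₁ x) (e₁ x) + β (e₂ x) (e₂ x) := by
  rw [metricTrace_eq _ x _ (A.orthonormal S hx) (by simp [A.finrank]) β h1 h2 h3 h4,
    Fin.sum_univ_two]
  rfl

/-- The tangent plane is spanned by T and ξ, both orthogonal to φT. -/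
lemma inner_N_tangent (A : AdaptedFrame g η ξ F U e₁ e₂) (S : IsSasaki g η ξ φ) {x : N} (hx : x ∈ U)
    (w : TangentSpace 𝓘(ℝ, E') x) :
    g.inner (F x) (frameN φ F e₁ x) (diff (E' := E') (E := Euc 3) F x w) = 0 := by
  obtain ⟨a, b, rfl⟩ := A.expand S hx w
  rw [map_add, map_smul, map_smul, A.vertical x hx, map_add, map_smul, map_smul,
    g.symm _ _ (ξ (F x)), S.metric_xi, etaN S]
  have := NT (F := F) (e₁ := e₁) S x
  rw [frameT] at this
  rw [this]
  simp

lemma inner_T_cov (A : AdaptedFrame g η ξ F U e₁ e₂) {x : N} (hx : x ∈ U)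
    (v : TangentSpace 𝓘(ℝ, E') x) :
    g.inner (F x) (covAlong g.inner F (frameT F e₁) x v) (frameT F e₁ x) = 0 := by
  have h1 := diff_inner (g.nondegAt (F x)) (A.smoothT hx).diffAt (A.smoothT hx).diffAt v
  have h2 : diffModel (E := ℝ) (E' := E') (fun y ↦ g.inner (F y) (frameT F e₁ y) (frameT F e₁ y)) x = 0 := by
    refine (diffModel_congr (M := ℝ) (f' := fun _ : N ↦ (1 : ℝ)) ?_).trans (diffModel_const _ _)
    filter_upwards [A.isOpen.mem_nhds hx] with y hy using A.TT hy
  rw [h2, g.symm _ (frameT F e₁ x)] at h1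
  have h3 : (0 : E' →L[ℝ] ℝ) v = 0 := rfl
  rw [h3] at h1
  linarith

/-- Differentiation of g(T,ξ) = 0, with ∇ξ = -φ. -/
lemma eta_cov_T (A : AdaptedFrame g η ξ F U e₁ e₂) (S : IsSasaki g η ξ φ) {x : N} (hx : x ∈ U)
    (v : TangentSpace 𝓘(ℝ, E') x) :
    η (F x) (covAlong g.inner F (frameT F e₁) x v) =
      g.inner (F x) (frameT F e₁ x) (φ (F x) (diff (E' := E') (E := Euc 3) F x v)) := by
  have hm := (A.smooth x hx).mdifferentiableAt (by simp)
  have h1 := diff_inner (g.nondegAt (F x)) (A.smoothT hx).diffAt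
    (S.fieldSmoothAt_xi (A.smooth x hx)).diffAt v
  have h2 : diffModel (E := ℝ) (E' := E') (fun y ↦ g.inner (F y) (frameT F e₁ y) (ξ (F y))) x = 0 := by
    refine (diffModel_congr (M := ℝ) (f' := fun _ : N ↦ (0 : ℝ)) ?_).trans (diffModel_const _ _)
    filter_upwards [A.isOpen.mem_nhds hx] with y hy
    rw [g.symm, S.metric_xi, A.etaT hy]
  rw [h2, S.covAlong_xi hm, g.symm _ _ (ξ (F x)), S.metric_xi, map_neg] at h1
  have h3 : (0 : E' →L[ℝ] ℝ) v = 0 := rfl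
  rw [h3] at h1
  linarith

/-- The T-component vanishes because |T| = 1, the ξ-component because it is g(T,φT); `frameCurv` is
the remaining one. -/
lemma cov_T₁ (A : AdaptedFrame g η ξ F U e₁ e₂) (S : IsSasaki g η ξ φ) {x : N} (hx : x ∈ U) :
    covAlong g.inner F (frameT F e₁) x (e₁ x) = frameCurv g φ F e₁ x • frameN φ F e₁ x := by
  apply S.ext (A.TT hx) (A.etaT hx)
  · rw [A.inner_T_cov hx, map_smul, smul_apply, NT S, smul_zero]
  · rw [map_smul, smul_apply]
    have := A.NN S hx
    rw [frameN] at this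
    rw [frameN, this, smul_eq_mul, mul_one]
    rfl
  · rw [A.eta_cov_T S hx, map_smul, etaN S, smul_zero]
    exact TN S x

lemma cov_xi₁ (A : AdaptedFrame g η ξ F U e₁ e₂) (S : IsSasaki g η ξ φ) {x : N} (hx : x ∈ U) :
    covAlong g.inner F (fun y ↦ ξ (F y)) x (e₁ x) = - frameN φ F e₁ x :=
  S.covAlong_xi ((A.smooth x hx).mdifferentiableAt (by simp)) (e₁ x)

lemma cov_xi₂ (A : AdaptedFrame g η ξ F U e₁ e₂) (S : IsSasaki g η ξ φ) {x : N} (hx : x ∈ U) :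
    covAlong g.inner F (fun y ↦ ξ (F y)) x (e₂ x) = 0 := by
  rw [S.covAlong_xi ((A.smooth x hx).mdifferentiableAt (by simp)) (e₂ x), A.vertical x hx, S.phi_xi,
    neg_zero]

/-- The difference ∇_{e₂}T - ∇_{e₁}ξ is dF of a bracket, hence tangent to the surface. So the normal
component of ∇_{e₂}T is that of ∇_{e₁}ξ = -N, and the other two components vanish. -/
lemma cov_T₂ (A : AdaptedFrame g η ξ F U e₁ e₂) (S : IsSasaki g η ξ φ) {x : N} (hx : x ∈ U) :
    covAlong g.inner F (frameT F e₁) x (e₂ x) = - frameN φ F e₁ x := by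
  have ht := covAlong_torsion (g.nondegAt (F x)) ((A.smooth x hx).of_le (by norm_cast))
    (A.smooth₂ x hx).diffAt (A.smooth₁ x hx).diffAt
  have hc : covAlong g.inner F (fun y ↦ diff (E' := E') (E := Euc 3) F y (e₂ y)) x (e₁ x) =
      - frameN φ F e₁ x := by
    rw [← A.cov_xi₁ S hx]
    refine covAlong_congr g.inner ?_ (e₁ x)
    filter_upwards [A.isOpen.mem_nhds hx] with y hy using A.vertical y hy
  rw [hc] at ht
  have hN := A.inner_N_tangent S hx (VectorField.mlieBracket 𝓘(ℝ, E') e₂ e₁ x)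
  rw [← ht, g.symm, map_sub, map_neg, sub_apply, neg_apply, A.NN S hx] at hN
  apply S.ext (A.TT hx) (A.etaT hx)
  · rw [A.inner_T_cov hx, map_neg, neg_apply, NT S, neg_zero]
  · have h2 : g.inner (F x) (covAlong g.inner F (frameT F e₁) x (e₂ x)) (frameN φ F e₁ x) = -1 := by
      have : g.inner (F x) (covAlong g.inner F (frameT F e₁) x (e₂ x)) (frameN φ F e₁ x) - -1 = 0 := hN
      linarith
    rw [map_neg, neg_apply]
    have h3 := A.NN S hx
    rw [frameN] at h2 h3 ⊢
    rw [h2, h3]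
  · rw [A.eta_cov_T S hx, A.vertical x hx, S.phi_xi, map_neg, etaN S]
    simp

/-- The derivative of φT is φ(∇T) + (∇φ)T, and (∇_X φ)T = g(X,T)ξ because η(T) = 0. -/
lemma cov_N (A : AdaptedFrame g η ξ F U e₁ e₂) (S : IsSasaki g η ξ φ) {x : N} (hx : x ∈ U)
    (v : TangentSpace 𝓘(ℝ, E') x) :
    covAlong g.inner F (frameN φ F e₁) x v = φ (F x) (covAlong g.inner F (frameT F e₁) x v) +
      g.inner (F x) (diff (E' := E') (E := Euc 3) F x v) (frameT F e₁ x) • ξ (F x) := by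
  have := covAlong_endo g φ S.smooth_phi (A.smoothT hx).diffAt v
  rw [S.sasaki, A.etaT hx, zero_smul, sub_zero] at this
  exact this

lemma cov_N₁ (A : AdaptedFrame g η ξ F U e₁ e₂) (S : IsSasaki g η ξ φ) {x : N} (hx : x ∈ U) :
    covAlong g.inner F (frameN φ F e₁) x (e₁ x) =
      -(frameCurv g φ F e₁ x • frameT F e₁ x) + ξ (F x) := by
  have h := A.TT hx
  rw [frameT] at h
  rw [A.cov_N S hx, A.cov_T₁ S hx, map_smul, A.phiN S hx, smul_neg]
  rw [frameT, h, one_smul]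

lemma cov_N₂ (A : AdaptedFrame g η ξ F U e₁ e₂) (S : IsSasaki g η ξ φ) {x : N} (hx : x ∈ U) :
    covAlong g.inner F (frameN φ F e₁) x (e₂ x) = frameT F e₁ x := by
  rw [A.cov_N S hx, A.cov_T₂ S hx, map_neg, A.phiN S hx, neg_neg, A.vertical x hx, S.metric_xi,
    A.etaT hx, zero_smul, add_zero]

/-- ∇(dF X) splits into the second fundamental form, which is normal, and dF(∇X), which is tangent.
If the sum is a multiple of N, the tangent part is zero, and so is ∇X because F is an immersion. -/
lemma cov_e (A : AdaptedFrame g η ξ F U e₁ e₂) (S : IsSasaki g η ξ φ) {x : N} (hx : x ∈ U)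
    {X : ∀ y : N, TangentSpace 𝓘(ℝ, E') y} (hX : FieldDiffAt E' (fun y : N ↦ y) X x)
    {u : TangentSpace 𝓘(ℝ, E') x} {a : ℝ}
    (h : covAlong g.inner F (fun y ↦ diff (E' := E') (E := Euc 3) F y (X y)) x u =
      a • frameN φ F e₁ x) :
    cov (inducedMetric (E' := E') g.inner F) X x u = 0 ∧
    secondFundamentalForm (inducedMetric (E' := E') g.inner F) g.inner F x u (X x) =
      a • frameN φ F e₁ x := by
  have h1 := secondFundamentalForm_eq (inducedMetric (E' := E') g.inner F) g.inner (A.smooth x hx) hX u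
  rw [h] at h1
  have h2 : diff (E' := E') (E := Euc 3) F x (cov (inducedMetric (E' := E') g.inner F) X x u) = 0 := by
    apply g.eq_zero
    have h3 := secondFundamentalForm_normal g (A.smooth x hx) (A.immersion x hx) u (X x)
      (cov (inducedMetric (E' := E') g.inner F) X x u)
    rw [h1, map_sub, sub_apply, map_smul, smul_apply, A.inner_N_tangent S hx, smul_zero] at h3
    linarith
  refine ⟨A.immersion x hx (h2.trans (map_zero _).symm), ?_⟩
  rw [h1, h2, sub_zero]

lemma cov_e₁ (A : AdaptedFrame g η ξ F U e₁ e₂) (S : IsSasaki g η ξ φ) {x : N} (hx : x ∈ U) :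
    cov (inducedMetric (E' := E') g.inner F) e₁ x (e₁ x) = 0 ∧
    secondFundamentalForm (inducedMetric (E' := E') g.inner F) g.inner F x (e₁ x) (e₁ x) =
      frameCurv g φ F e₁ x • frameN φ F e₁ x :=
  A.cov_e S hx (A.smooth₁ x hx).diffAt (A.cov_T₁ S hx)

lemma cov_e₂ (A : AdaptedFrame g η ξ F U e₁ e₂) (S : IsSasaki g η ξ φ) {x : N} (hx : x ∈ U)
    {u : TangentSpace 𝓘(ℝ, E') x} {a : ℝ}
    (h : covAlong g.inner F (fun y ↦ ξ (F y)) x u = a • frameN φ F e₁ x) :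
    cov (inducedMetric (E' := E') g.inner F) e₂ x u = 0 ∧
    secondFundamentalForm (inducedMetric (E' := E') g.inner F) g.inner F x u (e₂ x) =
      a • frameN φ F e₁ x := by
  refine A.cov_e S hx (A.smooth₂ x hx).diffAt ?_
  rw [← h]
  refine covAlong_congr g.inner ?_ u
  filter_upwards [A.isOpen.mem_nhds hx] with y hy using A.vertical y hy

lemma secondFundamentalForm_e₁e₂ (A : AdaptedFrame g η ξ F U e₁ e₂) (S : IsSasaki g η ξ φ) {x : N}
    (hx : x ∈ U) :
    secondFundamentalForm (inducedMetric (E' := E') g.inner F) g.inner F x (e₁ x) (e₂ x) =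
      - frameN φ F e₁ x := by
  rw [(A.cov_e₂ S hx (a := -1) (by rw [A.cov_xi₁ S hx, neg_one_smul])).2, neg_one_smul]

/-- The direction e₁ contributes kN and the direction e₂ nothing, as ∇_ξ ξ = 0. -/
lemma tension_eq (A : AdaptedFrame g η ξ F U e₁ e₂) (S : IsSasaki g η ξ φ) {x : N} (hx : x ∈ U) :
    tension (inducedMetric (E' := E') g.inner F) g.inner F x =
      frameCurv g φ F e₁ x • frameN φ F e₁ x := by
  rw [tension, A.trace S hx _ (fun u v w ↦ secondFundamentalForm_add_left _ _ _ _ _ _ _)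
    (fun a u w ↦ secondFundamentalForm_smul_left _ _ _ _ _ _ _)
    (fun u v w ↦ secondFundamentalForm_add_right _ _ (A.smooth x hx) _ _ _)
    (fun a u w ↦ secondFundamentalForm_smul_right _ _ (A.smooth x hx) _ _ _), (A.cov_e₁ S hx).2,
    (A.cov_e₂ S hx (a := 0) (by rw [A.cov_xi₂ S hx, zero_smul])).2, zero_smul, add_zero]

/-- The bitension field in an adapted frame. -/
lemma bitension_eq (A : AdaptedFrame g η ξ F U e₁ e₂) (S : IsSasakianSpaceForm g η ξ φ c) {x : N}
    (hx : x ∈ U) {k k₁ k₂ : N → ℝ} (hk : k = frameCurv g φ F e₁)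
    (hk₁ : k₁ = fun y ↦ diffModel (E := ℝ) (E' := E') k y (e₁ y))
    (hk₂ : k₂ = fun y ↦ diffModel (E := ℝ) (E' := E') k y (e₂ y)) :
    bitension (inducedMetric (E' := E') g.inner F) g.inner F x =
      (diffModel (E := ℝ) (E' := E') k₁ x (e₁ x) + diffModel (E := ℝ) (E' := E') k₂ x (e₂ x)
        - k x ^ 3 + (c - 1) * k x) • frameN φ F e₁ x +
      (2 * k₂ x - 3 * k x * k₁ x) • frameT F e₁ x + (2 * k₁ x) • ξ (F x) := by
  have hS := S.isSasaki
  set h := inducedMetric (E' := E') g.inner F with hh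
  have hks : ∀ y ∈ U, ContMDiffAt 𝓘(ℝ, E') 𝓘(ℝ, ℝ) ∞ k y := fun y hy ↦ hk ▸ A.smoothCurv hS hy
  have hk₁s : ∀ y ∈ U, ContMDiffAt 𝓘(ℝ, E') 𝓘(ℝ, ℝ) ∞ k₁ y := fun y hy ↦
    hk₁ ▸ contMDiffAt_diffModel_apply (hks y hy) (A.smooth₁ y hy)
  have hk₂s : ∀ y ∈ U, ContMDiffAt 𝓘(ℝ, E') 𝓘(ℝ, ℝ) ∞ k₂ y := fun y hy ↦
    hk₂ ▸ contMDiffAt_diffModel_apply (hks y hy) (A.smooth₂ y hy)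
  have hkd : ∀ y ∈ U, MDifferentiableAt 𝓘(ℝ, E') 𝓘(ℝ, ℝ) k y := fun y hy ↦
    (hks y hy).mdifferentiableAt (by simp)
  have hk₁d : ∀ y ∈ U, MDifferentiableAt 𝓘(ℝ, E') 𝓘(ℝ, ℝ) k₁ y := fun y hy ↦
    (hk₁s y hy).mdifferentiableAt (by simp)
  have hk₂d : ∀ y ∈ U, MDifferentiableAt 𝓘(ℝ, E') 𝓘(ℝ, ℝ) k₂ y := fun y hy ↦
    (hk₂s y hy).mdifferentiableAt (by simp)
  have hT : ∀ y ∈ U, FieldDiffAt E' F (frameT F e₁) y := fun y hy ↦ (A.smoothT hy).diffAt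
  have hN : ∀ y ∈ U, FieldDiffAt E' F (frameN φ F e₁) y := fun y hy ↦ (A.smoothN hS hy).diffAt
  have hX : ∀ y ∈ U, FieldDiffAt E' F (fun y ↦ ξ (F y)) y := fun y hy ↦
    (hS.fieldSmoothAt_xi (A.smooth y hy)).diffAt
  have hU := A.isOpen.mem_nhds hx
  set V : ∀ y : N, TangentSpace 𝓘(ℝ, Euc 3) (F y) := tension h g.inner F with hV
  have hVU : ∀ y ∈ U, V y = k y • frameN φ F e₁ y := fun y hy ↦ by
    rw [hV, A.tension_eq hS hy, hk]
  have hVs : FieldSmoothAt E' F V x :=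
    ((A.smoothN hS hx).smul (hks x hx)).congr (by filter_upwards [hU] with y hy using hVU y hy)
  have hV₁ : ∀ y ∈ U, covAlong g.inner F V y (e₁ y) =
      k₁ y • frameN φ F e₁ y + ((-(k y * k y)) • frameT F e₁ y + k y • ξ (F y)) := by
    intro y hy
    rw [covAlong_congr g.inner (W := fun y ↦ k y • frameN φ F e₁ y)
      (by filter_upwards [A.isOpen.mem_nhds hy] with z hz using hVU z hz),
      covAlong_smul g.inner (hkd y hy) (hN y hy), A.cov_N₁ hS hy, ← hk, hk₁]
    module
  have hV₂ : ∀ y ∈ U, covAlong g.inner F V y (e₂ y) =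
      k₂ y • frameN φ F e₁ y + k y • frameT F e₁ y := by
    intro y hy
    rw [covAlong_congr g.inner (W := fun y ↦ k y • frameN φ F e₁ y)
      (by filter_upwards [A.isOpen.mem_nhds hy] with z hz using hVU z hz),
      covAlong_smul g.inner (hkd y hy) (hN y hy), A.cov_N₂ hS hy, hk₂]
  have hd : diffModel (E := ℝ) (E' := E') (fun y ↦ -(k y * k y)) x (e₁ x) = -(2 * k x * k₁ x) := by
    have key : ∀ w : E', diffModel (E := ℝ) (E' := E') (fun y ↦ -(k y * k y)) x w =
        -(2 * k x * diffModel (E := ℝ) (E' := E') k x w) := by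
      intro w
      have h1 := diffModel_smul (f := fun _ : N ↦ (-1 : ℝ)) (h := fun y ↦ k y * k y) (x := x)
        mdifferentiableAt_const ((hkd x hx).mul (hkd x hx)) w
      rw [diffModel_mul (hkd x hx) (hkd x hx), diffModel_const, zero_apply] at h1
      have h2 : (fun y ↦ -(k y * k y)) = fun y ↦ (-1 : ℝ) • (k y * k y) := by funext y; simp
      rw [h2, h1]
      simp only [smul_eq_mul]
      ring
    rw [hk₁]
    exact key (e₁ x)
  -- The N-coefficient collects -k³ from ∇T = kN and -k from ∇ξ = -N. The T-coefficient is -kk₁ from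
  -- ∇N plus -2kk₁ from the derivative of -k².
  have hV₁₁ : covAlong g.inner F (fun y ↦ covAlong g.inner F V y (e₁ y)) x (e₁ x) =
      (diffModel (E := ℝ) (E' := E') k₁ x (e₁ x) - k x ^ 3 - k x) • frameN φ F e₁ x +
        ((-3 * k x * k₁ x) • frameT F e₁ x + (2 * k₁ x) • ξ (F x)) := by
    have hq : MDifferentiableAt 𝓘(ℝ, E') 𝓘(ℝ, ℝ) (fun y ↦ -(k y * k y)) x :=
      ((hkd x hx).mul (hkd x hx)).neg
    rw [covAlong_congr g.inner (W := fun y ↦ k₁ y • frameN φ F e₁ y +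
      ((-(k y * k y)) • frameT F e₁ y + k y • ξ (F y)))
      (by filter_upwards [hU] with z hz using hV₁ z hz),
      covAlong_add g.inner ((hN x hx).smul (hk₁d x hx))
        (((hT x hx).smul hq).add ((hX x hx).smul (hkd x hx))),
      covAlong_add g.inner ((hT x hx).smul hq) ((hX x hx).smul (hkd x hx)),
      covAlong_smul g.inner (hk₁d x hx) (hN x hx), covAlong_smul g.inner hq (hT x hx),
      covAlong_smul g.inner (hkd x hx) (hX x hx), A.cov_N₁ hS hx, A.cov_T₁ hS hx, A.cov_xi₁ hS hx,
      hd, ← hk]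
    have : diffModel (E := ℝ) (E' := E') k x (e₁ x) = k₁ x := by rw [hk₁]
    rw [this]
    module
  have hV₂₂ : covAlong g.inner F (fun y ↦ covAlong g.inner F V y (e₂ y)) x (e₂ x) =
      (diffModel (E := ℝ) (E' := E') k₂ x (e₂ x) - k x) • frameN φ F e₁ x +
        (2 * k₂ x) • frameT F e₁ x := by
    rw [covAlong_congr g.inner (W := fun y ↦ k₂ y • frameN φ F e₁ y + k y • frameT F e₁ y)
      (by filter_upwards [hU] with z hz using hV₂ z hz),
      covAlong_add g.inner ((hN x hx).smul (hk₂d x hx)) ((hT x hx).smul (hkd x hx)),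
      covAlong_smul g.inner (hk₂d x hx) (hN x hx), covAlong_smul g.inner (hkd x hx) (hT x hx),
      A.cov_N₂ hS hx, A.cov_T₂ hS hx]
    have : diffModel (E := ℝ) (E' := E') k x (e₂ x) = k₂ x := by rw [hk₂]
    rw [this]
    module
  have hrough : roughLaplacian h g.inner F V x =
      -(((diffModel (E := ℝ) (E' := E') k₁ x (e₁ x) - k x ^ 3 - k x) • frameN φ F e₁ x +
        ((-3 * k x * k₁ x) • frameT F e₁ x + (2 * k₁ x) • ξ (F x))) +
      ((diffModel (E := ℝ) (E' := E') k₂ x (e₂ x) - k x) • frameN φ F e₁ x +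
        (2 * k₂ x) • frameT F e₁ x)) := by
    -- Since ∇_{e₁}e₁ = ∇_{e₂}e₂ = 0, the trace of the Hessian is the sum of the two iterated
    -- derivatives.
    have t1 := hessian_eq h g hVs (A.smooth₁ x hx).diffAt (e₁ x)
    have t2 := hessian_eq h g hVs (A.smooth₂ x hx).diffAt (e₂ x)
    rw [(A.cov_e₁ hS hx).1, covAlong_zero_vec, sub_zero, hV₁₁] at t1
    rw [(A.cov_e₂ hS hx (a := 0) (by rw [A.cov_xi₂ hS hx, zero_smul])).1, covAlong_zero_vec,
      sub_zero, hV₂₂] at t2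
    rw [roughLaplacian, A.trace hS hx]
    · rw [t1, t2]
    · intro u v w
      rw [covAlong_add_vec, cov, covAlong_add_vec, covAlong_add_vec]
      simp only [cov]
      abel
    · intro a u w
      rw [covAlong_smul_vec, cov, covAlong_smul_vec, covAlong_smul_vec, smul_sub]
      rfl
    · intro u v w
      exact hessian_add_right h g hVs u v w
    · intro a u w
      exact hessian_smul_right h g hVs a u w
  have hlin : ∀ a : ℝ, ∀ u u' v v' w w', _ := fun a ↦ curvature_add_smul g (F x) a
  have hsm : ∀ (a : ℝ) (u v w : TangentSpace 𝓘(ℝ, Euc 3) (F x)),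
      curvature g.inner (F x) (a • u) v w = a • curvature g.inner (F x) u v w ∧
      curvature g.inner (F x) u (a • v) w = a • curvature g.inner (F x) u v w ∧
      curvature g.inner (F x) u v (a • w) = a • curvature g.inner (F x) u v w := by
    intro a u v w
    have z1 := (curvature_add_smul g (F x) (-1) u u v v w w).1
    have z2 := (curvature_add_smul g (F x) (-1) u u v v w w).2.1
    have z3 := (curvature_add_smul g (F x) (-1) u u v v w w).2.2
    simp only [neg_one_smul, add_neg_cancel] at z1 z2 z3
    have w1 := (curvature_add_smul g (F x) a 0 u v v w w).1
    have w2 := (curvature_add_smul g (F x) a u u 0 v w w).2.1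
    have w3 := (curvature_add_smul g (F x) a u u v v 0 w).2.2
    rw [z1, zero_add, zero_add] at w1
    rw [z2, zero_add, zero_add] at w2
    rw [z3, zero_add, zero_add] at w3
    exact ⟨w1, w2, w3⟩
  -- R(N,T)T contributes c and R(N,ξ)ξ contributes 1. Against the two terms -k of the second
  -- derivatives this leaves the coefficient c - 1.
  have hcurv : metricTrace h x (fun u v ↦ curvature g.inner (F x) (V x) (diff F x u) (diff F x v)) =
      (k x * (c + 1)) • frameN φ F e₁ x := by
    rw [A.trace hS hx]
    · rw [A.vertical x hx, hVU x hx, (hsm _ _ _ _).1, (hsm _ _ _ _).1, hS.curvature_xi, hS.eta_xi,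
        etaN hS]
      have h1 := S.curvature_horizontal (A.TT hx) (A.etaT hx)
      have h2 : curvature g.inner (F x) (frameN φ F e₁ x) (diff F x (e₁ x)) (diff F x (e₁ x)) =
        c • frameN φ F e₁ x := h1
      rw [h2]
      module
    · intro u v w
      have := (hlin 1 (V x) 0 (diff (E' := E') (E := Euc 3) F x u) (diff (E' := E') (E := Euc 3) F x v)
        (diff (E' := E') (E := Euc 3) F x w) 0).2.1
      rw [one_smul, one_smul] at this
      rw [map_add, this]
    · intro a u w
      rw [map_smul, (hsm _ _ _ _).2.1]
    · intro u v w
      have := (hlin 1 (V x) 0 (diff (E' := E') (E := Euc 3) F x u) 0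
        (diff (E' := E') (E := Euc 3) F x v) (diff (E' := E') (E := Euc 3) F x w)).2.2
      rw [one_smul, one_smul] at this
      rw [map_add, this]
    · intro a u w
      rw [map_smul, (hsm _ _ _ _).2.2]
  rw [bitension, jacobi, ← hV, hrough, hcurv]
  module

end AdaptedFrame
end Adapted

lemma isInvertible_of_injective {V : Type*} [NormedAddCommGroup V] [NormedSpace ℝ V]
    [FiniteDimensional ℝ V] (A : V →L[ℝ] V) (h : ∀ v, A v = 0 → v = 0) : A.IsInvertible := by
  have hinj : Function.Injective (A : V →ₗ[ℝ] V) := (injective_iff_map_eq_zero _).2 h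
  refine ⟨(LinearEquiv.ofInjectiveEndo (A : V →ₗ[ℝ] V) hinj).toContinuousLinearEquiv, ?_⟩
  ext v
  rfl

/-! ### Unit speed curves, their squared curvature and the Frenet equations. -/

section Curve

variable {E : Type*} [NormedAddCommGroup E] [NormedSpace ℝ E] [FiniteDimensional ℝ E]
  {B : Type*} [TopologicalSpace B] [ChartedSpace E B] [IsManifold 𝓘(ℝ, E) ∞ B]
  {gB : RMetric E B} {γ : ℝ → B} {J : Set ℝ}

lemma fieldSmoothAt_const {G : Type*} [NormedAddCommGroup G] [NormedSpace ℝ G] (v x : G) :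
    FieldSmoothAt G (fun y : G ↦ y) (fun _ : G ↦ v) x :=
  (fieldSmoothAt_vector contMDiffAt_id).2 contMDiffAt_const

lemma IsUnitSpeedCurve.contMDiffAt (h : IsUnitSpeedCurve gB γ J) {s : ℝ} (hs : s ∈ J) :
    ContMDiffAt 𝓘(ℝ, ℝ) 𝓘(ℝ, E) ∞ γ s := h.smooth.contMDiffAt (h.isOpen.mem_nhds hs)

lemma IsUnitSpeedCurve.smooth_velocity (h : IsUnitSpeedCurve gB γ J) {s : ℝ} (hs : s ∈ J) :
    FieldSmoothAt (E := E) ℝ γ (velocity γ) s :=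
  fieldSmoothAt_diff (h.contMDiffAt hs) (fieldSmoothAt_const (1 : ℝ) s)

lemma IsUnitSpeedCurve.smooth_curveCov (h : IsUnitSpeedCurve gB γ J) {s : ℝ} (hs : s ∈ J) :
    FieldSmoothAt ℝ γ (curveCov gB.inner γ (velocity γ)) s :=
  fieldSmoothAt_covAlong gB (fieldSmoothAt_const (1 : ℝ) s) (h.smooth_velocity hs)

/-- The squared geodesic curvature of a unit speed curve. -/
def curvSq (gB : RMetric E B) (γ : ℝ → B) (s : ℝ) : ℝ :=
  gB.inner (γ s) (curveCov gB.inner γ (velocity γ) s) (curveCov gB.inner γ (velocity γ) s)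

lemma IsUnitSpeedCurve.continuousOn_curvSq (h : IsUnitSpeedCurve gB γ J) :
    ContinuousOn (curvSq gB γ) J := fun _ hs ↦
  (gB.contMDiffAt_inner (h.smooth_curveCov hs) (h.smooth_curveCov hs)).continuousAt.continuousWithinAt

lemma diff_inner_const {V W : ∀ s : ℝ, TangentSpace 𝓘(ℝ, E) (γ s)} (hJ : IsOpen J) {s : ℝ}
    (hs : s ∈ J) (hV : FieldDiffAt ℝ γ V s) (hW : FieldDiffAt ℝ γ W s) {a : ℝ}
    (h : ∀ t ∈ J, gB.inner (γ t) (V t) (W t) = a) :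
    gB.inner (γ s) (curveCov gB.inner γ V s) (W s) = - gB.inner (γ s) (V s) (curveCov gB.inner γ W s) := by
  have h1 := diff_inner (gB.nondegAt (γ s)) hV hW (1 : ℝ)
  have h2 : diffModel (E := ℝ) (E' := ℝ) (fun t ↦ gB.inner (γ t) (V t) (W t)) s = 0 := by
    refine (diffModel_congr (M := ℝ) (f' := fun _ : ℝ ↦ a) ?_).trans (diffModel_const _ _)
    filter_upwards [hJ.mem_nhds hs] with t ht using h t ht
  have h3 : diffModel (E := ℝ) (E' := ℝ) (fun t ↦ gB.inner (γ t) (V t) (W t)) s (1 : ℝ) = 0 := by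
    rw [h2]; rfl
  have h4 : gB.inner (γ s) (curveCov gB.inner γ V s) (W s) +
    gB.inner (γ s) (V s) (curveCov gB.inner γ W s) = 0 := h1.symm.trans h3
  linarith

lemma isGeodesic_of_curvSq (h : ∀ s ∈ J, curvSq gB γ s = 0) : IsGeodesic gB γ J :=
  fun s hs ↦ gB.eq_zero (h s hs)

/-- The normal is k⁻¹∇γ', which is smooth because k is a nonzero constant. In dimension two ∇n is
known from its products with n and γ', and these come from differentiating the constants g(n,n) and
g(n,γ'). -/
lemma isRiemannianCircle_of_curvSq (hE : Module.finrank ℝ E = 2) (hγ : IsUnitSpeedCurve gB γ J)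
    {k : ℝ} (hk : 0 < k) (h : ∀ s ∈ J, curvSq gB γ s = k ^ 2) : IsRiemannianCircle gB γ J k := by
  set n : ∀ s : ℝ, TangentSpace 𝓘(ℝ, E) (γ s) :=
    fun s ↦ k⁻¹ • curveCov gB.inner γ (velocity γ) s with hn
  have hns : ∀ s ∈ J, FieldSmoothAt ℝ γ n s := fun s hs ↦
    (hγ.smooth_curveCov hs).smul (k := fun _ ↦ k⁻¹) contMDiffAt_const
  have hkn : ∀ s, curveCov gB.inner γ (velocity γ) s = k • n s := fun s ↦ by
    rw [hn, smul_smul, mul_inv_cancel₀ hk.ne', one_smul]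
  clear_value n
  have hvv : ∀ s ∈ J, gB.inner (γ s) (velocity γ s) (velocity γ s) = 1 := hγ.unit_speed
  have hnn : ∀ s ∈ J, gB.inner (γ s) (n s) (n s) = 1 := fun s hs ↦ by
    have h1 := h s hs
    have h2 : gB.inner (γ s) (k • n s) (k • n s) = k ^ 2 := by rw [← hkn]; exact h1
    rw [map_smul, map_smul, smul_apply, smul_eq_mul, smul_eq_mul] at h2
    have hk2 : k ^ 2 ≠ 0 := by positivity
    apply mul_left_cancel₀ hk2
    linarith
  have hnv : ∀ s ∈ J, gB.inner (γ s) (n s) (velocity γ s) = 0 := fun s hs ↦ by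
    have h1 := diff_inner_const hγ.isOpen hs (hγ.smooth_velocity hs).diffAt
      (hγ.smooth_velocity hs).diffAt hvv
    rw [gB.symm (γ s) (velocity γ s), hkn, map_smul, smul_apply, smul_eq_mul] at h1
    have : k * gB.inner (γ s) (n s) (velocity γ s) = 0 := by linarith
    exact (mul_eq_zero.1 this).resolve_left hk.ne'
  refine ⟨hk, n, fun s hs ↦ (hns s hs).contMDiffWithinAt, fun s hs ↦
    ⟨hnn s hs, hnv s hs, hkn s, ?_⟩⟩
  have h1 := diff_inner_const hγ.isOpen hs (hns s hs).diffAt (hns s hs).diffAt hnn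
  have h2 := diff_inner_const hγ.isOpen hs (hns s hs).diffAt (hγ.smooth_velocity hs).diffAt hnv
  rw [gB.symm (γ s) (n s)] at h1
  rw [hkn, map_smul, hnn s hs] at h2
  have hvn : gB.inner (γ s) (velocity γ s) (n s) = 0 := by rw [gB.symm, hnv s hs]
  have h3 := sum_orthonormal (V := E) (fun a b ↦ formAt gB.inner (γ s) a b) ![n s, velocity γ s]
    (fun u v w ↦ by rw [map_add, add_apply])
    (fun a u w ↦ by rw [map_smul, smul_apply, smul_eq_mul])
    (by
      intro i j
      fin_cases i <;> fin_cases j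
      exacts [hnn s hs, hnv s hs, hvn, hvv s hs])
    (by simp [hE]) (curveCov gB.inner γ n s)
  rw [Fin.sum_univ_two] at h3
  have h4 : curveCov gB.inner γ n s = gB.inner (γ s) (curveCov gB.inner γ n s) (n s) • n s +
    gB.inner (γ s) (curveCov gB.inner γ n s) (velocity γ s) • velocity γ s := h3
  rw [h4, h2]
  have h5 : gB.inner (γ s) (curveCov gB.inner γ n s) (n s) = 0 := by linarith
  rw [h5]
  simp

end Curve

/-! ### Adapted frames on Hopf patches; the base curve of a polyharmonic cylinder. -/

section Patch

variable {M : Type*} [TopologicalSpace M] [ChartedSpace (Euc 3) M]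
  [IsManifold 𝓘(ℝ, Euc 3) ∞ M]
  {B : Type*} [TopologicalSpace B] [ChartedSpace (Euc 2) B] [IsManifold 𝓘(ℝ, Euc 2) ∞ B]
  {g : RMetric (Euc 3) M}
  {η : ∀ x : M, TangentSpace 𝓘(ℝ, Euc 3) x →L[ℝ] ℝ}
  {ξ : ∀ x : M, TangentSpace 𝓘(ℝ, Euc 3) x}
  {φ : ∀ x : M, TangentSpace 𝓘(ℝ, Euc 3) x →L[ℝ] TangentSpace 𝓘(ℝ, Euc 3) x} {c : ℝ}
  {gB : RMetric (Euc 2) B} {pr : M → B} {γ : ℝ → B} {J : Set ℝ} {U : Set (ℝ × ℝ)} {σ : ℝ × ℝ → ℝ}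
  {F : ℝ × ℝ → M}

lemma IsHopfPatch.contMDiffAt (P : IsHopfPatch pr γ J U σ F) {x : ℝ × ℝ} (hx : x ∈ U) :
    ContMDiffAt 𝓘(ℝ, ℝ × ℝ) 𝓘(ℝ, Euc 3) ∞ F x := P.smooth.contMDiffAt (P.isOpen.mem_nhds hx)

lemma IsHopfPatch.contMDiffAt_sigma (P : IsHopfPatch pr γ J U σ F) {x : ℝ × ℝ} (hx : x ∈ U) :
    ContMDiffAt 𝓘(ℝ, ℝ × ℝ) 𝓘(ℝ, ℝ) ∞ σ x :=
  (P.smooth_sigma.contDiffAt (P.isOpen.mem_nhds hx)).contMDiffAt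

/-- Differentiation of the identity pr ∘ F = γ ∘ σ. -/
lemma IsHopfPatch.diff_pr (P : IsHopfPatch pr γ J U σ F) (b : IsBoothbyWang g η ξ gB pr)
    (hγ : IsUnitSpeedCurve gB γ J) {x : ℝ × ℝ} (hx : x ∈ U) (w : ℝ × ℝ) :
    diffModel (E := Euc 2) (E' := Euc 3) pr (F x) (diffModel (E := Euc 3) (E' := ℝ × ℝ) F x w) =
      diffModel (E := ℝ) (E' := ℝ × ℝ) σ x w • diffModel (E := Euc 2) (E' := ℝ) γ (σ x) 1 := by
  have hF := (P.contMDiffAt hx).mdifferentiableAt (by simp)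
  have hσ := (P.contMDiffAt_sigma hx).mdifferentiableAt (by simp)
  have hs : σ x ∈ J := (P.mem x hx).1
  have hγ' : MDifferentiableAt 𝓘(ℝ, ℝ) 𝓘(ℝ, Euc 2) γ (σ x) :=
    (hγ.contMDiffAt hs).mdifferentiableAt (by simp)
  rw [← diffModel_comp' (b.smooth.contMDiffAt.mdifferentiableAt (by simp)) hF, ← map_smul,
    smul_eq_mul, mul_one, ← diffModel_comp' hγ' hσ]
  refine DFunLike.congr_fun (diffModel_congr ?_) w
  filter_upwards [P.isOpen.mem_nhds hx] with y hy using (P.mem y hy).2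

/-- The coframe `(dσ, F^* η)` of a patch. -/
def coframe (η : ∀ x : M, TangentSpace 𝓘(ℝ, Euc 3) x →L[ℝ] ℝ) (σ : ℝ × ℝ → ℝ) (F : ℝ × ℝ → M)
    (x : ℝ × ℝ) : ℝ × ℝ →L[ℝ] ℝ × ℝ :=
  (diffModel (E := ℝ) (E' := ℝ × ℝ) σ x).prod
    ((show Euc 3 →L[ℝ] ℝ from η (F x)).comp (diffModel (E := Euc 3) (E' := ℝ × ℝ) F x))

lemma coframe_apply (x w : ℝ × ℝ) : coframe η σ F x w =
    (diffModel (E := ℝ) (E' := ℝ × ℝ) σ x w, η (F x) (diff (E := Euc 3) (E' := ℝ × ℝ) F x w)) := rfl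

lemma IsHopfPatch.contDiffAt_coframe (P : IsHopfPatch pr γ J U σ F) (S : IsSasaki g η ξ φ) {x : ℝ × ℝ}
    (hx : x ∈ U) : ContDiffAt ℝ ∞ (coframe η σ F) x := by
  rw [← contMDiffAt_iff_contDiffAt]
  refine contMDiffAt_clm_of_apply fun w ↦ ?_
  exact (contMDiffAt_diffModel_apply (P.contMDiffAt_sigma hx) (fieldSmoothAt_const w x)).prodMk_space
    (S.contMDiffAt_eta (fieldSmoothAt_diff (P.contMDiffAt hx) (fieldSmoothAt_const w x)))

/-- If dσ and F*η vanish on w, then dF(w) is horizontal and dpr kills it. As dpr is isometric on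
horizontal vectors, dF(w) = 0, and F is an immersion. -/
lemma IsHopfPatch.isInvertible_coframe (P : IsHopfPatch pr γ J U σ F) (b : IsBoothbyWang g η ξ gB pr)
    (S : IsSasaki g η ξ φ) (hγ : IsUnitSpeedCurve gB γ J) {x : ℝ × ℝ} (hx : x ∈ U) :
    (coframe η σ F x).IsInvertible := by
  refine isInvertible_of_injective _ fun w hw ↦ ?_
  rw [coframe_apply, Prod.mk_eq_zero] at hw
  have h1 := P.diff_pr b hγ hx w
  rw [hw.1, zero_smul] at h1
  have h2 : diff (E := Euc 3) (E' := ℝ × ℝ) F x w = 0 := by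
    apply g.eq_zero
    rw [← b.inner_diff S (F x) _ _ hw.2]
    have h3 : diff (E := Euc 2) (E' := Euc 3) pr (F x) (diff (E := Euc 3) (E' := ℝ × ℝ) F x w) = 0 := h1
    rw [h3, map_zero]
  exact P.immersion x hx (h2.trans (map_zero _).symm)

/-- The field on a patch with constant components in the coframe. -/
def dualField (η : ∀ x : M, TangentSpace 𝓘(ℝ, Euc 3) x →L[ℝ] ℝ) (σ : ℝ × ℝ → ℝ) (F : ℝ × ℝ → M)
    (w : ℝ × ℝ) (x : ℝ × ℝ) : TangentSpace 𝓘(ℝ, ℝ × ℝ) x := (coframe η σ F x).inverse w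

lemma IsHopfPatch.coframe_dualField (P : IsHopfPatch pr γ J U σ F) (b : IsBoothbyWang g η ξ gB pr)
    (S : IsSasaki g η ξ φ) (hγ : IsUnitSpeedCurve gB γ J) {x : ℝ × ℝ} (hx : x ∈ U) (w : ℝ × ℝ) :
    coframe η σ F x (dualField η σ F w x) = w := by
  obtain ⟨e, he⟩ := P.isInvertible_coframe b S hγ hx
  have : coframe η σ F x ((coframe η σ F x).inverse w) = w := by
    rw [← he, ContinuousLinearMap.inverse_equiv]
    exact e.apply_symm_apply w
  exact this

/-- The frame dual to (dσ, F*η). The image of e₁ is horizontal and projects to γ', so it has unit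
length; dF(e₂) - ξ is horizontal and is killed by dpr, so it is zero. -/
lemma IsHopfPatch.adaptedFrame (P : IsHopfPatch pr γ J U σ F) (b : IsBoothbyWang g η ξ gB pr)
    (S : IsSasaki g η ξ φ) (hγ : IsUnitSpeedCurve gB γ J) :
    AdaptedFrame g η ξ F U (dualField η σ F (1, 0)) (dualField η σ F (0, 1)) := by
  have hsm : ∀ w, ∀ x ∈ U, FieldSmoothAt (ℝ × ℝ) (fun y : ℝ × ℝ ↦ y) (dualField η σ F w) x := by
    intro w x hx
    refine (fieldSmoothAt_vector contMDiffAt_id).2 ?_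
    apply ContDiffAt.contMDiffAt
    exact (((P.isInvertible_coframe b S hγ hx).contDiffAt_map_inverse).comp x
      (P.contDiffAt_coframe S hx)).clm_apply contDiffAt_const
  have hcf : ∀ w, ∀ x ∈ U, diffModel (E := ℝ) (E' := ℝ × ℝ) σ x (dualField η σ F w x) = w.1 ∧
      η (F x) (diff (E := Euc 3) (E' := ℝ × ℝ) F x (dualField η σ F w x)) = w.2 := by
    intro w x hx
    have := P.coframe_dualField b S hγ hx w
    exact Prod.ext_iff.1 ((coframe_apply _ _).symm.trans this)
  have hpr : ∀ w, ∀ x ∈ U, (diff (E := Euc 2) (E' := Euc 3) pr (F x)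
      (diff (E := Euc 3) (E' := ℝ × ℝ) F x (dualField η σ F w x)) : Euc 2) =
      w.1 • diffModel (E := Euc 2) (E' := ℝ) γ (σ x) 1 := by
    intro w x hx
    rw [← (hcf w x hx).1]
    exact P.diff_pr b hγ hx _
  refine ⟨by simp, P.isOpen, fun x hx ↦ P.contMDiffAt hx, P.immersion, hsm _, hsm _, ?_, ?_, ?_⟩
  · intro x hx
    rw [← b.inner_diff S (F x) _ _ (hcf (1, 0) x hx).2]
    have h1 := hγ.unit_speed _ (P.mem x hx).1
    have h2 := (P.mem x hx).2
    have key : ∀ q, q = γ (σ x) → ∀ v : Euc 2, v = (1 : ℝ) • diffModel (E := Euc 2) (E' := ℝ) γ (σ x) 1 →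
      formAt gB.inner q v v = 1 := by
      rintro q rfl v rfl
      rw [one_smul]
      exact h1
    exact key _ h2 _ (hpr (1, 0) x hx)
  · intro x hx
    exact (hcf (1, 0) x hx).2
  · intro x hx
    rw [← sub_eq_zero]
    apply g.eq_zero
    rw [← b.inner_diff S (F x) _ _ (by rw [map_sub, (hcf (0, 1) x hx).2, S.eta_xi, sub_self])]
    have h3 : diff (E := Euc 2) (E' := Euc 3) pr (F x)
        (diff (E := Euc 3) (E' := ℝ × ℝ) F x (dualField η σ F (0, 1) x)) = 0 :=
      (hpr (0, 1) x hx).trans (zero_smul _ _)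
    have h4 : diff (E := Euc 2) (E' := Euc 3) pr (F x)
        (diff (E := Euc 3) (E' := ℝ × ℝ) F x (dualField η σ F (0, 1) x) - ξ (F x)) = 0 := by
      rw [map_sub, b.diff_xi, sub_zero, h3]
    rw [h4, map_zero]

/-- The curvature function of an adapted frame is, up to sign, the curvature of the base curve. -/
lemma IsHopfPatch.frameCurv_sq (P : IsHopfPatch pr γ J U σ F) (b : IsBoothbyWang g η ξ gB pr)
    (S : IsSasaki g η ξ φ) (hγ : IsUnitSpeedCurve gB γ J) {x : ℝ × ℝ} (hx : x ∈ U) :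
    frameCurv g φ F (dualField η σ F (1, 0)) x ^ 2 = curvSq gB γ (σ x) := by
  have A := P.adaptedFrame b S hγ
  set e := dualField η σ F (1, 0) with he
  have hcf : ∀ y ∈ U, diffModel (E := ℝ) (E' := ℝ × ℝ) σ y (e y) = 1 := by
    intro y hy
    have := P.coframe_dualField b S hγ hy (1, 0)
    exact (Prod.ext_iff.1 ((coframe_apply _ _).symm.trans this)).1
  -- Because ∇dpr vanishes on horizontal vectors, dpr(kN) is the derivative along e₁ of dpr(T) = γ',
  -- and this is ∇γ' since dσ(e₁) = 1. Comparing squared lengths gives the claim.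
  have h1 := covAlong_diff g gB (b.smooth.contMDiffAt (x := F x)) (A.smoothT hx).diffAt (e x)
  have h0 : secondFundamentalForm g.inner gB.inner pr (F x)
      (diff (E := Euc 3) (E' := ℝ × ℝ) F x (e x)) (frameT F e x) = 0 :=
    b.secondFundamentalForm_horizontal S (A.etaT hx) (A.etaT hx)
  rw [h0, add_zero, A.cov_T₁ S hx] at h1
  have h2 := covAlong_congr_raw gB.inner (f := fun y ↦ pr (F y)) (f' := fun y ↦ γ (σ y))
    (V := fun y ↦ diff (E := Euc 2) (E' := Euc 3) pr (F y) (frameT F e y))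
    (V' := fun y ↦ velocity γ (σ y)) (x := x) (by
      filter_upwards [P.isOpen.mem_nhds hx] with y hy
      have h3 : (diff (E := Euc 2) (E' := Euc 3) pr (F y) (frameT F e y) : Euc 2) =
          diffModel (E := Euc 2) (E' := ℝ) γ (σ y) 1 := by
        refine (P.diff_pr b hγ hy (e y)).trans ?_
        rw [hcf y hy, one_smul]
      have key : ∀ q, q = γ (σ y) → ∀ v : Euc 2, v = diffModel (E := Euc 2) (E' := ℝ) γ (σ y) 1 →
        (⟨q, v⟩ : TangentBundle 𝓘(ℝ, Euc 2) B) = ⟨γ (σ y), velocity γ (σ y)⟩ := by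
        rintro q rfl v rfl; rfl
      exact key _ (P.mem y hy).2 _ h3) (e x)
  have h4 := covAlong_comp gB.inner (f := γ) (V := velocity γ) (h := σ) (z := x)
    (hγ.smooth_velocity (P.mem x hx).1).diffAt
    ((P.contMDiffAt_sigma hx).mdifferentiableAt (by simp)) (e x)
  rw [h1, h4, hcf x hx] at h2
  have h5 := congrArg (fun z : TangentBundle 𝓘(ℝ, Euc 2) B ↦ gB.inner z.1 z.2 z.2) h2
  have h6 : gB.inner (pr (F x)) (diff (E := Euc 2) (E' := Euc 3) pr (F x)
      (frameCurv g φ F e x • frameN φ F e x)) (diff (E := Euc 2) (E' := Euc 3) pr (F x)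
      (frameCurv g φ F e x • frameN φ F e x)) = curvSq gB γ (σ x) := h5
  rw [← h6, b.inner_diff S _ _ _ (by rw [map_smul, AdaptedFrame.etaN S, smul_zero]), map_smul,
    map_smul, smul_apply, A.NN S hx, smul_eq_mul, smul_eq_mul]
  ring

lemma eq_zero_of_eventually {f : ℝ × ℝ → ℝ} (hU : IsOpen U) (h : ∀ x ∈ U, f x = 0) {x : ℝ × ℝ}
    (hx : x ∈ U) (v : TangentSpace 𝓘(ℝ, ℝ × ℝ) x) : diffModel (E := ℝ) (E' := ℝ × ℝ) f x v = 0 := by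
  have : diffModel (E := ℝ) (E' := ℝ × ℝ) f x = 0 := by
    refine (diffModel_congr (M := ℝ) (f' := fun _ ↦ (0 : ℝ)) ?_).trans (diffModel_const _ _)
    filter_upwards [hU.mem_nhds hx] with y hy using h y hy
  rw [this]; rfl

/-- A biharmonic patch lies over a point where the curvature is `0` or `√(c - 1)`. -/
lemma IsHopfPatch.curvSq_of_bitension (P : IsHopfPatch pr γ J U σ F) (b : IsBoothbyWang g η ξ gB pr)
    (S : IsSasakianSpaceForm g η ξ φ c) (hγ : IsUnitSpeedCurve gB γ J)
    (h : ∀ x ∈ U, bitension (inducedMetric (E' := ℝ × ℝ) g.inner F) g.inner F x = 0)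
    {x : ℝ × ℝ} (hx : x ∈ U) : curvSq gB γ (σ x) = 0 ∨ curvSq gB γ (σ x) = c - 1 := by
  have hS := S.isSasaki
  have A := P.adaptedFrame b hS hγ
  set e₁ := dualField η σ F (1, 0)
  set e₂ := dualField η σ F (0, 1)
  set k := frameCurv g φ F e₁ with hk
  set k₁ : ℝ × ℝ → ℝ := fun y ↦ diffModel (E := ℝ) (E' := ℝ × ℝ) k y (e₁ y) with hk₁
  set k₂ : ℝ × ℝ → ℝ := fun y ↦ diffModel (E := ℝ) (E' := ℝ × ℝ) k y (e₂ y) with hk₂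
  -- The ξ-component gives k₁ = 0 and then the T-component gives k₂ = 0. Both hold on the whole open
  -- set `U`, so the second derivatives vanish as well and the N-component becomes algebraic.
  have hcomp : ∀ y ∈ U, k₁ y = 0 ∧ k₂ y = 0 ∧ diffModel (E := ℝ) (E' := ℝ × ℝ) k₁ y (e₁ y) +
      diffModel (E := ℝ) (E' := ℝ × ℝ) k₂ y (e₂ y) - k y ^ 3 + (c - 1) * k y = 0 := by
    intro y hy
    have h1 := A.bitension_eq S hy hk hk₁ hk₂
    rw [h y hy] at h1
    have hξT : g.inner (F y) (ξ (F y)) (frameT F e₁ y) = 0 := by rw [hS.metric_xi, A.etaT hy]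
    have hξN : g.inner (F y) (ξ (F y)) (frameN φ F e₁ y) = 0 := by
      rw [hS.metric_xi, AdaptedFrame.etaN hS]
    have c1 := congrArg (η (F y)) h1
    have c2 := congrArg (fun w ↦ g.inner (F y) w (frameT F e₁ y)) h1
    have c3 := congrArg (fun w ↦ g.inner (F y) w (frameN φ F e₁ y)) h1
    simp only [map_zero, map_add, map_smul, zero_apply, add_apply, smul_apply, AdaptedFrame.etaN hS,
      A.etaT hy, hS.eta_xi, hξT, hξN, A.TT hy, A.NN hS hy, AdaptedFrame.NT hS, AdaptedFrame.TN hS,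
      smul_eq_mul] at c1 c2 c3
    have d1 : k₁ y = 0 := by linarith
    rw [d1] at c2
    exact ⟨d1, by linarith, by linarith⟩
  obtain ⟨-, -, h3⟩ := hcomp x hx
  rw [eq_zero_of_eventually P.isOpen (fun y hy ↦ (hcomp y hy).1) hx,
    eq_zero_of_eventually P.isOpen (fun y hy ↦ (hcomp y hy).2.1) hx] at h3
  have h4 : k x * (k x ^ 2 - (c - 1)) = 0 := by linarith
  rw [← P.frameCurv_sq b hS hγ hx]
  rcases mul_eq_zero.1 h4 with h5 | h5
  · left; rw [← hk, h5]; ring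
  · right; rw [← hk]; linarith

/-- Patches over curves of constant curvature `√(c - 1)` are biharmonic. -/
lemma IsHopfPatch.bitension_of_curvSq (P : IsHopfPatch pr γ J U σ F) (b : IsBoothbyWang g η ξ gB pr)
    (S : IsSasakianSpaceForm g η ξ φ c) (hγ : IsUnitSpeedCurve gB γ J) (hc : 1 < c)
    (h : ∀ s ∈ J, curvSq gB γ s = c - 1) {x : ℝ × ℝ} (hx : x ∈ U) :
    bitension (inducedMetric (E' := ℝ × ℝ) g.inner F) g.inner F x = 0 := by
  have hS := S.isSasaki
  have A := P.adaptedFrame b hS hγ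
  set e₁ := dualField η σ F (1, 0)
  set e₂ := dualField η σ F (0, 1)
  set k := frameCurv g φ F e₁ with hk
  set k₁ : ℝ × ℝ → ℝ := fun y ↦ diffModel (E := ℝ) (E' := ℝ × ℝ) k y (e₁ y) with hk₁
  set k₂ : ℝ × ℝ → ℝ := fun y ↦ diffModel (E := ℝ) (E' := ℝ × ℝ) k y (e₂ y) with hk₂
  have hsq : ∀ y ∈ U, k y ^ 2 = c - 1 := fun y hy ↦ by
    rw [P.frameCurv_sq b hS hγ hy, h _ (P.mem y hy).1]
  -- Differentiating k² = c - 1 gives 2k dk = 0, and k has no zero since c > 1.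
  have hd : ∀ y ∈ U, ∀ w : ℝ × ℝ, diffModel (E := ℝ) (E' := ℝ × ℝ) k y w = 0 := by
    intro y hy w
    have hkd : MDifferentiableAt 𝓘(ℝ, ℝ × ℝ) 𝓘(ℝ, ℝ) k y :=
      (A.smoothCurv hS hy).mdifferentiableAt (by simp)
    have h1 := diffModel_mul hkd hkd w
    have h2 : diffModel (E := ℝ) (E' := ℝ × ℝ) (fun z ↦ k z * k z) y = 0 := by
      refine (diffModel_congr (M := ℝ) (f' := fun _ ↦ c - 1) ?_).trans (diffModel_const _ _)
      filter_upwards [P.isOpen.mem_nhds hy] with z hz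
      rw [← hsq z hz]; ring
    rw [h2, zero_apply] at h1
    have h3 : k y ≠ 0 := by
      intro h0
      have := hsq y hy
      rw [h0] at this
      linarith
    have h4 : k y * diffModel (E := ℝ) (E' := ℝ × ℝ) k y w = 0 := by linarith
    exact (mul_eq_zero.1 h4).resolve_left h3
  rw [A.bitension_eq S hx hk hk₁ hk₂,
    eq_zero_of_eventually (f := k₁) P.isOpen (fun y hy ↦ hd y hy _) hx,
    eq_zero_of_eventually (f := k₂) P.isOpen (fun y hy ↦ hd y hy _) hx]
  have h1 : k₁ x = 0 := hd x hx _
  have h2 : k₂ x = 0 := hd x hx _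
  have h3 : k x ^ 3 = (c - 1) * k x := by rw [← hsq x hx]; ring
  rw [h1, h2, h3]
  simp

/-- Surjectivity of `pr` gives a patch over every s in J, so the squared curvature is everywhere 0
or c - 1. For c ≤ 1 it must be 0, being nonnegative. For c > 1 continuity on the interval excludes a
change between the two values. -/
theorem curve_of_polyharmonic (b : IsBoothbyWang g η ξ gB pr)
    (S : IsSasakianSpaceForm g η ξ φ c) (hγ : IsUnitSpeedCurve gB γ J)
    (h : IsPolyharmonicHopf g pr γ J) :
    (c ≤ 1 → IsGeodesic gB γ J) ∧
    (1 < c → IsGeodesic gB γ J ∨ IsRiemannianCircle gB γ J (Real.sqrt (c - 1))) := by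
  have hval : ∀ s ∈ J, curvSq gB γ s = 0 ∨ curvSq gB γ s = c - 1 := by
    intro s hs
    obtain ⟨p, hp⟩ := b.surjective (γ s)
    obtain ⟨U, σ, F, P, ⟨x, hx, hxz⟩, hU⟩ := h (s, p) ⟨hs, hp⟩
    have := P.curvSq_of_bitension b S hγ hU hx
    have hσ : σ x = s := (Prod.ext_iff.1 hxz).1
    rwa [hσ] at this
  have hnonneg : ∀ s, 0 ≤ curvSq gB γ s := by
    intro s
    by_cases h0 : curveCov gB.inner γ (velocity γ) s = 0
    · rw [curvSq, h0, map_zero]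
    · exact (gB.pos _ _ h0).le
  constructor
  · intro hc
    refine isGeodesic_of_curvSq fun s hs ↦ ?_
    rcases hval s hs with h1 | h1
    · exact h1
    · have := hnonneg s
      linarith
  · intro hc
    have hpre : IsPreconnected J := hγ.ordConnected.isPreconnected
    obtain ⟨s₀, hs₀⟩ := hγ.nonempty
    have hconst : ∀ s ∈ J, curvSq gB γ s = curvSq gB γ s₀ := by
      intro s hs
      have hfin : ({0, c - 1} : Set ℝ).Finite := Set.toFinite _
      exact hpre.constant_of_mapsTo hfin.isDiscrete hγ.continuousOn_curvSq (T := {0, c - 1})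
        (fun t ht ↦ hval t ht) hs hs₀
    rcases hval s₀ hs₀ with h1 | h1
    · exact Or.inl (isGeodesic_of_curvSq fun s hs ↦ (hconst s hs).trans h1)
    · refine Or.inr (isRiemannianCircle_of_curvSq (by simp) hγ (Real.sqrt_pos.2 (by linarith)) ?_)
      intro s hs
      rw [hconst s hs, h1, Real.sq_sqrt (by linarith)]

end Patch

/-- Local smooth solutions of autonomous differential equations. -/
lemma exists_smooth_solution {V : Type*} [NormedAddCommGroup V] [NormedSpace ℝ V] [CompleteSpace V]
    {f : V → V} {Ω : Set V} (hΩ : IsOpen Ω) (hf : ContDiffOn ℝ ∞ f Ω) {x₀ : V} (hx₀ : x₀ ∈ Ω) :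
    ∃ (α : ℝ → V) (ε : ℝ), 0 < ε ∧ ContDiffOn ℝ ∞ α (Set.Ioo (-ε) ε) ∧
      ∀ t ∈ Set.Ioo (-ε) ε, α t ∈ Ω ∧ HasDerivAt α (f (α t)) t := by
  have hf1 : ContDiffAt ℝ 1 f x₀ := (hf.contDiffAt (hΩ.mem_nhds hx₀)).of_le (by simp)
  obtain ⟨α, hα0, ε, hε, hα⟩ :=
    hf1.exists_forall_mem_closedBall_exists_eq_forall_mem_Ioo_hasDerivAt₀ 0
  have hcont : ContinuousAt α 0 := (hα 0 (by simp [hε])).continuousAt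
  have hev : ∀ᶠ t in 𝓝 (0 : ℝ), α t ∈ Ω :=
    hcont.preimage_mem_nhds (hα0 ▸ hΩ.mem_nhds hx₀)
  obtain ⟨δ, hδ, hball⟩ := Metric.eventually_nhds_iff.1 hev
  have hsol : ∀ t ∈ Set.Ioo (-min ε δ) (min ε δ), α t ∈ Ω ∧ HasDerivAt α (f (α t)) t := by
    intro t ht
    have h1 : |t| < min ε δ := abs_lt.2 ht
    refine ⟨hball (by rw [Real.dist_0_eq_abs]; exact h1.trans_le (min_le_right _ _)), hα t ?_⟩
    have := abs_lt.1 (h1.trans_le (min_le_left _ _))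
    constructor <;> linarith [this.1, this.2]
  refine ⟨α, min ε δ, lt_min hε hδ, ?_, hsol⟩
  -- Bootstrapping: α' = f ∘ α is as regular as α, so every step of the induction gains one
  -- derivative.
  rw [contDiffOn_infty]
  intro n
  induction n with
  | zero =>
    exact contDiffOn_zero.2 fun t ht ↦ (hsol t ht).2.continuousAt.continuousWithinAt
  | succ n ih =>
    have : ((n + 1 : ℕ) : WithTop ℕ∞) = (n : WithTop ℕ∞) + 1 := by push_cast; rfl
    rw [this, contDiffOn_succ_iff_deriv_of_isOpen isOpen_Ioo]
    refine ⟨fun t ht ↦ (hsol t ht).2.differentiableAt.differentiableWithinAt, by simp, ?_⟩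
    refine ((hf.of_le (by exact_mod_cast le_top)).comp ih fun t ht ↦ (hsol t ht).1).congr fun t ht ↦ ?_
    exact (hsol t ht).2.deriv

/-! ### Curves of prescribed constant curvature on a Riemannian surface. -/

section Frame

variable {B : Type*} [TopologicalSpace B] [ChartedSpace (Euc 2) B] [IsManifold 𝓘(ℝ, Euc 2) ∞ B]

lemma contMDiffAt_inv_sqrt {f : B → ℝ} {y : B} (hf : ContMDiffAt 𝓘(ℝ, Euc 2) 𝓘(ℝ, ℝ) ∞ f y)
    (h : 0 < f y) : ContMDiffAt 𝓘(ℝ, Euc 2) 𝓘(ℝ, ℝ) ∞ (fun z ↦ (Real.sqrt (f z))⁻¹) y := by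
  have h1 : ContDiffAt ℝ ∞ (fun t : ℝ ↦ (Real.sqrt t)⁻¹) (f y) :=
    (Real.contDiffAt_sqrt h.ne').inv (Real.sqrt_pos.2 h).ne'
  exact h1.contMDiffAt.comp y hf

/-- Every chart domain of a surface carries an orthonormal frame. -/
lemma exists_orthonormal_frame (gB : RMetric (Euc 2) B) (q : B) :
    ∃ E₁ E₂ : ∀ y : B, TangentSpace 𝓘(ℝ, Euc 2) y, ∀ y ∈ (chartAt (Euc 2) q).source,
      FieldSmoothAt (Euc 2) (fun y : B ↦ y) E₁ y ∧ FieldSmoothAt (Euc 2) (fun y : B ↦ y) E₂ y ∧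
      gB.inner y (E₁ y) (E₁ y) = 1 ∧ gB.inner y (E₁ y) (E₂ y) = 0 ∧
      gB.inner y (E₂ y) (E₂ y) = 1 := by
  set a₁ : Euc 2 := EuclideanSpace.single 0 1 with ha₁
  set a₂ : Euc 2 := EuclideanSpace.single 1 1 with ha₂
  set Z₁ : ∀ y : B, TangentSpace 𝓘(ℝ, Euc 2) y := frameField q a₁ with hZ₁
  set Z₂ : ∀ y : B, TangentSpace 𝓘(ℝ, Euc 2) y := frameField q a₂ with hZ₂
  have hindep : ∀ y ∈ (chartAt (Euc 2) q).source, ∀ l m : ℝ, l • Z₂ y + m • Z₁ y = 0 → l = 0 ∧ m = 0 := by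
    intro y hy l m h
    have h1 : frameAt (E := Euc 2) q y (l • a₂ + m • a₁) = 0 := by
      rw [map_add, map_smul, map_smul]; exact h
    have h2 := componentsL_frameAt hy (l • a₂ + m • a₁)
    rw [h1, map_zero] at h2
    have h3 := congrArg (fun v : Euc 2 ↦ v 1) h2
    have h4 := congrArg (fun v : Euc 2 ↦ v 0) h2
    simp [ha₁, ha₂] at h3 h4
    exact ⟨h3.symm, h4.symm⟩
  have hZ₁s : ∀ y ∈ (chartAt (Euc 2) q).source, FieldSmoothAt (Euc 2) (fun y : B ↦ y) Z₁ y :=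
    fun y hy ↦ fieldSmoothAt_frameField q hy a₁
  have hZ₂s : ∀ y ∈ (chartAt (Euc 2) q).source, FieldSmoothAt (Euc 2) (fun y : B ↦ y) Z₂ y :=
    fun y hy ↦ fieldSmoothAt_frameField q hy a₂
  have hnorm : ∀ y (v : TangentSpace 𝓘(ℝ, Euc 2) y), v ≠ 0 →
      gB.inner y ((Real.sqrt (gB.inner y v v))⁻¹ • v) ((Real.sqrt (gB.inner y v v))⁻¹ • v) = 1 := by
    intro y v hv
    have hp := gB.pos y v hv
    rw [map_smul, map_smul, smul_apply, smul_eq_mul, smul_eq_mul, ← mul_assoc, ← mul_inv,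
      Real.mul_self_sqrt hp.le, inv_mul_cancel₀ hp.ne']
  set E₁ : ∀ y : B, TangentSpace 𝓘(ℝ, Euc 2) y :=
    fun y ↦ (Real.sqrt (gB.inner y (Z₁ y) (Z₁ y)))⁻¹ • Z₁ y with hE₁
  -- The Gram-Schmidt process; `W` has no zero because `Z₁` and `Z₂` are independent.
  set W : ∀ y : B, TangentSpace 𝓘(ℝ, Euc 2) y :=
    fun y ↦ Z₂ y - gB.inner y (Z₂ y) (E₁ y) • E₁ y with hW
  have hZ₁0 : ∀ y ∈ (chartAt (Euc 2) q).source, Z₁ y ≠ 0 := by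
    intro y hy h0
    have := hindep y hy 0 1 (by rw [h0]; simp)
    simp at this
  have hW0 : ∀ y ∈ (chartAt (Euc 2) q).source, W y ≠ 0 := by
    intro y hy h0
    have := hindep y hy 1 (-(gB.inner y (Z₂ y) (E₁ y) * (Real.sqrt (gB.inner y (Z₁ y) (Z₁ y)))⁻¹)) (by
      rw [← h0, hW, hE₁]; module)
    simp at this
  have hE₁s : ∀ y ∈ (chartAt (Euc 2) q).source, FieldSmoothAt (Euc 2) (fun y : B ↦ y) E₁ y :=
    fun y hy ↦ (hZ₁s y hy).smul (contMDiffAt_inv_sqrt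
      (gB.contMDiffAt_inner (hZ₁s y hy) (hZ₁s y hy)) (gB.pos _ _ (hZ₁0 y hy)))
  have hWs : ∀ y ∈ (chartAt (Euc 2) q).source, FieldSmoothAt (Euc 2) (fun y : B ↦ y) W y :=
    fun y hy ↦ (hZ₂s y hy).sub ((hE₁s y hy).smul (gB.contMDiffAt_inner (hZ₂s y hy) (hE₁s y hy)))
  refine ⟨E₁, fun y ↦ (Real.sqrt (gB.inner y (W y) (W y)))⁻¹ • W y, fun y hy ↦
    ⟨hE₁s y hy, (hWs y hy).smul (contMDiffAt_inv_sqrt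
      (gB.contMDiffAt_inner (hWs y hy) (hWs y hy)) (gB.pos _ _ (hW0 y hy))),
      hnorm y _ (hZ₁0 y hy), ?_, hnorm y _ (hW0 y hy)⟩⟩
  have h1 : gB.inner y (E₁ y) (E₁ y) = 1 := hnorm y _ (hZ₁0 y hy)
  have hgs : ∀ a z : TangentSpace 𝓘(ℝ, Euc 2) y, gB.inner y a a = 1 →
      gB.inner y a (z - gB.inner y z a • a) = 0 := by
    intro a z h
    rw [map_sub, map_smul, h, gB.symm y a, smul_eq_mul, mul_one, sub_self]
  have h2 : gB.inner y (E₁ y) (W y) = 0 := hgs _ _ h1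
  rw [map_smul, h2, smul_zero]

lemma expand_frame (gB : RMetric (Euc 2) B) {y : B} {a b : TangentSpace 𝓘(ℝ, Euc 2) y}
    (h1 : gB.inner y a a = 1) (h2 : gB.inner y a b = 0) (h3 : gB.inner y b b = 1)
    (v : TangentSpace 𝓘(ℝ, Euc 2) y) : v = gB.inner y v a • a + gB.inner y v b • b := by
  have h4 : gB.inner y b a = 0 := by rw [gB.symm, h2]
  have h := sum_orthonormal (V := Euc 2) (fun a b ↦ formAt gB.inner y a b) ![a, b]
    (fun u v w ↦ by rw [map_add, add_apply])
    (fun a u w ↦ by rw [map_smul, smul_apply, smul_eq_mul])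
    (by
      intro i j
      fin_cases i <;> fin_cases j
      exacts [h1, h2, h4, h3])
    (by simp) v
  rw [Fin.sum_univ_two] at h
  exact h

/-- There are unit speed curves of any given constant curvature. -/
theorem exists_curve_of_curvature (gB : RMetric (Euc 2) B) (q : B) (k : ℝ) :
    ∃ (γ : ℝ → B) (J : Set ℝ), IsUnitSpeedCurve gB γ J ∧ ∀ s ∈ J, curvSq gB γ s = k ^ 2 := by
  obtain ⟨E₁, E₂, hE⟩ := exists_orthonormal_frame gB q
  set c₁ : B → Euc 2 := fun y ↦ components q (E₁ y) with hc₁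
  set c₂ : B → Euc 2 := fun y ↦ components q (E₂ y) with hc₂
  -- The values on E₁ and E₂ of the connection form ω(v) = g(∇_v E₁, E₂).
  set ω₁ : B → ℝ := fun y ↦ gB.inner y (cov gB.inner E₁ y (E₁ y)) (E₂ y) with hω₁
  set ω₂ : B → ℝ := fun y ↦ gB.inner y (cov gB.inner E₁ y (E₂ y)) (E₂ y) with hω₂
  set ψ := (extChartAt 𝓘(ℝ, Euc 2) q).symm with hψ
  set Ω : Set (Euc 2 × ℝ) := (extChartAt 𝓘(ℝ, Euc 2) q).target ×ˢ Set.univ with hΩ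
  have hΩo : IsOpen Ω := (isOpen_extChartAt_target q).prod isOpen_univ
  have hψsrc : ∀ x ∈ (extChartAt 𝓘(ℝ, Euc 2) q).target, ψ x ∈ (chartAt (Euc 2) q).source := by
    intro x hx
    have := (extChartAt 𝓘(ℝ, Euc 2) q).map_target hx
    rwa [extChartAt_source] at this
  have hψs : ∀ x ∈ (extChartAt 𝓘(ℝ, Euc 2) q).target,
      ContMDiffAt 𝓘(ℝ, Euc 2) 𝓘(ℝ, Euc 2) ∞ ψ x := fun x hx ↦
    (contMDiffOn_extChartAt_symm q).contMDiffAt ((isOpen_extChartAt_target q).mem_nhds hx)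
  have hpull : ∀ {G : Type} [NormedAddCommGroup G] [NormedSpace ℝ G] (u : B → G),
      (∀ y ∈ (chartAt (Euc 2) q).source, ContMDiffAt 𝓘(ℝ, Euc 2) 𝓘(ℝ, G) ∞ u y) →
      ContDiffOn ℝ ∞ (fun z : Euc 2 × ℝ ↦ u (ψ z.1)) Ω := by
    intro G _ _ u hu z hz
    have h1 : ContDiffAt ℝ ∞ (fun x ↦ u (ψ x)) z.1 :=
      ((hu _ (hψsrc z.1 hz.1)).comp z.1 (hψs z.1 hz.1)).contDiffAt
    exact (h1.comp z contDiffAt_fst).contDiffWithinAt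
  -- The unknowns are the chart coordinates of the point and the angle θ of the velocity cos θ E₁ +
  -- sin θ E₂. The acceleration of such a curve is (θ' + ω(γ'))(-sin θ E₁ + cos θ E₂), and the
  -- second component prescribes θ' so that the factor equals k.
  set f : Euc 2 × ℝ → Euc 2 × ℝ := fun z ↦
    (Real.cos z.2 • c₁ (ψ z.1) + Real.sin z.2 • c₂ (ψ z.1),
      k - (Real.cos z.2 * ω₁ (ψ z.1) + Real.sin z.2 * ω₂ (ψ z.1))) with hf
  have hfs : ContDiffOn ℝ ∞ f Ω := by
    have hcos : ContDiffOn ℝ ∞ (fun z : Euc 2 × ℝ ↦ Real.cos z.2) Ω :=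
      (Real.contDiff_cos.comp contDiff_snd).contDiffOn
    have hsin : ContDiffOn ℝ ∞ (fun z : Euc 2 × ℝ ↦ Real.sin z.2) Ω :=
      (Real.contDiff_sin.comp contDiff_snd).contDiffOn
    have d₁ := hpull c₁ fun y hy ↦ ((fieldSmoothAt_iff' (q := q) hy).1 (hE y hy).1).2
    have d₂ := hpull c₂ fun y hy ↦ ((fieldSmoothAt_iff' (q := q) hy).1 (hE y hy).2.1).2
    have d₃ := hpull ω₁ fun y hy ↦ gB.contMDiffAt_inner
      (fieldSmoothAt_cov gB (hE y hy).1 (hE y hy).1) (hE y hy).2.1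
    have d₄ := hpull ω₂ fun y hy ↦ gB.contMDiffAt_inner
      (fieldSmoothAt_cov gB (hE y hy).2.1 (hE y hy).1) (hE y hy).2.1
    exact ((hcos.smul d₁).add (hsin.smul d₂)).prodMk
      (contDiffOn_const.sub ((hcos.mul d₃).add (hsin.mul d₄)))
  obtain ⟨α, ε, hε, hαs, hα⟩ := exists_smooth_solution hΩo hfs
    (x₀ := (extChartAt 𝓘(ℝ, Euc 2) q q, 0)) ⟨mem_extChartAt_target q, trivial⟩
  set J := Set.Ioo (-ε) ε with hJ
  have hJo : IsOpen J := isOpen_Ioo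
  set γ : ℝ → B := fun t ↦ ψ (α t).1 with hγ
  set θ : ℝ → ℝ := fun t ↦ (α t).2 with hθ
  have hγsrc : ∀ t ∈ J, γ t ∈ (chartAt (Euc 2) q).source := fun t ht ↦ hψsrc _ (hα t ht).1.1
  have hαat : ∀ t ∈ J, ContDiffAt ℝ ∞ α t := fun t ht ↦ hαs.contDiffAt (hJo.mem_nhds ht)
  have hγs : ∀ t ∈ J, ContMDiffAt 𝓘(ℝ, ℝ) 𝓘(ℝ, Euc 2) ∞ γ t := fun t ht ↦
    (hψs _ (hα t ht).1.1).comp t (contDiffAt_fst.comp t (hαat t ht)).contMDiffAt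
  have hθd : ∀ t ∈ J, HasDerivAt θ (f (α t)).2 t := fun t ht ↦ by
    have := (hα t ht).2.hasFDerivAt.snd.hasDerivAt
    simpa using this
  have hx : ∀ t ∈ J, HasDerivAt (fun t ↦ (α t).1) (f (α t)).1 t := fun t ht ↦ by
    have := (hα t ht).2.hasFDerivAt.fst.hasDerivAt
    simpa using this
  have hvel : ∀ t ∈ J, velocity γ t = Real.cos (θ t) • E₁ (γ t) + Real.sin (θ t) • E₂ (γ t) := by
    intro t ht
    have h1 : ∀ᶠ s in 𝓝 t, extChartAt 𝓘(ℝ, Euc 2) q (γ s) = (α s).1 := by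
      filter_upwards [hJo.mem_nhds ht] with s hs
      exact (extChartAt 𝓘(ℝ, Euc 2) q).right_inv (hα s hs).1.1
    have h2 := diffModel_comp (f := extChartAt 𝓘(ℝ, Euc 2) q) (F := γ) (x := t)
      ((contMDiffAt_extChartAt' (n := ∞) (hγsrc t ht)).mdifferentiableAt (by simp))
      ((hγs t ht).mdifferentiableAt (by simp)) (1 : ℝ)
    rw [diffModel_congr h1, diffModel_extChartAt (hγsrc t ht), diffModel_eq_fderiv] at h2
    have h3 : fderiv ℝ (fun s ↦ (α s).1) t 1 = (f (α t)).1 := (hx t ht).deriv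
    rw [h3] at h2
    have h4 := congrArg (frameAt (E := Euc 2) q (γ t)) h2
    rw [frameAt_componentsL (hγsrc t ht)] at h4
    refine h4.symm.trans ?_
    have key : ∀ a b : Euc 2, frameAt (E := Euc 2) q (γ t) (Real.cos (θ t) • componentsL q (γ t) a +
        Real.sin (θ t) • componentsL q (γ t) b) = Real.cos (θ t) • a + Real.sin (θ t) • b := by
      intro a b
      rw [map_add, map_smul, map_smul, frameAt_componentsL (hγsrc t ht),
        frameAt_componentsL (hγsrc t ht)]
    exact key (E₁ (γ t)) (E₂ (γ t))
  refine ⟨γ, J, ⟨hJo, Set.ordConnected_Ioo, ⟨0, by simp [hJ, hε]⟩,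
    fun t ht ↦ (hγs t ht).contMDiffWithinAt, ?_⟩, ?_⟩
  · intro t ht
    obtain ⟨-, -, o1, o2, o3⟩ := hE _ (hγsrc t ht)
    have o4 : gB.inner (γ t) (E₂ (γ t)) (E₁ (γ t)) = 0 := by rw [gB.symm, o2]
    rw [hvel t ht]
    simp only [map_add, map_smul, add_apply, smul_apply, o1, o2, o3, o4, smul_eq_mul]
    have := Real.cos_sq_add_sin_sq (θ t)
    linarith
  · intro t ht
    have hs := hγsrc t ht
    obtain ⟨s1, s2, o1, o2, o3⟩ := hE _ hs
    have o4 : gB.inner (γ t) (E₂ (γ t)) (E₁ (γ t)) = 0 := by rw [gB.symm, o2]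
    have hsrc : ∀ᶠ y in 𝓝 (γ t), y ∈ (chartAt (Euc 2) q).source :=
      (chartAt (Euc 2) q).open_source.mem_nhds hs
    have hconst : ∀ (f₁ : B → ℝ) (a : ℝ) (v : Euc 2), (∀ y ∈ (chartAt (Euc 2) q).source, f₁ y = a) →
        diffModel (E := ℝ) (E' := Euc 2) f₁ (γ t) v = 0 := by
      intro f₁ a v h
      have : diffModel (E := ℝ) (E' := Euc 2) f₁ (γ t) = 0 := by
        refine (diffModel_congr (M := ℝ) (f' := fun _ : B ↦ a) ?_).trans (diffModel_const _ _)
        filter_upwards [hsrc] with y hy using h y hy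
      rw [this, zero_apply]
    -- Orthonormality makes the connection matrix skew, so ω determines the derivatives of both
    -- frame fields.
    have hcov : ∀ v : TangentSpace 𝓘(ℝ, Euc 2) (γ t), cov gB.inner E₁ (γ t) v =
        gB.inner (γ t) (cov gB.inner E₁ (γ t) v) (E₂ (γ t)) • E₂ (γ t) ∧
        cov gB.inner E₂ (γ t) v =
        -(gB.inner (γ t) (cov gB.inner E₁ (γ t) v) (E₂ (γ t)) • E₁ (γ t)) := by
      intro v
      have i11 := diff_inner (f := fun y : B ↦ y) (gB.nondegAt (γ t)) s1.diffAt s1.diffAt v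
      have i12 := diff_inner (f := fun y : B ↦ y) (gB.nondegAt (γ t)) s1.diffAt s2.diffAt v
      have i22 := diff_inner (f := fun y : B ↦ y) (gB.nondegAt (γ t)) s2.diffAt s2.diffAt v
      have z11 := hconst _ 1 v fun y hy ↦ (hE y hy).2.2.1
      have z12 := hconst _ 0 v fun y hy ↦ (hE y hy).2.2.2.1
      have z22 := hconst _ 1 v fun y hy ↦ (hE y hy).2.2.2.2
      have e11 : 0 = gB.inner (γ t) (cov gB.inner E₁ (γ t) v) (E₁ (γ t)) +
        gB.inner (γ t) (E₁ (γ t)) (cov gB.inner E₁ (γ t) v) := z11.symm.trans i11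
      have e12 : 0 = gB.inner (γ t) (cov gB.inner E₁ (γ t) v) (E₂ (γ t)) +
        gB.inner (γ t) (E₁ (γ t)) (cov gB.inner E₂ (γ t) v) := z12.symm.trans i12
      have e22 : 0 = gB.inner (γ t) (cov gB.inner E₂ (γ t) v) (E₂ (γ t)) +
        gB.inner (γ t) (E₂ (γ t)) (cov gB.inner E₂ (γ t) v) := z22.symm.trans i22
      rw [gB.symm (γ t) (E₁ (γ t))] at e11 e12
      rw [gB.symm (γ t) (E₂ (γ t))] at e22
      have d1 : gB.inner (γ t) (cov gB.inner E₁ (γ t) v) (E₁ (γ t)) = 0 := by linarith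
      have d2 : gB.inner (γ t) (cov gB.inner E₂ (γ t) v) (E₂ (γ t)) = 0 := by linarith
      have d3 : gB.inner (γ t) (cov gB.inner E₂ (γ t) v) (E₁ (γ t)) =
        - gB.inner (γ t) (cov gB.inner E₁ (γ t) v) (E₂ (γ t)) := by linarith
      constructor
      · conv_lhs => rw [expand_frame gB o1 o2 o3 (cov gB.inner E₁ (γ t) v), d1, zero_smul, zero_add]
      · conv_lhs => rw [expand_frame gB o1 o2 o3 (cov gB.inner E₂ (γ t) v), d2, d3, zero_smul,
          add_zero, neg_smul]
    have hmd : MDifferentiableAt 𝓘(ℝ, ℝ) 𝓘(ℝ, Euc 2) γ t := (hγs t ht).mdifferentiableAt (by simp)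
    have f1 : FieldDiffAt ℝ γ (fun s ↦ E₁ (γ s)) t := FieldDiffAt.comp (f := fun y : B ↦ y) s1.diffAt hmd
    have f2 : FieldDiffAt ℝ γ (fun s ↦ E₂ (γ s)) t := FieldDiffAt.comp (f := fun y : B ↦ y) s2.diffAt hmd
    have hcosd : HasDerivAt (fun s ↦ Real.cos (θ s)) (-Real.sin (θ t) * (f (α t)).2) t := (hθd t ht).cos
    have hsind : HasDerivAt (fun s ↦ Real.sin (θ s)) (Real.cos (θ t) * (f (α t)).2) t := (hθd t ht).sin
    have m1 : MDifferentiableAt 𝓘(ℝ, ℝ) 𝓘(ℝ, ℝ) (fun s ↦ Real.cos (θ s)) t :=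
      hcosd.differentiableAt.mdifferentiableAt
    have m2 : MDifferentiableAt 𝓘(ℝ, ℝ) 𝓘(ℝ, ℝ) (fun s ↦ Real.sin (θ s)) t :=
      hsind.differentiableAt.mdifferentiableAt
    have n1 : diffModel (E := ℝ) (E' := ℝ) (fun s ↦ Real.cos (θ s)) t (1 : ℝ) =
        -Real.sin (θ t) * (f (α t)).2 := by
      rw [diffModel_eq_fderiv]; exact hcosd.deriv
    have n2 : diffModel (E := ℝ) (E' := ℝ) (fun s ↦ Real.sin (θ s)) t (1 : ℝ) =
        Real.cos (θ t) * (f (α t)).2 := by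
      rw [diffModel_eq_fderiv]; exact hsind.deriv
    have g1 : covAlong gB.inner γ (fun s ↦ E₁ (γ s)) t (1 : ℝ) = cov gB.inner E₁ (γ t) (velocity γ t) :=
      covAlong_comp gB.inner (f := fun y : B ↦ y) (V := E₁) (h := γ) (z := t) s1.diffAt hmd (1 : ℝ)
    have g2 : covAlong gB.inner γ (fun s ↦ E₂ (γ s)) t (1 : ℝ) = cov gB.inner E₂ (γ t) (velocity γ t) :=
      covAlong_comp gB.inner (f := fun y : B ↦ y) (V := E₂) (h := γ) (z := t) s2.diffAt hmd (1 : ℝ)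
    have hω : gB.inner (γ t) (cov gB.inner E₁ (γ t) (velocity γ t)) (E₂ (γ t)) =
        Real.cos (θ t) * ω₁ (γ t) + Real.sin (θ t) * ω₂ (γ t) := by
      have h1 := covAlong_add_vec gB.inner (f := fun y : B ↦ y) (V := E₁) (x := γ t)
        (Real.cos (θ t) • E₁ (γ t)) (Real.sin (θ t) • E₂ (γ t))
      rw [covAlong_smul_vec, covAlong_smul_vec] at h1
      have h2 : cov gB.inner E₁ (γ t) (velocity γ t) = Real.cos (θ t) • cov gB.inner E₁ (γ t) (E₁ (γ t)) +
          Real.sin (θ t) • cov gB.inner E₁ (γ t) (E₂ (γ t)) := by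
        rw [hvel t ht]; exact h1
      rw [h2, map_add, map_smul, map_smul, add_apply, smul_apply, smul_apply, smul_eq_mul, smul_eq_mul]
    have hmain : curveCov gB.inner γ (velocity γ) t =
        (-(k * Real.sin (θ t))) • E₁ (γ t) + (k * Real.cos (θ t)) • E₂ (γ t) := by
      have h1 := covAlong_congr gB.inner (f := γ) (V := velocity γ)
        (W := fun s ↦ Real.cos (θ s) • E₁ (γ s) + Real.sin (θ s) • E₂ (γ s)) (x := t)
        (by filter_upwards [hJo.mem_nhds ht] with s hs using hvel s hs) (1 : ℝ)
      have h2 : ∀ v : TangentSpace 𝓘(ℝ, ℝ) t, covAlong gB.inner γ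
          (fun s ↦ Real.cos (θ s) • E₁ (γ s) + Real.sin (θ s) • E₂ (γ s)) t v = _ := fun v ↦ by
        rw [covAlong_add gB.inner (f1.smul m1) (f2.smul m2), covAlong_smul gB.inner m1 f1,
          covAlong_smul gB.inner m2 f2]
      refine h1.trans ((h2 (1 : ℝ)).trans ?_)
      rw [(hcov _).1, hω] at g1
      rw [(hcov _).2, hω] at g2
      have key : ∀ (p r : ℝ) (X₁ X₂ : TangentSpace 𝓘(ℝ, Euc 2) (γ t)),
          p = -Real.sin (θ t) * (k - (Real.cos (θ t) * ω₁ (γ t) + Real.sin (θ t) * ω₂ (γ t))) →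
          r = Real.cos (θ t) * (k - (Real.cos (θ t) * ω₁ (γ t) + Real.sin (θ t) * ω₂ (γ t))) →
          X₁ = (Real.cos (θ t) * ω₁ (γ t) + Real.sin (θ t) * ω₂ (γ t)) • E₂ (γ t) →
          X₂ = -((Real.cos (θ t) * ω₁ (γ t) + Real.sin (θ t) * ω₂ (γ t)) • E₁ (γ t)) →
          p • E₁ (γ t) + Real.cos (θ t) • X₁ + (r • E₂ (γ t) + Real.sin (θ t) • X₂) =
          (-(k * Real.sin (θ t))) • E₁ (γ t) + (k * Real.cos (θ t)) • E₂ (γ t) := by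
        rintro p r X₁ X₂ rfl rfl rfl rfl
        module
      exact key _ _ _ _ n1 n2 g1 g2
    rw [curvSq, hmain]
    simp only [map_add, map_smul, add_apply, smul_apply, o1, o2, o3, o4, smul_eq_mul]
    linear_combination (k ^ 2) * Real.cos_sq_add_sin_sq (θ t)

end Frame

/-- The inverse function theorem, with an inverse that is smooth on an open set. -/
lemma exists_smooth_local_inverse {V W : Type*} [NormedAddCommGroup V] [NormedSpace ℝ V]
    [CompleteSpace V] [NormedAddCommGroup W] [NormedSpace ℝ W] {f : V → W} {D : Set V}
    (hD : IsOpen D) (hf : ContDiffOn ℝ ∞ f D) {x₀ : V} (hx₀ : x₀ ∈ D)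
    (hinv : (fderiv ℝ f x₀).IsInvertible) :
    ∃ (T : Set W) (ψ : W → V), IsOpen T ∧ f x₀ ∈ T ∧ ContDiffOn ℝ ∞ ψ T ∧
      (∀ w ∈ T, ψ w ∈ D ∧ f (ψ w) = w) ∧ ψ (f x₀) = x₀ := by
  have hat : ∀ x ∈ D, ContDiffAt ℝ ∞ f x := fun x hx ↦ hf.contDiffAt (hD.mem_nhds hx)
  have hder : ∀ x ∈ D, HasFDerivAt f (fderiv ℝ f x) x := fun x hx ↦
    ((hat x hx).differentiableAt (by simp)).hasFDerivAt
  obtain ⟨L, hL⟩ := hinv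
  have h0 : HasFDerivAt f (L : V →L[ℝ] W) x₀ := hL ▸ hder x₀ hx₀
  set e := (hat x₀ hx₀).toOpenPartialHomeomorph f h0 (by simp) with he
  have hef : ∀ x, e x = f x := fun x ↦ rfl
  have hsrc : x₀ ∈ e.source := (hat x₀ hx₀).mem_toOpenPartialHomeomorph_source h0 (by simp)
  -- The local inverse is known to be smooth only at images of points where the derivative is
  -- invertible. These points form an open set, to which the target is cut down.
  set D' : Set V := D ∩ fderiv ℝ f ⁻¹' Set.range ((↑) : (V ≃L[ℝ] W) → V →L[ℝ] W) with hD'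
  have hD'o : IsOpen D' :=
    (hf.continuousOn_fderiv_of_isOpen hD (by simp)).isOpen_inter_preimage hD
      ContinuousLinearEquiv.isOpen
  refine ⟨e.target ∩ e.symm ⁻¹' D', e.symm, e.isOpen_inter_preimage_symm hD'o, ?_, ?_, ?_, ?_⟩
  · refine ⟨e.map_source hsrc, ?_⟩
    have : e.symm (f x₀) = x₀ := e.left_inv hsrc
    rw [Set.mem_preimage, this]
    exact ⟨hx₀, L, hL⟩
  · rintro w ⟨hw, hwD, L', hL'⟩
    exact (e.contDiffAt_symm hw (hL' ▸ hder _ hwD) (hat _ hwD)).contDiffWithinAt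
  · rintro w ⟨hw, hwD, -⟩
    exact ⟨hwD, e.right_inv hw⟩
  · exact e.left_inv hsrc

/-! ### Local parametrisations of Hopf cylinders; proper polyharmonic cylinders. -/

section Patch

variable {M : Type*} [TopologicalSpace M] [ChartedSpace (Euc 3) M]
  [IsManifold 𝓘(ℝ, Euc 3) ∞ M]
  {B : Type*} [TopologicalSpace B] [ChartedSpace (Euc 2) B] [IsManifold 𝓘(ℝ, Euc 2) ∞ B]
  {g : RMetric (Euc 3) M}
  {η : ∀ x : M, TangentSpace 𝓘(ℝ, Euc 3) x →L[ℝ] ℝ}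
  {ξ : ∀ x : M, TangentSpace 𝓘(ℝ, Euc 3) x}
  {φ : ∀ x : M, TangentSpace 𝓘(ℝ, Euc 3) x →L[ℝ] TangentSpace 𝓘(ℝ, Euc 3) x} {c : ℝ}
  {gB : RMetric (Euc 2) B} {pr : M → B} {γ : ℝ → B} {J : Set ℝ}

/-- Hopf cylinders have local parametrisations around each of their points. -/
theorem exists_hopfPatch (b : IsBoothbyWang g η ξ gB pr) (S : IsSasaki g η ξ φ)
    (hγ : IsUnitSpeedCurve gB γ J) {z : ℝ × M} (hz : z ∈ hopfCylinder pr γ J) :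
    ∃ (U : Set (ℝ × ℝ)) (σ : ℝ × ℝ → ℝ) (F : ℝ × ℝ → M),
      IsHopfPatch pr γ J U σ F ∧ ∃ x ∈ U, (σ x, F x) = z := by
  obtain ⟨s₀, p⟩ := z
  obtain ⟨hs₀, hp⟩ : s₀ ∈ J ∧ pr p = γ s₀ := hz
  set ψ := (extChartAt 𝓘(ℝ, Euc 3) p).symm with hψ
  -- A linear function of the chart coordinates serves as coordinate along the fibres. With the
  -- value of η at p as coefficients, it completes dpr to an injective map at p, because dpr is
  -- isometric on ker η.
  set L : Euc 3 →L[ℝ] ℝ := η p with hL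
  set D : Set (Euc 3) := (extChartAt 𝓘(ℝ, Euc 3) p).target ∩ ψ ⁻¹' (pr ⁻¹' (chartAt (Euc 2) (pr p)).source)
    with hD
  have hψo := isOpen_extChartAt_target (I := 𝓘(ℝ, Euc 3)) p
  have hψs : ∀ x ∈ (extChartAt 𝓘(ℝ, Euc 3) p).target,
      ContMDiffAt 𝓘(ℝ, Euc 3) 𝓘(ℝ, Euc 3) ∞ ψ x := fun x hx ↦
    (contMDiffOn_extChartAt_symm p).contMDiffAt (hψo.mem_nhds hx)
  have hDo : IsOpen D :=
    (continuousOn_extChartAt_symm p).isOpen_inter_preimage hψo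
      ((chartAt (Euc 2) (pr p)).open_source.preimage b.smooth.continuous)
  set Θ : Euc 3 → Euc 2 × ℝ := fun x ↦ (extChartAt 𝓘(ℝ, Euc 2) (pr p) (pr (ψ x)), L x) with hΘ
  have hprψ : ∀ x ∈ D, ContDiffAt ℝ ∞ (fun x ↦ extChartAt 𝓘(ℝ, Euc 2) (pr p) (pr (ψ x))) x := by
    intro x hx
    have h1 : ContMDiffAt 𝓘(ℝ, Euc 2) 𝓘(ℝ, Euc 2) ∞ (extChartAt 𝓘(ℝ, Euc 2) (pr p)) (pr (ψ x)) :=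
      contMDiffAt_extChartAt' hx.2
    exact ((h1.comp (ψ x) b.smooth.contMDiffAt).comp x (hψs x hx.1)).contDiffAt
  have hΘs : ContDiffOn ℝ ∞ Θ D := fun x hx ↦
    ((hprψ x hx).prodMk L.contDiff.contDiffAt).contDiffWithinAt
  set x₀ := extChartAt 𝓘(ℝ, Euc 3) p p with hx₀
  have hψx₀ : ψ x₀ = p := extChartAt_to_inv p
  have hx₀D : x₀ ∈ D := ⟨mem_extChartAt_target p, by
    rw [Set.mem_preimage, hψx₀]; exact mem_chart_source (Euc 2) (pr p)⟩
  have hchart : MDifferentiableAt 𝓘(ℝ, Euc 2) 𝓘(ℝ, Euc 2) (extChartAt 𝓘(ℝ, Euc 2) (pr p)) (pr p) :=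
    (contMDiffAt_extChartAt (n := ∞)).mdifferentiableAt (by simp)
  have hprd : MDifferentiableAt 𝓘(ℝ, Euc 3) 𝓘(ℝ, Euc 2) pr p :=
    b.smooth.contMDiffAt.mdifferentiableAt (by simp)
  have hder : ∀ v, fderiv ℝ Θ x₀ v = (diffModel (E := Euc 2) (E' := Euc 3) pr p v, L v) := by
    intro v
    have h1 : HasFDerivAt Θ ((fderiv ℝ (fun x ↦ extChartAt 𝓘(ℝ, Euc 2) (pr p) (pr (ψ x))) x₀).prod L) x₀ :=
      (((hprψ x₀ hx₀D).differentiableAt (by simp)).hasFDerivAt).prodMk L.hasFDerivAt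
    rw [h1.fderiv]
    have h2 := diffModel_eq_fderiv_chart (φ := fun y ↦ extChartAt 𝓘(ℝ, Euc 2) (pr p) (pr y)) (x := p)
      (hchart.comp p hprd)
    have h3 := diffModel_comp hchart hprd v
    rw [h2, diffModel_extChartAt (mem_chart_source (Euc 2) (pr p)), componentsL_self] at h3
    exact Prod.ext h3 rfl
  have hinv : (fderiv ℝ Θ x₀).IsInvertible := by
    have hinj : Function.Injective (fderiv ℝ Θ x₀ : Euc 3 →ₗ[ℝ] Euc 2 × ℝ) := by
      rw [injective_iff_map_eq_zero]
      intro v hv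
      have h1 : (diffModel (E := Euc 2) (E' := Euc 3) pr p v, L v) = 0 := (hder v).symm.trans hv
      rw [Prod.mk_eq_zero] at h1
      have h2 : g.inner p v v = 0 := by
        rw [← b.inner_diff S p v v h1.2]
        have h3 : diff (E := Euc 2) (E' := Euc 3) pr p v = 0 := h1.1
        rw [h3, map_zero]
      exact g.eq_zero h2
    refine ⟨(LinearEquiv.ofInjectiveOfFinrankEq _ hinj (by simp)).toContinuousLinearEquiv, ?_⟩
    ext v <;> rfl
  obtain ⟨T, Ψ, hTo, hT₀, hΨs, hΨ, hΨ₀⟩ := exists_smooth_local_inverse hDo hΘs hx₀D hinv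
  set J' : Set ℝ := J ∩ γ ⁻¹' (chartAt (Euc 2) (pr p)).source with hJ'
  have hJ'o : IsOpen J' := hγ.smooth.continuousOn.isOpen_inter_preimage hγ.isOpen
    (chartAt (Euc 2) (pr p)).open_source
  -- The cylinder is the set where the base coordinate runs along γ. The first parameter is that of
  -- γ, the second is the fibre coordinate `L`.
  set u : ℝ × ℝ → Euc 2 × ℝ := fun x ↦ (extChartAt 𝓘(ℝ, Euc 2) (pr p) (γ x.1), x.2) with hu
  have hus : ContDiffOn ℝ ∞ u (J' ×ˢ Set.univ) := by
    rintro x ⟨hx, -⟩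
    have h1 : ContMDiffAt 𝓘(ℝ, Euc 2) 𝓘(ℝ, Euc 2) ∞ (extChartAt 𝓘(ℝ, Euc 2) (pr p)) (γ x.1) :=
      contMDiffAt_extChartAt' hx.2
    have h2 : ContDiffAt ℝ ∞ (fun s ↦ extChartAt 𝓘(ℝ, Euc 2) (pr p) (γ s)) x.1 :=
      (h1.comp x.1 (hγ.contMDiffAt hx.1)).contDiffAt
    exact ((h2.comp x contDiffAt_fst).prodMk contDiffAt_snd).contDiffWithinAt
  set U : Set (ℝ × ℝ) := (J' ×ˢ Set.univ) ∩ u ⁻¹' T with hU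
  have hUo : IsOpen U := hus.continuousOn.isOpen_inter_preimage (hJ'o.prod isOpen_univ) hTo
  set F : ℝ × ℝ → M := fun x ↦ ψ (Ψ (u x)) with hF
  have hFs : ∀ x ∈ U, ContMDiffAt 𝓘(ℝ, ℝ × ℝ) 𝓘(ℝ, Euc 3) ∞ F x := by
    intro x hx
    have h1 : ContDiffAt ℝ ∞ u x := hus.contDiffAt ((hJ'o.prod isOpen_univ).mem_nhds hx.1)
    have h2 : ContDiffAt ℝ ∞ Ψ (u x) := hΨs.contDiffAt (hTo.mem_nhds hx.2)
    exact (hψs _ (hΨ _ hx.2).1.1).comp x (h2.comp x h1).contMDiffAt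
  have hprF : ∀ x ∈ U, pr (F x) = γ x.1 := by
    intro x hx
    obtain ⟨h1, h2⟩ := hΨ _ hx.2
    have h3 : extChartAt 𝓘(ℝ, Euc 2) (pr p) (pr (F x)) = extChartAt 𝓘(ℝ, Euc 2) (pr p) (γ x.1) :=
      (Prod.ext_iff.1 h2).1
    refine (extChartAt 𝓘(ℝ, Euc 2) (pr p)).injOn ?_ ?_ h3
    · rw [extChartAt_source]; exact h1.2
    · rw [extChartAt_source]; exact hx.1.1.2
  have hLF : ∀ x ∈ U, L (extChartAt 𝓘(ℝ, Euc 3) p (F x)) = x.2 := by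
    intro x hx
    obtain ⟨h1, h2⟩ := hΨ _ hx.2
    have h3 : extChartAt 𝓘(ℝ, Euc 3) p (F x) = Ψ (u x) := (extChartAt 𝓘(ℝ, Euc 3) p).right_inv h1.1
    rw [h3]
    exact (Prod.ext_iff.1 h2).2
  have hFsrc : ∀ x ∈ U, F x ∈ (chartAt (Euc 3) p).source := by
    intro x hx
    have := (extChartAt 𝓘(ℝ, Euc 3) p).map_target (hΨ _ hx.2).1.1
    rwa [extChartAt_source] at this
  refine ⟨U, Prod.fst, F, ⟨hUo, contDiff_fst.contDiffOn, fun x hx ↦ (hFs x hx).contMDiffWithinAt,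
    ?_, fun x hx ↦ ⟨hx.1.1.1, hprF x hx⟩⟩, (s₀, L x₀), ?_, ?_⟩
  · intro x hx
    rw [injective_iff_map_eq_zero]
    intro w hw
    have hFd := (hFs x hx).mdifferentiableAt (by simp)
    have hw' : diffModel (E := Euc 3) (E' := ℝ × ℝ) F x w = 0 := hw
    -- Composition with `pr` recovers the first component of w, as γ' ≠ 0, and composition with `L`
    -- in the chart recovers the second.
    have key : ∀ w : ℝ × ℝ, diffModel (E := Euc 3) (E' := ℝ × ℝ) F x w = 0 → w = 0 := by
      intro w hw
      have hs : x.1 ∈ J := hx.1.1.1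
      have h1 := diffModel_comp' (b.smooth.contMDiffAt.mdifferentiableAt (by simp) (x := F x)) hFd w
      have h2 := diffModel_comp' (f := γ) (F := fun x : ℝ × ℝ ↦ x.1) (x := x)
        ((hγ.contMDiffAt hs).mdifferentiableAt (by simp))
        (differentiableAt_fst.mdifferentiableAt) w
      have h3 : diffModel (E := Euc 2) (E' := ℝ × ℝ) (fun y ↦ pr (F y)) x =
          diffModel (E := Euc 2) (E' := ℝ × ℝ) (fun y : ℝ × ℝ ↦ γ y.1) x := by
        apply diffModel_congr
        filter_upwards [hUo.mem_nhds hx] with y hy using hprF y hy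
      rw [hw, map_zero, h3, h2] at h1
      have h4 : diffModel (E := ℝ) (E' := ℝ × ℝ) (fun y : ℝ × ℝ ↦ y.1) x w = w.1 := by
        rw [diffModel_eq_fderiv]; simp [fderiv_fst]
      have h5 : w.1 = 0 := by
        by_contra h0
        have h6 : w.1 • diffModel (E := Euc 2) (E' := ℝ) γ x.1 1 = 0 := by
          rw [← map_smul, smul_eq_mul, mul_one, ← h4]; exact h1
        have h7 : velocity (E := Euc 2) γ x.1 = 0 := (smul_eq_zero.1 h6).resolve_left h0
        have h8 := hγ.unit_speed x.1 hs
        rw [h7, map_zero] at h8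
        exact zero_ne_one h8
      have hcd : MDifferentiableAt 𝓘(ℝ, Euc 3) 𝓘(ℝ, Euc 3) (extChartAt 𝓘(ℝ, Euc 3) p) (F x) :=
        (contMDiffAt_extChartAt' (n := ∞) (hFsrc x hx)).mdifferentiableAt (by simp)
      have h6 := diffModel_clm L (f := fun y ↦ extChartAt 𝓘(ℝ, Euc 3) p (F y)) (hcd.comp x hFd) w
      have h7 : diffModel (E := ℝ) (E' := ℝ × ℝ) (fun y ↦ L (extChartAt 𝓘(ℝ, Euc 3) p (F y))) x =
          diffModel (E := ℝ) (E' := ℝ × ℝ) (fun y : ℝ × ℝ ↦ y.2) x := by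
        apply diffModel_congr
        filter_upwards [hUo.mem_nhds hx] with y hy using hLF y hy
      have h8 : diffModel (E := ℝ) (E' := ℝ × ℝ) (fun y : ℝ × ℝ ↦ y.2) x w = w.2 := by
        rw [diffModel_eq_fderiv]; simp [fderiv_snd]
      rw [diffModel_comp hcd hFd, hw, map_zero, map_zero, h7, h8] at h6
      exact Prod.ext h5 h6
    exact key w hw'
  · have h1 : u (s₀, L x₀) = Θ x₀ := by
      simp only [hu, hΘ, hψx₀, hp]
    refine ⟨⟨⟨hs₀, ?_⟩, trivial⟩, ?_⟩
    · rw [Set.mem_preimage, ← hp]; exact mem_chart_source (Euc 2) (pr p)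
    · rw [Set.mem_preimage, h1]; exact hT₀
  · have h1 : u (s₀, L x₀) = Θ x₀ := by
      simp only [hu, hΘ, hψx₀, hp]
    simp only [hF, h1, hΨ₀, hψx₀]

/-- Over a base curve of curvature √(c-1) one has k² = c - 1 on every patch. So kN is nonzero, and
on the orthogonal pair e₁, e₂ the second fundamental form is -N, where an umbilical one would
vanish. -/
theorem exists_polyharmonicHopf (b : IsBoothbyWang g η ξ gB pr)
    (S : IsSasakianSpaceForm g η ξ φ c) (hc : 1 < c) : HasProperPolyharmonicHopf g gB pr := by
  have hS := S.isSasaki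
  obtain ⟨p⟩ := S.connected.toNonempty
  obtain ⟨γ, J, hγ, hk⟩ := exists_curve_of_curvature gB (pr p) (Real.sqrt (c - 1))
  rw [Real.sq_sqrt (by linarith)] at hk
  obtain ⟨s, hs⟩ := hγ.nonempty
  obtain ⟨q, hq⟩ := b.surjective (γ s)
  have hz : (s, q) ∈ hopfCylinder pr γ J := ⟨hs, hq⟩
  refine ⟨γ, J, hγ, ?_, ?_, ?_⟩
  · intro z hz
    obtain ⟨U, σ, F, P, hx⟩ := exists_hopfPatch b hS hγ hz
    exact ⟨U, σ, F, P, hx, fun x hx ↦ P.bitension_of_curvSq b S hγ hc hk hx⟩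
  · intro h
    obtain ⟨U, σ, F, P, ⟨x, hx, -⟩, hU⟩ := h _ hz
    have A := P.adaptedFrame b hS hγ
    have h1 := A.tension_eq hS hx
    rw [hU x hx] at h1
    have h2 := congrArg (fun w ↦ g.inner (F x) w (frameN φ F (dualField η σ F (1, 0)) x)) h1
    simp only [map_zero, zero_apply, map_smul, smul_apply, A.NN hS hx, smul_eq_mul, mul_one] at h2
    have h3 := P.frameCurv_sq b hS hγ hx
    rw [hk _ (P.mem x hx).1, ← h2] at h3
    norm_num at h3
    linarith
  · intro h
    obtain ⟨U, σ, F, P, ⟨x, hx, -⟩, hU⟩ := h _ hz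
    have A := P.adaptedFrame b hS hγ
    have h1 := hU x hx (dualField η σ F (1, 0) x) (dualField η σ F (0, 1) x)
    have h2 := A.orthonormal hS hx 0 1
    have h3 : inducedMetric (E' := ℝ × ℝ) g.inner F x (dualField η σ F (1, 0) x)
      (dualField η σ F (0, 1) x) = 0 := h2
    rw [h3, zero_smul, A.secondFundamentalForm_e₁e₂ hS hx, neg_eq_zero] at h1
    have h4 := A.NN hS hx
    rw [h1, map_zero] at h4
    exact zero_ne_one h4

end Patch

/-! ### Smooth forms, endomorphism fields and metrics tested on coordinate frames. -/

section HomSections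

variable {E : Type*} [NormedAddCommGroup E] [NormedSpace ℝ E] [FiniteDimensional ℝ E]
  {M : Type*} [TopologicalSpace M] [ChartedSpace E M] [IsManifold 𝓘(ℝ, E) ∞ M]

/-- A one-form is smooth if its values on coordinate frames are. -/
lemma contMDiff_form_of_frame (θ : ∀ x : M, TangentSpace 𝓘(ℝ, E) x →L[ℝ] ℝ)
    (h : ∀ (q : M) (a : E), ContMDiffAt 𝓘(ℝ, E) 𝓘(ℝ, ℝ) ∞ (fun y ↦ θ y (frameField q a y)) q) :
    ContMDiff 𝓘(ℝ, E) (𝓘(ℝ, E).prod 𝓘(ℝ, E →L[ℝ] ℝ)) ∞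
    (fun x ↦ TotalSpace.mk' (E →L[ℝ] ℝ)
      (E := fun x : M ↦ TangentSpace 𝓘(ℝ, E) x →L[ℝ] Bundle.Trivial M ℝ x) x (θ x)) := by
  intro q
  rw [contMDiffAt_hom_bundle]
  refine ⟨contMDiffAt_id, contMDiffAt_clm_of_apply fun a ↦ (h q a).congr_of_eventuallyEq ?_⟩
  filter_upwards [chart_source_mem_nhds E q] with y hy
  exact Bundle.Trivialization.continuousLinearMapAt_apply_of_mem (R := ℝ)
    (trivializationAt ℝ (Bundle.Trivial M ℝ) q) (b := y) (Set.mem_univ _) _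

/-- An endomorphism field is smooth if its values on coordinate frames are. -/
lemma contMDiff_endo_of_frame
    (Φ : ∀ x : M, TangentSpace 𝓘(ℝ, E) x →L[ℝ] TangentSpace 𝓘(ℝ, E) x)
    (h : ∀ (q : M) (a : E), FieldSmoothAt E (fun y : M ↦ y) (fun y ↦ Φ y (frameField q a y)) q) :
    ContMDiff 𝓘(ℝ, E) (𝓘(ℝ, E).prod 𝓘(ℝ, E →L[ℝ] E)) ∞
    (fun x ↦ TotalSpace.mk' (E →L[ℝ] E)
      (E := fun x : M ↦ TangentSpace 𝓘(ℝ, E) x →L[ℝ] TangentSpace 𝓘(ℝ, E) x) x (Φ x)) := by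
  intro q
  rw [contMDiffAt_hom_bundle]
  refine ⟨contMDiffAt_id, contMDiffAt_clm_of_apply fun a ↦
    ((fieldSmoothAt_iff.1 (h q a)).2).congr_of_eventuallyEq ?_⟩
  filter_upwards [chart_source_mem_nhds E q] with y hy
  exact Bundle.Trivialization.continuousLinearMapAt_apply_of_mem (R := ℝ)
    (trivializationAt E (fun x : M ↦ TangentSpace 𝓘(ℝ, E) x) q) (b := y) (by simpa using hy) _

/-- A field of bilinear forms is smooth if its values on coordinate frames are. -/
lemma contMDiff_bilin_of_frame (β : BilinField E M)
    (h : ∀ (q : M) (a b : E), ContMDiffAt 𝓘(ℝ, E) 𝓘(ℝ, ℝ) ∞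
      (fun y ↦ β y (frameField q a y) (frameField q b y)) q) :
    ContMDiff 𝓘(ℝ, E) (𝓘(ℝ, E).prod 𝓘(ℝ, E →L[ℝ] E →L[ℝ] ℝ)) ∞
    (fun x ↦ TotalSpace.mk' (E →L[ℝ] E →L[ℝ] ℝ)
      (E := fun x : M ↦ TangentSpace 𝓘(ℝ, E) x →L[ℝ] TangentSpace 𝓘(ℝ, E) x →L[ℝ]
        Bundle.Trivial M ℝ x) x (β x)) := by
  intro q
  rw [contMDiffAt_hom_bundle]
  refine ⟨contMDiffAt_id, contMDiffAt_clm_of_apply fun a ↦ contMDiffAt_clm_of_apply fun b ↦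
    (h q a b).congr_of_eventuallyEq ?_⟩
  filter_upwards [chart_source_mem_nhds E q] with y hy
  have hb : y ∈ (trivializationAt E (fun x : M ↦ TangentSpace 𝓘(ℝ, E) x) q).baseSet := by
    simpa using hy
  refine (inCoordinates_apply_eq₂ (F₃ := ℝ) (E₃ := Bundle.Trivial M ℝ) (ϕ := β y) hb hb
    (Set.mem_univ _)).trans ?_
  refine (congrFun ((trivializationAt ℝ (Bundle.Trivial M ℝ) q).coe_linearMapAt_of_mem (R := ℝ)
    (b := y) (Set.mem_univ _)) _).trans ?_
  rw [frameField, frameField, frameAt_apply hy, frameAt_apply hy]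
  rfl

/-- The Riemannian metric induced by an injective smooth bundle map into an inner product space. -/
def pullMetric {G : Type*} [NormedAddCommGroup G] [InnerProductSpace ℝ G]
    (A : ∀ x : M, TangentSpace 𝓘(ℝ, E) x →L[ℝ] G) (hA : ∀ x, Function.Injective (A x))
    (h : ∀ (q : M) (a : E), ContMDiffAt 𝓘(ℝ, E) 𝓘(ℝ, G) ∞ (fun y ↦ A y (frameField q a y)) q) :
    RMetric E M where
  inner x := ((innerSL ℝ (E := G)).bilinearComp (A x : E →L[ℝ] G) (A x : E →L[ℝ] G) :
    E →L[ℝ] E →L[ℝ] ℝ)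
  symm x u v := real_inner_comm _ _
  pos x u hu := by
    have : A x u ≠ 0 := fun h0 ↦ hu (hA x (by rw [h0, map_zero]))
    exact real_inner_self_pos.2 this
  isVonNBounded x := by
    -- An injective linear map on a finite-dimensional space is antilipschitz, so unit balls of the
    -- pulled-back norm are bounded.
    have hE : ∀ L : E →L[ℝ] G, Function.Injective L →
        Bornology.IsVonNBounded ℝ {v : E | inner ℝ (L v) (L v) < 1} := by
      intro L hL
      obtain ⟨K, -, hK⟩ := LinearMap.exists_antilipschitzWith (L : E →ₗ[ℝ] G)
        (LinearMap.ker_eq_bot.2 hL)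
      rw [NormedSpace.isVonNBounded_iff]
      refine (Metric.isBounded_closedBall (x := (0 : E)) (r := K * 1)).subset fun v hv ↦ ?_
      have h1 : ‖v‖ ≤ K * ‖L v‖ := by
        have := hK.le_mul_dist v 0
        simpa using this
      have h2 : ‖L v‖ ≤ 1 := by
        have : inner ℝ (L v) (L v) < 1 := hv
        rw [real_inner_self_eq_norm_sq] at this
        nlinarith [norm_nonneg (L v)]
      rw [mem_closedBall_zero_iff]
      exact h1.trans (mul_le_mul_of_nonneg_left h2 K.coe_nonneg)
    exact hE (A x) (hA x)
  contMDiff := contMDiff_bilin_of_frame _ fun q a b ↦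
    ((contDiff_inner (𝕜 := ℝ) (E := G)).contMDiff.contMDiffAt.comp q
      ((h q a).prodMk_space (h q b)))

end HomSections

/-! ### Completeness of compact Riemannian manifolds. -/

section Complete

variable {E : Type*} [NormedAddCommGroup E] [NormedSpace ℝ E] [FiniteDimensional ℝ E]
  {M : Type*} [TopologicalSpace M] [ChartedSpace E M] [IsManifold 𝓘(ℝ, E) ∞ M]

/-- Compactness yields a convergent subsequence, and a Cauchy sequence follows its subsequence.
Small balls of the Riemannian distance form a neighbourhood basis of the limit, which links the
distance to the given topology. -/
lemma isCompleteMetric_of_compact [CompactSpace M] [T2Space M] [SecondCountableTopology M]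
    (g : RMetric E M) : IsCompleteMetric g := by
  let _ : RiemannianBundle (fun x : M ↦ TangentSpace 𝓘(ℝ, E) x) := ⟨g.toRiemannianMetric⟩
  intro u hu
  obtain ⟨x, -, ψ, hψ, hx⟩ := isCompact_univ.tendsto_subseq (x := u) (fun n ↦ Set.mem_univ _)
  refine ⟨x, ?_⟩
  have : IsContMDiffRiemannianBundle 𝓘(ℝ, E) ∞ E (fun x : M ↦ TangentSpace 𝓘(ℝ, E) x) :=
    inferInstance
  have : IsContinuousRiemannianBundle E (fun x : M ↦ TangentSpace 𝓘(ℝ, E) x) :=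
    ⟨g.inner, g.contMDiff.continuous, fun _ _ _ ↦ rfl⟩
  have : IsManifold 𝓘(ℝ, E) 1 M := IsManifold.of_le (n := ∞) (by simp)
  refine Filter.tendsto_def.2 fun s hs ↦ ?_
  obtain ⟨c, hc, hcs⟩ := setOfPred_riemannianEDist_lt_subset_nhds 𝓘(ℝ, E) hs
  replace hc : 0 < (c : ENNReal) := by exact_mod_cast hc
  obtain ⟨n₀, hn₀⟩ := hu (c / 2) (ENNReal.half_pos hc.ne')
  have h1 := hx.eventually (eventually_riemannianEDist_lt 𝓘(ℝ, E) x (ENNReal.half_pos hc.ne'))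
  obtain ⟨k, hk, hk'⟩ := (h1.and (Filter.eventually_ge_atTop n₀)).exists
  filter_upwards [Filter.eventually_ge_atTop n₀] with n hn
  apply hcs
  calc riemannianEDist 𝓘(ℝ, E) x (u n)
      ≤ riemannianEDist 𝓘(ℝ, E) x (u (ψ k)) + riemannianEDist 𝓘(ℝ, E) (u (ψ k)) (u n) :=
        riemannianEDist_triangle
    _ < c / 2 + c / 2 := ENNReal.add_lt_add hk (hn₀ _ (hk'.trans (hψ.id_le k)) _ hn)
    _ = c := ENNReal.add_halves c

end Complete

/-! ### Independence of the curvature from the choice of extensions. -/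

section Tensor

variable {E : Type*} [NormedAddCommGroup E] [NormedSpace ℝ E] [FiniteDimensional ℝ E]
  {M : Type*} [TopologicalSpace M] [ChartedSpace E M] [IsManifold 𝓘(ℝ, E) ∞ M]

/-- The curvature tensor may be computed with arbitrary smooth extensions. -/
lemma curvature_eq_curvatureField (g : RMetric E M) {X Y Z : ∀ y : M, TangentSpace 𝓘(ℝ, E) y} {p : M}
    (hX : FieldSmoothAt E (fun y : M ↦ y) X p) (hY : FieldSmoothAt E (fun y : M ↦ y) Y p)
    (hZ : FieldSmoothAt E (fun y : M ↦ y) Z p) :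
    curvature g.inner p (X p) (Y p) (Z p) = curvatureField g.inner X Y Z p := by
  have hs : ∀ w : TangentSpace 𝓘(ℝ, E) p, FieldSmoothAt E (fun y : M ↦ y) (coordField w) p :=
    fun w ↦ fieldSmoothAt_coordField (mem_chart_source _ p) w
  -- Writing the bracket as ∇_X Y - ∇_Y X exhibits the curvature as an antisymmetrised Hessian of Z,
  -- which by `hessian_eq` sees only the values of X and Y at p.
  have key : ∀ X Y : ∀ y : M, TangentSpace 𝓘(ℝ, E) y, FieldSmoothAt E (fun y : M ↦ y) X p →
      FieldSmoothAt E (fun y : M ↦ y) Y p →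
      curvatureField g.inner X Y Z p =
        (cov g.inner (fun y ↦ cov g.inner Z y (Y y)) p (X p) -
          cov g.inner Z p (cov g.inner Y p (X p))) -
        (cov g.inner (fun y ↦ cov g.inner Z y (X y)) p (Y p) -
          cov g.inner Z p (cov g.inner X p (Y p))) := by
    intro X Y hX hY
    rw [curvatureField, ← cov_torsion (g.nondegAt p) hX.diffAt hY.diffAt]
    have h1 : ∀ a b : TangentSpace 𝓘(ℝ, E) p, cov g.inner Z p (a - b) =
        cov g.inner Z p a - cov g.inner Z p b := fun a b ↦ (covL g.inner (fun y : M ↦ y) Z p).map_sub a b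
    rw [h1]
    abel
  rw [key X Y hX hY]
  have h2 := hessian_eq g.inner g hZ hY.diffAt (X p)
  have h3 := hessian_eq g.inner g hZ hX.diffAt (Y p)
  have h4 : curvatureField g.inner (coordField (X p)) (coordField (Y p)) Z p =
      curvature g.inner p (X p) (Y p) (Z p) := by
    refine curvatureField_congr_right g (hs _) (hs _) hZ (hs _) ?_
    exact (coordField_self _).symm
  rw [← h4, key _ _ (hs _) (hs _), coordField_self, coordField_self]
  exact congrArg₂ (· - ·) h2 h3

end Tensor

/-! ### Frames with the bracket relations of SU(2): connection and curvature coefficients. -/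

section Berger

variable {M : Type*} [TopologicalSpace M] [ChartedSpace (Euc 3) M] [IsManifold 𝓘(ℝ, Euc 3) ∞ M]

/-- The Levi-Civita symbol. -/
def eps (i j k : Fin 3) : ℝ := ((j : ℕ) - (i : ℕ) : ℝ) * ((k : ℕ) - (i : ℕ)) * ((k : ℕ) - (j : ℕ)) / 2

/-- The squared lengths of the frame fields of a Berger metric. -/
def bergerLen (α : ℝ) (i : Fin 3) : ℝ := ![α⁻¹ ^ 2, α⁻¹, α⁻¹] i

/-- The connection coefficients of a Berger frame. -/
def bergerConn (α : ℝ) (i j k : Fin 3) : ℝ :=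
  eps i j k * (bergerLen α k + bergerLen α j - bergerLen α i) / bergerLen α k

/-- A global frame with dual coframe that satisfies the bracket relations of `SU(2)`, orthogonal
for the Berger metric `g` of parameter `α`. -/
structure IsBergerFrame (g : RMetric (Euc 3) M) (α : ℝ)
    (V : Fin 3 → ∀ x : M, TangentSpace 𝓘(ℝ, Euc 3) x)
    (θ : Fin 3 → ∀ x : M, TangentSpace 𝓘(ℝ, Euc 3) x →L[ℝ] ℝ) : Prop where
  pos : 0 < α
  smooth : ∀ i x, FieldSmoothAt (Euc 3) (fun y : M ↦ y) (V i) x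
  dual : ∀ i j x, θ i x (V j x) = if i = j then 1 else 0
  expand : ∀ x u, u = ∑ i, θ i x u • V i x
  metric : ∀ x u v, g.inner x u v = ∑ i, bergerLen α i * (θ i x u * θ i x v)
  bracket : ∀ i j x,
    VectorField.mlieBracket 𝓘(ℝ, Euc 3) (V i) (V j) x = ∑ k, (2 * eps i j k) • V k x

/-- The endomorphism field that rotates the last two fields of a frame. -/
def bergerPhi (V : Fin 3 → ∀ x : M, TangentSpace 𝓘(ℝ, Euc 3) x)
    (θ : Fin 3 → ∀ x : M, TangentSpace 𝓘(ℝ, Euc 3) x →L[ℝ] ℝ) (x : M) :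
    TangentSpace 𝓘(ℝ, Euc 3) x →L[ℝ] TangentSpace 𝓘(ℝ, Euc 3) x :=
  (θ 1 x).smulRight (V 2 x) - (θ 2 x).smulRight (V 1 x)

variable {g : RMetric (Euc 3) M} {α : ℝ} {V : Fin 3 → ∀ x : M, TangentSpace 𝓘(ℝ, Euc 3) x}
  {θ : Fin 3 → ∀ x : M, TangentSpace 𝓘(ℝ, Euc 3) x →L[ℝ] ℝ}

namespace IsBergerFrame

lemma len_pos (F : IsBergerFrame g α V θ) (i : Fin 3) : 0 < bergerLen α i := by
  have := F.pos
  fin_cases i <;> simp [bergerLen] <;> positivity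

lemma ext (F : IsBergerFrame g α V θ) {x : M} {u v : TangentSpace 𝓘(ℝ, Euc 3) x}
    (h : ∀ i, θ i x u = θ i x v) : u = v := by
  rw [F.expand x u, F.expand x v]
  exact Finset.sum_congr rfl fun i _ ↦ by rw [h]

lemma inner_frame (F : IsBergerFrame g α V θ) (x : M) (u : TangentSpace 𝓘(ℝ, Euc 3) x) (k : Fin 3) :
    g.inner x u (V k x) = bergerLen α k * θ k x u := by
  rw [F.metric]
  simp [F.dual]

lemma theta_eq (F : IsBergerFrame g α V θ) (x : M) (u : TangentSpace 𝓘(ℝ, Euc 3) x) (k : Fin 3) :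
    θ k x u = g.inner x u (V k x) / bergerLen α k := by
  rw [F.inner_frame, mul_div_cancel_left₀ _ (F.len_pos k).ne']

lemma theta_sum (F : IsBergerFrame g α V θ) (x : M) (c : Fin 3 → ℝ) (k : Fin 3) :
    θ k x (∑ i, c i • V i x) = c k := by
  simp [map_sum, F.dual]

/-- The frame fields have constant inner products, so only the bracket terms of the Koszul formula
survive. -/
lemma theta_cov_frame (F : IsBergerFrame g α V θ) (p : M) (i j k : Fin 3) :
    θ k p (cov g.inner (V j) p (V i p)) = bergerConn α i j k := by
  have hc : ∀ i j : Fin 3,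
      diffModel (E := ℝ) (E' := Euc 3) (fun y ↦ g.inner y (V i y) (V j y)) p = 0 := by
    intro i j
    refine (diffModel_congr (M := ℝ) (f' := fun _ ↦ bergerLen α j * if j = i then 1 else 0)
      (Filter.Eventually.of_forall fun y ↦ ?_)).trans (diffModel_const _ _)
    rw [F.inner_frame, F.dual]
  have h := koszul (g.nondegAt p) (F.smooth i p).diffAt (F.smooth j p).diffAt (F.smooth k p).diffAt
  rw [hc, hc, hc, F.bracket, F.bracket, F.bracket, F.inner_frame, F.inner_frame, F.inner_frame,
    F.inner_frame, F.theta_sum, F.theta_sum, F.theta_sum] at h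
  have h' : 2 * (bergerLen α k * θ k p (cov g.inner (V j) p (V i p))) =
      bergerLen α k * (2 * eps i j k) - bergerLen α j * (2 * eps i k j) -
        bergerLen α i * (2 * eps j k i) := by
    refine h.trans ?_
    change (0 : ℝ) + 0 - 0 + _ - _ - _ = _
    ring
  have h1 : eps i k j = -eps i j k := by unfold eps; ring
  have h2 : eps j k i = eps i j k := by unfold eps; ring
  rw [h1, h2] at h'
  rw [bergerConn, eq_div_iff (F.len_pos k).ne']
  linarith

lemma cov_frame (F : IsBergerFrame g α V θ) (p : M) (i j : Fin 3) :
    cov g.inner (V j) p (V i p) = ∑ k, bergerConn α i j k • V k p :=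
  F.ext fun k ↦ by rw [F.theta_cov_frame, F.theta_sum]

lemma theta_cov (F : IsBergerFrame g α V θ) (p : M) (j k : Fin 3) (u : TangentSpace 𝓘(ℝ, Euc 3) p) :
    θ k p (cov g.inner (V j) p u) = ∑ i, θ i p u * bergerConn α i j k := by
  have h : cov g.inner (V j) p u = ∑ i, θ i p u • cov g.inner (V j) p (V i p) := by
    conv_lhs => rw [F.expand p u]
    exact map_sum_smul _ _
  rw [h, map_sum]
  exact Finset.sum_congr rfl fun i _ ↦ by rw [map_smul, F.theta_cov_frame, smul_eq_mul]
where
  map_sum_smul {p : M} {j : Fin 3} (c : Fin 3 → ℝ) (w : Fin 3 → TangentSpace 𝓘(ℝ, Euc 3) p) :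
      cov g.inner (V j) p (∑ i, c i • w i) = ∑ i, c i • cov g.inner (V j) p (w i) := by
    have h := map_sum (covL g.inner (fun y : M ↦ y) (V j) p) (fun i ↦ c i • w i) Finset.univ
    refine h.trans (Finset.sum_congr rfl fun i _ ↦ ?_)
    exact map_smul (covL g.inner (fun y : M ↦ y) (V j) p) (c i) (w i)

lemma smooth_sum (F : IsBergerFrame g α V θ) (p : M) (c : Fin 3 → ℝ) :
    FieldSmoothAt (Euc 3) (fun y : M ↦ y) (fun y ↦ ∑ i, c i • V i y) p :=
  FieldSmoothAt.sum _ contMDiffAt_id fun i _ ↦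
    FieldSmoothAt.smul (k := fun _ ↦ c i) contMDiffAt_const (F.smooth i p)

lemma theta_cov_sum (F : IsBergerFrame g α V θ) (p : M) (c : Fin 3 → ℝ) (k : Fin 3)
    (u : TangentSpace 𝓘(ℝ, Euc 3) p) :
    θ k p (cov g.inner (fun y ↦ ∑ j, c j • V j y) p u) =
      ∑ j, c j * ∑ i, θ i p u * bergerConn α i j k := by
  have h : cov g.inner (fun y ↦ ∑ j, c j • V j y) p u = ∑ j, c j • cov g.inner (V j) p u := by
    have h1 := covAlong_sum g.inner (f := fun y : M ↦ y) (x := p) Finset.univ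
      (U := fun j y ↦ c j • V j y) mdifferentiableAt_id
      (fun j _ ↦ (FieldSmoothAt.smul (k := fun _ ↦ c j) contMDiffAt_const (F.smooth j p)).diffAt) u
    refine h1.trans (Finset.sum_congr rfl fun j _ ↦ ?_)
    exact covAlong_const_smul g.inner (c j) (F.smooth j p).diffAt u
  rw [h, map_sum]
  exact Finset.sum_congr rfl fun j _ ↦ by rw [map_smul, F.theta_cov, smul_eq_mul]

/-- The connection coefficients are constant, so the curvature is quadratic in them up to the
bracket term with structure constants 2ε. -/
lemma theta_curvature (F : IsBergerFrame g α V θ) (p : M) (i j k m : Fin 3) :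
    θ m p (curvature g.inner p (V i p) (V j p) (V k p)) =
      ∑ l, (bergerConn α j k l * bergerConn α i l m - bergerConn α i k l * bergerConn α j l m -
        2 * eps i j l * bergerConn α l k m) := by
  have h1 : ∀ i j : Fin 3, (fun y ↦ cov g.inner (V k) y (V j y)) =
      fun y ↦ ∑ l, bergerConn α j k l • V l y := fun i j ↦ funext fun y ↦ F.cov_frame y j k
  rw [curvature_eq_curvatureField g (F.smooth i p) (F.smooth j p) (F.smooth k p), curvatureField,
    h1 i j, h1 j i, map_sub, map_sub, F.theta_cov_sum, F.theta_cov_sum, F.bracket, F.theta_cov]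
  simp only [F.theta_sum, F.dual]
  simp [Fin.sum_univ_three]

end IsBergerFrame

/-- The exterior derivative of the one-form dual to a vector field. -/
lemma extDerivOne_inner (g : RMetric (Euc 3) M) {ξ : ∀ x : M, TangentSpace 𝓘(ℝ, Euc 3) x} {p : M}
    (hξ : FieldSmoothAt (Euc 3) (fun y : M ↦ y) ξ p) (u v : TangentSpace 𝓘(ℝ, Euc 3) p) :
    extDerivOne (fun y ↦ g.inner y (ξ y)) p u v =
      g.inner p (cov g.inner ξ p u) v - g.inner p (cov g.inner ξ p v) u := by
  have hs : ∀ w : TangentSpace 𝓘(ℝ, Euc 3) p,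
      FieldSmoothAt (Euc 3) (fun y : M ↦ y) (coordField w) p :=
    fun w ↦ fieldSmoothAt_coordField (mem_chart_source _ p) w
  have h1 : ∀ w z : TangentSpace 𝓘(ℝ, Euc 3) p,
      diffModel (E := ℝ) (E' := Euc 3) (fun y ↦ g.inner y (ξ y) (coordField w y)) p z =
        g.inner p (cov g.inner ξ p z) w + g.inner p (ξ p) (cov g.inner (coordField w) p z) := by
    intro w z
    have := diff_inner (f := fun y : M ↦ y) (g.nondegAt p) hξ.diffAt (hs w).diffAt z
    rw [coordField_self] at this
    exact this
  have h2 := cov_torsion (g.nondegAt p) (hs u).diffAt (hs v).diffAt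
  rw [coordField_self, coordField_self] at h2
  have h3 : extDerivOne (fun y ↦ g.inner y (ξ y)) p u v =
      diffModel (E := ℝ) (E' := Euc 3) (fun y ↦ g.inner y (ξ y) (coordField v y)) p u -
      diffModel (E := ℝ) (E' := Euc 3) (fun y ↦ g.inner y (ξ y) (coordField u y)) p v -
      g.inner p (ξ p) (VectorField.mlieBracket 𝓘(ℝ, Euc 3) (coordField u) (coordField v) p) := rfl
  rw [h3, h1, h1, ← h2, map_sub]
  ring

end Berger

/-! ### The Sasaki structure of a Berger metric and its φ-sectional curvature. -/

section Berger

variable {M : Type*} [TopologicalSpace M] [ChartedSpace (Euc 3) M] [IsManifold 𝓘(ℝ, Euc 3) ∞ M]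
  {g : RMetric (Euc 3) M} {α : ℝ} {V : Fin 3 → ∀ x : M, TangentSpace 𝓘(ℝ, Euc 3) x}
  {θ : Fin 3 → ∀ x : M, TangentSpace 𝓘(ℝ, Euc 3) x →L[ℝ] ℝ}

namespace IsBergerFrame

lemma bergerPhi_apply (x : M) (u : TangentSpace 𝓘(ℝ, Euc 3) x) :
    bergerPhi V θ x u = θ 1 x u • V 2 x - θ 2 x u • V 1 x := rfl

lemma theta_phi (F : IsBergerFrame g α V θ) (x : M) (u : TangentSpace 𝓘(ℝ, Euc 3) x) :
    θ 0 x (bergerPhi V θ x u) = 0 ∧ θ 1 x (bergerPhi V θ x u) = -θ 2 x u ∧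
      θ 2 x (bergerPhi V θ x u) = θ 1 x u := by
  simp [bergerPhi_apply, F.dual]

/-- V₀ has squared length α⁻², hence αV₀ is a unit field with dual form α⁻¹θ₀. -/
lemma eta_eq (F : IsBergerFrame g α V θ) (x : M) (u : TangentSpace 𝓘(ℝ, Euc 3) x) :
    g.inner x (α • V 0 x) u = α⁻¹ * θ 0 x u := by
  have := F.pos.ne'
  rw [F.metric]
  simp only [Fin.sum_univ_three, map_smul, F.dual, bergerLen]
  simp
  field_simp

lemma theta_xi (F : IsBergerFrame g α V θ) (x : M) :
    θ 0 x (α • V 0 x) = α ∧ θ 1 x (α • V 0 x) = 0 ∧ θ 2 x (α • V 0 x) = 0 := by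
  simp [F.dual]

lemma smooth_xi (F : IsBergerFrame g α V θ) (x : M) :
    FieldSmoothAt (Euc 3) (fun y : M ↦ y) (fun y ↦ α • V 0 y) x :=
  FieldSmoothAt.smul (k := fun _ ↦ α) contMDiffAt_const (F.smooth 0 x)

lemma ext_three (F : IsBergerFrame g α V θ) {x : M} {u v : TangentSpace 𝓘(ℝ, Euc 3) x}
    (h₀ : θ 0 x u = θ 0 x v) (h₁ : θ 1 x u = θ 1 x v) (h₂ : θ 2 x u = θ 2 x v) : u = v :=
  F.ext fun i ↦ by fin_cases i <;> assumption

/-- Off the fibre direction the coefficients of ∇V₀ are ±|V₀|²/|V_k|² = ±α⁻¹. The factor α in ξ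
normalises them to those of -φ; the ratio of lengths in a Berger metric is made for this. -/
lemma cov_xi (F : IsBergerFrame g α V θ) (x : M) (u : TangentSpace 𝓘(ℝ, Euc 3) x) :
    cov g.inner (fun y ↦ α • V 0 y) x u = -bergerPhi V θ x u := by
  have hα := F.pos.ne'
  have h : cov g.inner (fun y ↦ α • V 0 y) x u = α • cov g.inner (V 0) x u :=
    covAlong_const_smul g.inner α (F.smooth 0 x).diffAt u
  obtain ⟨p0, p1, p2⟩ := F.theta_phi x u
  refine F.ext_three ?_ ?_ ?_
  · rw [h, map_smul, map_neg, F.theta_cov, p0]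
    simp [bergerConn, eps]
  · rw [h, map_smul, map_neg, F.theta_cov, p1]
    simp [Fin.sum_univ_three, bergerConn, eps, bergerLen]
    field_simp
    try ring
  · rw [h, map_smul, map_neg, F.theta_cov, p2]
    simp [Fin.sum_univ_three, bergerConn, eps, bergerLen]
    field_simp
    try ring

lemma contMDiffAt_theta (F : IsBergerFrame g α V θ) {x : M} {W : ∀ x : M, TangentSpace 𝓘(ℝ, Euc 3) x}
    (hW : FieldSmoothAt (Euc 3) (fun y : M ↦ y) W x) (k : Fin 3) :
    ContMDiffAt 𝓘(ℝ, Euc 3) 𝓘(ℝ, ℝ) ∞ (fun y ↦ θ k y (W y)) x := by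
  simp only [F.theta_eq, div_eq_mul_inv]
  exact (g.contMDiffAt_inner hW (F.smooth k x)).mul contMDiffAt_const

lemma smooth_phi (F : IsBergerFrame g α V θ) :
    ContMDiff 𝓘(ℝ, Euc 3) (𝓘(ℝ, Euc 3).prod 𝓘(ℝ, Euc 3 →L[ℝ] Euc 3)) ∞
    (fun x ↦ TotalSpace.mk' (Euc 3 →L[ℝ] Euc 3)
      (E := fun x : M ↦ TangentSpace 𝓘(ℝ, Euc 3) x →L[ℝ] TangentSpace 𝓘(ℝ, Euc 3) x) x
      (bergerPhi V θ x)) := by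
  refine contMDiff_endo_of_frame _ fun q a ↦ ?_
  have ha := fieldSmoothAt_frameField q (mem_chart_source (Euc 3) q) a
  exact ((F.smooth 2 q).smul (F.contMDiffAt_theta ha 1)).sub
    ((F.smooth 1 q).smul (F.contMDiffAt_theta ha 2))

/-- The derivative of an endomorphism field is tensorial, so v may be extended with constant frame
coefficients. φ preserves such fields, and both sides become expressions in the connection
coefficients. -/
lemma covEndo_phi (F : IsBergerFrame g α V θ) (x : M) (u v : TangentSpace 𝓘(ℝ, Euc 3) x) :
    covEndo g.inner (bergerPhi V θ) x u v =
      g.inner x u v • (α • V 0 x) - (α⁻¹ * θ 0 x v) • u := by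
  have hα := F.pos.ne'
  set c : Fin 3 → ℝ := fun i ↦ θ i x v with hc
  have h := covAlong_endo g (bergerPhi V θ) F.smooth_phi (F := fun y : M ↦ y)
    (F.smooth_sum x c).diffAt u
  have h1 : diff (E := Euc 3) (E' := Euc 3) (fun y : M ↦ y) x u = u := diffModel_id (E := Euc 3) x u
  have h2 : ∑ i, c i • V i x = v := (F.expand x v).symm
  rw [h1, h2] at h
  have h3 : (fun y : M ↦ bergerPhi V θ y (∑ i, c i • V i y)) =
      fun y ↦ ∑ i, (![0, -c 2, c 1] : Fin 3 → ℝ) i • V i y := by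
    funext y
    rw [bergerPhi_apply, F.theta_sum, F.theta_sum, Fin.sum_univ_three]
    simp
    abel
  have h4 : covEndo g.inner (bergerPhi V θ) x u v =
      cov g.inner (fun y ↦ ∑ i, (![0, -c 2, c 1] : Fin 3 → ℝ) i • V i y) x u -
        bergerPhi V θ x (cov g.inner (fun y ↦ ∑ i, c i • V i y) x u) := by
    have key : ∀ a b d : TangentSpace 𝓘(ℝ, Euc 3) x, a = b + d → d = a - b := by
      intro a b d h; rw [h]; abel
    refine key _ _ _ ?_
    rw [← h3]
    exact h
  obtain ⟨p0, p1, p2⟩ := F.theta_phi x (cov g.inner (fun y ↦ ∑ i, c i • V i y) x u)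
  rw [h4, F.metric]
  refine F.ext_three ?_ ?_ ?_
  · simp only [map_sub, p0, F.theta_cov_sum, map_smul (θ 0 x), smul_eq_mul]
    simp [Fin.sum_univ_three, bergerConn, eps, bergerLen, hc, F.dual]
    field_simp
    try ring
  · simp only [map_sub, p1, F.theta_cov_sum, map_smul (θ 1 x), smul_eq_mul]
    simp [Fin.sum_univ_three, bergerConn, eps, bergerLen, hc, F.dual]
    field_simp
    try ring
  · simp only [map_sub, p2, F.theta_cov_sum, map_smul (θ 2 x), smul_eq_mul]
    simp [Fin.sum_univ_three, bergerConn, eps, bergerLen, hc, F.dual]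
    field_simp
    try ring

lemma extDerivOne_eta (F : IsBergerFrame g α V θ) (x : M) (u v : TangentSpace 𝓘(ℝ, Euc 3) x) :
    extDerivOne (fun y ↦ g.inner y (α • V 0 y)) x u v = 2 * g.inner x u (bergerPhi V θ x v) := by
  obtain ⟨p0, p1, p2⟩ := F.theta_phi x u
  obtain ⟨q0, q1, q2⟩ := F.theta_phi x v
  rw [extDerivOne_inner g (F.smooth_xi x), F.cov_xi, F.cov_xi, F.metric, F.metric, F.metric]
  simp only [Fin.sum_univ_three, map_neg, p0, p1, p2, q0, q1, q2, bergerLen]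
  simp
  ring

/-- The Sasaki structure of a Berger metric. -/
theorem isSasaki (F : IsBergerFrame g α V θ) :
    IsSasaki g (fun y ↦ g.inner y (α • V 0 y)) (fun y ↦ α • V 0 y) (bergerPhi V θ) where
  smooth_eta := contMDiff_form_of_frame _ fun q a ↦ g.contMDiffAt_inner (F.smooth_xi q)
    (fieldSmoothAt_frameField q (mem_chart_source (Euc 3) q) a)
  smooth_xi := fun x ↦ F.smooth_xi x
  smooth_phi := F.smooth_phi
  contact x := by
    refine ⟨V 1 x, V 2 x, V 0 x, ?_⟩
    have hα := F.pos
    have h : ∀ i j, extDerivOne (fun y ↦ g.inner y (α • V 0 y)) x (V i x) (V j x) =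
        2 * (bergerLen α i * θ i x (bergerPhi V θ x (V j x))) := by
      intro i j
      rw [F.extDerivOne_eta, g.symm, F.inner_frame]
    have hη : ∀ i, g.inner x (α • V 0 x) (V i x) = α⁻¹ * θ 0 x (V i x) := fun i ↦ F.eta_eq x _
    rw [h, h, h, hη, hη, hη, F.dual, F.dual, F.dual, (F.theta_phi x _).2.1, F.dual]
    simp [bergerLen, hα.ne']
  eta_xi x := by
    have hα := F.pos.ne'
    rw [F.eta_eq, (F.theta_xi x).1, inv_mul_cancel₀ hα]
  deta_xi x u := by
    rw [F.extDerivOne_eta, F.eta_eq, (F.theta_phi x u).1]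
    simp
  phi_sq x u := by
    have hα := F.pos.ne'
    obtain ⟨p0, p1, p2⟩ := F.theta_phi x u
    obtain ⟨q0, q1, q2⟩ := F.theta_phi x (bergerPhi V θ x u)
    obtain ⟨x0, x1, x2⟩ := F.theta_xi x
    rw [F.eta_eq]
    refine F.ext_three ?_ ?_ ?_
    · rw [q0, map_add, map_neg, map_smul (θ 0 x), x0, smul_eq_mul]
      field_simp
      ring
    · rw [q1, p2, map_add, map_neg, map_smul (θ 1 x), x1, smul_eq_mul]
      ring
    · rw [q2, p1, map_add, map_neg, map_smul (θ 2 x), x2, smul_eq_mul]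
      ring
  compatible x u v := by
    have hα := F.pos.ne'
    obtain ⟨p0, p1, p2⟩ := F.theta_phi x u
    obtain ⟨q0, q1, q2⟩ := F.theta_phi x v
    rw [F.eta_eq, F.eta_eq, F.metric, F.metric]
    simp only [Fin.sum_univ_three, p0, p1, p2, q0, q1, q2, bergerLen]
    simp
    ring
  metric_xi x u := rfl
  associated x u v := F.extDerivOne_eta x u v
  sasaki x u v := by
    rw [F.eta_eq]
    exact F.covEndo_phi x u v

lemma curvature_frame (F : IsBergerFrame g α V θ) (p : M) :
    curvature g.inner p (V 1 p) (V 2 p) (V 1 p) = (-(4 - 3 / α)) • V 2 p ∧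
    curvature g.inner p (V 1 p) (V 2 p) (V 2 p) = (4 - 3 / α) • V 1 p := by
  have hα := F.pos.ne'
  constructor <;> refine F.ext fun m ↦ ?_ <;> rw [F.theta_curvature, map_smul, F.dual] <;>
    fin_cases m <;> simp [Fin.sum_univ_three, bergerConn, eps, bergerLen] <;> field_simp <;> ring

end IsBergerFrame

lemma curvature_smul_add (g : RMetric (Euc 3) M) (p : M) (a b : ℝ)
    (u u' v w : TangentSpace 𝓘(ℝ, Euc 3) p) :
    curvature g.inner p (a • u + b • u') v w =
        a • curvature g.inner p u v w + b • curvature g.inner p u' v w ∧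
    curvature g.inner p v (a • u + b • u') w =
        a • curvature g.inner p v u w + b • curvature g.inner p v u' w ∧
    curvature g.inner p v w (a • u + b • u') =
        a • curvature g.inner p v w u + b • curvature g.inner p v w u' := by
  have key : ∀ T : TangentSpace 𝓘(ℝ, Euc 3) p → TangentSpace 𝓘(ℝ, Euc 3) p,
      (∀ (c : ℝ) (z z' : TangentSpace 𝓘(ℝ, Euc 3) p), T (z + c • z') = T z + c • T z') →
      T (a • u + b • u') = a • T u + b • T u' := by
    intro T hT
    have h0 : T 0 = 0 := by
      have := hT 1 0 0
      simpa using this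
    have h1 := hT a 0 u
    rw [zero_add, h0, zero_add] at h1
    rw [hT, h1]
  exact ⟨key (fun z ↦ curvature g.inner p z v w) fun c z z' ↦ (curvature_add_smul g p c z z' v v w w).1,
    key (fun z ↦ curvature g.inner p v z w) fun c z z' ↦ (curvature_add_smul g p c v v z z' w w).2.1,
    key (fun z ↦ curvature g.inner p v w z) fun c z z' ↦ (curvature_add_smul g p c v v w w z z').2.2⟩

lemma curvature_swap (g : RMetric (Euc 3) M) (p : M) (u v w : TangentSpace 𝓘(ℝ, Euc 3) p) :
    curvature g.inner p u v w = -curvature g.inner p v u w := by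
  rw [curvature_eq, curvature_eq, neg_sub]

/-- A singular real `2 × 2` matrix has no invariant plane on which it is a quarter turn. -/
lemma eq_zero_of_singular_rotation {a b c d p q r s : ℝ} (hdet : a * d = b * c)
    (h₁ : a * p + b * q = -r) (h₂ : c * p + d * q = -s) (h₃ : a * r + b * s = p)
    (h₄ : c * r + d * s = q) : p = 0 ∧ q = 0 ∧ r = 0 ∧ s = 0 := by
  -- By Cayley-Hamilton a singular matrix A with trace t satisfies A² = tA. With A(p,q) = -(r,s) and
  -- A(r,s) = (p,q) this reads (p,q) = t(r,s) and (r,s) = -t(p,q), so 1 + t² annihilates everything.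
  have e1 : p = (a + d) * r := by linear_combination -h₃ + p * hdet + b * h₂ - d * h₁
  have e2 : q = (a + d) * s := by linear_combination -h₄ + q * hdet + c * h₁ - a * h₂
  have e3 : r = -(a + d) * p := by linear_combination h₁ - a * e1 - b * e2 - (a + d) * h₃
  have e4 : s = -(a + d) * q := by linear_combination h₂ - c * e1 - d * e2 - (a + d) * h₄
  have ht : 1 + (a + d) ^ 2 ≠ 0 := by positivity
  have hr : r = 0 := by
    have : (1 + (a + d) ^ 2) * r = 0 := by linear_combination e3 - (a + d) * e1
    exact (mul_eq_zero.1 this).resolve_left ht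
  have hs : s = 0 := by
    have : (1 + (a + d) ^ 2) * s = 0 := by linear_combination e4 - (a + d) * e2
    exact (mul_eq_zero.1 this).resolve_left ht
  refine ⟨?_, ?_, hr, hs⟩
  · rw [e1, hr, mul_zero]
  · rw [e2, hs, mul_zero]

/-- A φ-invariant plane is horizontal: otherwise φ, whose image is horizontal, has a singular matrix
on the plane, and since the components 1 and 2 are rotated by a quarter turn,
`eq_zero_of_singular_rotation` makes the plane vertical, hence too small. On a horizontal plane the
squared determinant of components cancels from numerator and denominator, leaving (4 - 3/α)α⁻¹/α⁻² =
4α - 3. -/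
lemma IsBergerFrame.sectionalCurvature_eq (F : IsBergerFrame g α V θ) (x : M)
    (u v : TangentSpace 𝓘(ℝ, Euc 3) x) (hi : LinearIndependent ℝ ![u, v])
    (hφ : ∀ w ∈ Submodule.span ℝ {u, v}, bergerPhi V θ x w ∈ Submodule.span ℝ {u, v}) :
    sectionalCurvature g.inner x u v = 4 * α - 3 := by
  have hα := F.pos.ne'
  have hpair := LinearIndependent.pair_iff.1 hi
  obtain ⟨a, b, hab⟩ := Submodule.mem_span_pair.1 (hφ u (Submodule.subset_span (by simp)))
  obtain ⟨c, d, hcd⟩ := Submodule.mem_span_pair.1 (hφ v (Submodule.subset_span (by simp)))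
  obtain ⟨p0, p1, p2⟩ := F.theta_phi x u
  obtain ⟨q0, q1, q2⟩ := F.theta_phi x v
  rw [← hab, map_add, map_smul (θ _ x), map_smul (θ _ x), smul_eq_mul, smul_eq_mul] at p0 p1 p2
  rw [← hcd, map_add, map_smul (θ _ x), map_smul (θ _ x), smul_eq_mul, smul_eq_mul] at q0 q1 q2
  have hlin : ∀ (s t : ℝ), s * θ 0 x u + t * θ 0 x v = 0 → s * θ 1 x u + t * θ 1 x v = 0 →
      s * θ 2 x u + t * θ 2 x v = 0 → s = 0 ∧ t = 0 := by
    intro s t h0 h1 h2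
    refine hpair s t (F.ext_three ?_ ?_ ?_) <;>
      rw [map_add, map_smul (θ _ x), map_smul (θ _ x), smul_eq_mul, smul_eq_mul, map_zero] <;>
      assumption
  have hhor : θ 0 x u = 0 ∧ θ 0 x v = 0 := by
    by_contra hne
    have hdet : a * d = b * c := by
      have h1 : (a * d - b * c) * θ 0 x u = 0 := by linear_combination d * p0 - b * q0
      have h2 : (a * d - b * c) * θ 0 x v = 0 := by linear_combination a * q0 - c * p0
      by_contra hd
      have hd' : a * d - b * c ≠ 0 := sub_ne_zero.2 hd
      exact hne ⟨(mul_eq_zero.1 h1).resolve_left hd', (mul_eq_zero.1 h2).resolve_left hd'⟩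
    obtain ⟨r1, r2, r3, r4⟩ := eq_zero_of_singular_rotation hdet p1 q1 p2 q2
    have := hlin (θ 0 x v) (-θ 0 x u) (by ring) (by rw [r1, r2]; ring) (by rw [r3, r4]; ring)
    exact hne ⟨by simpa using this.2, this.1⟩
  obtain ⟨u0, v0⟩ := hhor
  set u₁ := θ 1 x u with hu₁
  set u₂ := θ 2 x u with hu₂
  set v₁ := θ 1 x v with hv₁
  set v₂ := θ 2 x v with hv₂
  have hD : u₁ * v₂ - u₂ * v₁ ≠ 0 := by
    intro hD
    have h1 := hlin v₁ (-u₁) (by rw [u0, v0]; ring) (by ring) (by linear_combination -hD)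
    have h2 := hlin v₂ (-u₂) (by rw [u0, v0]; ring) (by linear_combination hD) (by ring)
    have h3 := hlin 1 0 (by rw [u0, v0]; ring) (by linarith [h1.2]) (by linarith [h2.2])
    exact one_ne_zero h3.1
  have hu : u = u₁ • V 1 x + u₂ • V 2 x := by
    have := F.expand x u
    rwa [Fin.sum_univ_three, u0, zero_smul, zero_add] at this
  have hv : v = v₁ • V 1 x + v₂ • V 2 x := by
    have := F.expand x v
    rwa [Fin.sum_univ_three, v0, zero_smul, zero_add] at this
  have hself : ∀ w z, curvature g.inner x w w z = 0 := fun w z ↦ by rw [curvature_eq, sub_self]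
  have hR : curvature g.inner x u v v = (u₁ * v₂ - u₂ * v₁) •
      (v₁ • ((-(4 - 3 / α)) • V 2 x) + v₂ • ((4 - 3 / α) • V 1 x)) := by
    have h1 : ∀ z, curvature g.inner x u v z =
        (u₁ * v₂ - u₂ * v₁) • curvature g.inner x (V 1 x) (V 2 x) z := by
      intro z
      rw [hu, hv, (curvature_smul_add g x u₁ u₂ _ _ _ z).1, (curvature_smul_add g x v₁ v₂ _ _ _ z).2.1,
        (curvature_smul_add g x v₁ v₂ _ _ _ z).2.1, hself, hself, curvature_swap g x (V 2 x) (V 1 x)]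
      module
    rw [h1 v]
    congr 1
    conv_lhs => rw [hv]
    rw [(curvature_smul_add g x v₁ v₂ _ _ _ _).2.2, (F.curvature_frame x).1, (F.curvature_frame x).2]
  have hnum : g.inner x (curvature g.inner x u v v) u =
      (u₁ * v₂ - u₂ * v₁) ^ 2 * (4 - 3 / α) * α⁻¹ := by
    rw [hR, F.metric, Fin.sum_univ_three, u0]
    simp only [map_add, map_smul, F.dual, smul_eq_mul, bergerLen, ← hu₁, ← hu₂]
    simp
    ring
  have hden : g.inner x u u * g.inner x v v - g.inner x u v ^ 2 =
      (u₁ * v₂ - u₂ * v₁) ^ 2 * α⁻¹ ^ 2 := by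
    rw [F.metric, F.metric, F.metric]
    simp only [Fin.sum_univ_three, u0, v0, bergerLen, ← hu₁, ← hu₂, ← hv₁, ← hv₂]
    simp
    ring
  rw [sectionalCurvature, hnum, hden]
  field_simp

theorem IsBergerFrame.isSasakianSpaceForm [CompactSpace M] [T2Space M] [SecondCountableTopology M]
    [ConnectedSpace M] (F : IsBergerFrame g α V θ) :
    IsSasakianSpaceForm g (fun y ↦ g.inner y (α • V 0 y)) (fun y ↦ α • V 0 y) (bergerPhi V θ)
      (4 * α - 3) where
  connected := inferInstance
  complete := isCompleteMetric_of_compact g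
  isSasaki := F.isSasaki
  holomorphic := F.sectionalCurvature_eq

end Berger

/-! ### Unit spheres and the differential of their inclusion. -/

section Sphere

/-- The unit sphere of dimension `n`. -/
abbrev Sph (n : ℕ) : Type := Metric.sphere (0 : Euc (n + 1)) 1

/-- The inclusion of the unit sphere. -/
def incl (n : ℕ) (x : Sph n) : Euc (n + 1) := x

lemma contMDiff_incl (n : ℕ) : ContMDiff 𝓘(ℝ, Euc n) 𝓘(ℝ, Euc (n + 1)) ∞ (incl n) :=
  have := Fact.mk (@finrank_euclideanSpace_fin ℝ _ (n + 1))
  contMDiff_coe_sphere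

/-- The differential of the inclusion of the unit sphere. -/
def dincl {n : ℕ} (x : Sph n) : Euc n →L[ℝ] Euc (n + 1) :=
  diffModel (E := Euc (n + 1)) (E' := Euc n) (incl n) x

lemma dincl_injective {n : ℕ} (x : Sph n) : Function.Injective (dincl x) :=
  have := Fact.mk (@finrank_euclideanSpace_fin ℝ _ (n + 1))
  injective_mvfderiv_subtypeVal_sphere x

lemma mem_range_dincl {n : ℕ} (x : Sph n) (w : Euc (n + 1)) :
    (∃ u, dincl x u = w) ↔ inner ℝ (incl n x) w = 0 := by
  have := Fact.mk (@finrank_euclideanSpace_fin ℝ _ (n + 1))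
  have h := range_mvfderiv_subtypeVal (n := n) x
  have h1 : (∃ u, dincl x u = w) ↔ w ∈ (ℝ ∙ (x : Euc (n + 1)))ᗮ := by
    rw [← h]
    rfl
  rw [h1, Submodule.mem_orthogonal_singleton_iff_inner_right]
  rfl

lemma inner_dincl {n : ℕ} (x : Sph n) (u : Euc n) : inner ℝ (incl n x) (dincl x u) = 0 :=
  (mem_range_dincl x _).1 ⟨u, rfl⟩

lemma norm_incl {n : ℕ} (x : Sph n) : ‖incl n x‖ = 1 := norm_eq_of_mem_sphere x

/-- The tangent vector to the sphere at `x` with image `w`. -/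
def tangentOf {n : ℕ} (x : Sph n) (w : Euc (n + 1)) : Euc n :=
  Function.invFun (dincl x) w

lemma dincl_tangentOf {n : ℕ} {x : Sph n} {w : Euc (n + 1)} (h : inner ℝ (incl n x) w = 0) :
    dincl x (tangentOf x w) = w :=
  Function.invFun_eq ((mem_range_dincl x w).2 h)

/-- Smooth maps into the ambient space with values in the sphere. -/
lemma contMDiff_codRestrict {n : ℕ} {E : Type*} [NormedAddCommGroup E] [NormedSpace ℝ E] {M : Type*}
    [TopologicalSpace M] [ChartedSpace E M] [IsManifold 𝓘(ℝ, E) ∞ M] {f : M → Sph n}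
    (hf : ContMDiff 𝓘(ℝ, E) 𝓘(ℝ, Euc (n + 1)) ∞ (fun y ↦ incl n (f y))) :
    ContMDiff 𝓘(ℝ, E) 𝓘(ℝ, Euc n) ∞ f :=
  have := Fact.mk (@finrank_euclideanSpace_fin ℝ _ (n + 1))
  ContMDiff.codRestrict_sphere hf (fun y ↦ (f y).2)

lemma dincl_diff {n : ℕ} {E : Type*} [NormedAddCommGroup E] [NormedSpace ℝ E] {M : Type*}
    [TopologicalSpace M] [ChartedSpace E M] [IsManifold 𝓘(ℝ, E) ∞ M] {f : M → Sph n} {x : M}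
    (hf : MDifferentiableAt 𝓘(ℝ, E) 𝓘(ℝ, Euc n) f x) (v : E) :
    dincl (f x) (diffModel (E := Euc n) (E' := E) f x v) =
      diffModel (E := Euc (n + 1)) (E' := E) (fun y ↦ incl n (f y)) x v :=
  (diffModel_comp ((contMDiff_incl n).mdifferentiable (by simp) _) hf v).symm

end Sphere

/-! ### Right multiplication by i, j, k on four-space. -/

section Quaternions

/-- Right multiplication by the imaginary unit quaternions. -/
def quat (i : Fin 3) : Euc 4 →L[ℝ] Euc 4 := LinearMap.toContinuousLinearMap
  { toFun := fun x ↦ ![!₂[-x 1, x 0, x 3, -x 2], !₂[-x 2, -x 3, x 0, x 1], !₂[-x 3, x 2, -x 1, x 0]] i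
    map_add' := fun x y ↦ by
      fin_cases i <;> ext j <;> fin_cases j <;> simp <;> ring
    map_smul' := fun c x ↦ by
      fin_cases i <;> ext j <;> fin_cases j <;> simp }

lemma quat_apply (i : Fin 3) (x : Euc 4) : quat i x =
    ![!₂[-x 1, x 0, x 3, -x 2], !₂[-x 2, -x 3, x 0, x 1], !₂[-x 3, x 2, -x 1, x 0]] i := rfl

lemma inner_four (x y : Euc 4) : inner ℝ x y = x 0 * y 0 + x 1 * y 1 + x 2 * y 2 + x 3 * y 3 := by
  simp [PiLp.inner_apply, Fin.sum_univ_four]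
  ring

lemma norm_sq_four (x : Euc 4) : ‖x‖ ^ 2 = x 0 ^ 2 + x 1 ^ 2 + x 2 ^ 2 + x 3 ^ 2 := by
  rw [← real_inner_self_eq_norm_sq, inner_four]
  ring

lemma inner_quat_self (i : Fin 3) (x : Euc 4) : inner ℝ x (quat i x) = 0 := by
  fin_cases i <;> simp [inner_four, quat_apply] <;> ring

lemma inner_quat_quat (i j : Fin 3) (x : Euc 4) :
    inner ℝ (quat i x) (quat j x) = if i = j then ‖x‖ ^ 2 else 0 := by
  rw [norm_sq_four, inner_four]
  fin_cases i <;> fin_cases j <;> simp [quat_apply] <;> ring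

lemma expand_quat (x w : Euc 4) :
    ‖x‖ ^ 2 • w = inner ℝ x w • x + ∑ i, inner ℝ (quat i x) w • quat i x := by
  rw [norm_sq_four]
  ext j
  fin_cases j <;> simp [inner_four, quat_apply, Fin.sum_univ_three] <;> ring

lemma quat_commutator (i j : Fin 3) (x : Euc 4) :
    quat j (quat i x) - quat i (quat j x) = ∑ k, (2 * eps i j k) • quat k x := by
  ext l
  fin_cases i <;> fin_cases j <;> fin_cases l <;>
    simp [quat_apply, Fin.sum_univ_three, eps] <;> ring

end Quaternions

/-! ### The left invariant frame and the Berger metrics of the three-sphere. -/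

section ThreeSphere

/-- The left invariant frame of the three-sphere. -/
def sphFrame (i : Fin 3) (x : Sph 3) : TangentSpace 𝓘(ℝ, Euc 3) x := tangentOf x (quat i (incl 3 x))

/-- The left invariant coframe of the three-sphere. -/
def sphCoframe (i : Fin 3) (x : Sph 3) : TangentSpace 𝓘(ℝ, Euc 3) x →L[ℝ] ℝ :=
  ((innerSL ℝ (quat i (incl 3 x))).comp (dincl x) : Euc 3 →L[ℝ] ℝ)

lemma dincl_sphFrame (i : Fin 3) (x : Sph 3) : dincl x (sphFrame i x) = quat i (incl 3 x) :=
  dincl_tangentOf (inner_quat_self i _)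

lemma sphCoframe_apply (i : Fin 3) (x : Sph 3) (u : TangentSpace 𝓘(ℝ, Euc 3) x) :
    sphCoframe i x u = inner ℝ (quat i (incl 3 x)) (dincl x u) := rfl

lemma sphCoframe_sphFrame (i j : Fin 3) (x : Sph 3) :
    sphCoframe i x (sphFrame j x) = if i = j then 1 else 0 := by
  rw [sphCoframe_apply, dincl_sphFrame, inner_quat_quat, norm_incl, one_pow]

lemma dincl_eq_sum (x : Sph 3) (u : TangentSpace 𝓘(ℝ, Euc 3) x) :
    dincl x u = ∑ i, sphCoframe i x u • quat i (incl 3 x) := by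
  have key : ∀ w, inner ℝ (incl 3 x) w = 0 →
      w = ∑ i, inner ℝ (quat i (incl 3 x)) w • quat i (incl 3 x) := by
    intro w hw
    have h := expand_quat (incl 3 x) w
    rwa [norm_incl, one_pow, one_smul, hw, zero_smul, zero_add] at h
  exact key _ (inner_dincl x u)

lemma sphFrame_expand (x : Sph 3) (u : TangentSpace 𝓘(ℝ, Euc 3) x) :
    u = ∑ i, sphCoframe i x u • sphFrame i x := by
  have key : ∀ (c : Fin 3 → ℝ) (v : Fin 3 → Euc 3),
      dincl x (∑ i, c i • v i) = ∑ i, c i • dincl x (v i) := by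
    intro c v; simp [map_sum]
  apply dincl_injective x
  rw [dincl_eq_sum x u]
  refine Eq.trans ?_ (key (fun i ↦ sphCoframe i x u) (fun i ↦ sphFrame i x)).symm
  exact Finset.sum_congr rfl fun i _ ↦ by rw [dincl_sphFrame]

lemma contMDiffAt_sphCoframe (i : Fin 3) {x : Sph 3} {W : ∀ x : Sph 3, TangentSpace 𝓘(ℝ, Euc 3) x}
    (hW : FieldSmoothAt (Euc 3) (fun y : Sph 3 ↦ y) W x) :
    ContMDiffAt 𝓘(ℝ, Euc 3) 𝓘(ℝ, ℝ) ∞ (fun y ↦ sphCoframe i y (W y)) x := by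
  have h1 := contMDiffAt_diffModel_apply (contMDiff_incl 3 x) hW
  have h2 : ContMDiffAt 𝓘(ℝ, Euc 3) 𝓘(ℝ, Euc 4) ∞ (fun y ↦ quat i (incl 3 y)) x :=
    (quat i).contDiff.contMDiff.contMDiffAt.comp x (contMDiff_incl 3 x)
  exact (contDiff_inner (𝕜 := ℝ) (E := Euc 4)).contMDiff.contMDiffAt.comp x (h2.prodMk_space h1)

/-- The orthonormal coframe of the Berger metric. -/
def bergerCoframe (α : ℝ) (x : Sph 3) : TangentSpace 𝓘(ℝ, Euc 3) x →L[ℝ] Euc 3 :=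
  ((EuclideanSpace.equiv (Fin 3) ℝ).symm : (Fin 3 → ℝ) →L[ℝ] Euc 3).comp
    (ContinuousLinearMap.pi fun i ↦ Real.sqrt (bergerLen α i) • sphCoframe i x)

lemma bergerCoframe_apply (α : ℝ) (x : Sph 3) (u : TangentSpace 𝓘(ℝ, Euc 3) x) (i : Fin 3) :
    bergerCoframe α x u i = Real.sqrt (bergerLen α i) * sphCoframe i x u := rfl

lemma bergerLen_pos {α : ℝ} (hα : 0 < α) (i : Fin 3) : 0 < bergerLen α i := by
  fin_cases i <;> simp [bergerLen] <;> positivity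

/-- The Berger metric of parameter `α` on the three-sphere. -/
def bergerMetric {α : ℝ} (hα : 0 < α) : RMetric (Euc 3) (Sph 3) :=
  pullMetric (bergerCoframe α)
    (fun x ↦ (injective_iff_map_eq_zero _).2 fun u hu ↦ by
      have h : ∀ i, sphCoframe i x u = 0 := fun i ↦ by
        have h1 : bergerCoframe α x u i = 0 := by rw [hu]; rfl
        rw [bergerCoframe_apply] at h1
        exact (mul_eq_zero.1 h1).resolve_left (Real.sqrt_pos.2 (bergerLen_pos hα i)).ne'
      rw [sphFrame_expand x u]
      simp [h])
    (fun q a ↦ by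
      refine ((EuclideanSpace.equiv (Fin 3) ℝ).symm : (Fin 3 → ℝ) →L[ℝ] Euc 3).contDiff.contMDiff.contMDiffAt.comp q ?_
      refine contMDiffAt_pi_space.2 fun i ↦ ?_
      exact contMDiffAt_const.mul (contMDiffAt_sphCoframe i
        (fieldSmoothAt_frameField q (mem_chart_source (Euc 3) q) a)))

lemma bergerMetric_apply {α : ℝ} (hα : 0 < α) (x : Sph 3) (u v : TangentSpace 𝓘(ℝ, Euc 3) x) :
    (bergerMetric hα).inner x u v =
      ∑ i, bergerLen α i * (sphCoframe i x u * sphCoframe i x v) := by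
  have h : (bergerMetric hα).inner x u v = inner ℝ (bergerCoframe α x u) (bergerCoframe α x v) := rfl
  rw [h, PiLp.inner_apply]
  refine Finset.sum_congr rfl fun i _ ↦ ?_
  have hs := Real.mul_self_sqrt (bergerLen_pos hα i).le
  rw [bergerCoframe_apply, bergerCoframe_apply, real_inner_eq_mul]
  linear_combination (sphCoframe i x u * sphCoframe i x v) * hs
where
  real_inner_eq_mul (a b : ℝ) : inner ℝ a b = a * b := by simp [mul_comm]

/-- `sphFrame` is given by a pointwise choice of preimages. Its smoothness is read off from products
with coordinate fields in the metric of parameter 1, which are values of the smooth coframe. -/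
lemma fieldSmoothAt_sphFrame (i : Fin 3) (x : Sph 3) :
    FieldSmoothAt (Euc 3) (fun y : Sph 3 ↦ y) (sphFrame i) x := by
  refine fieldSmoothAt_of_inner (bergerMetric one_pos) fun a ↦ ?_
  have h : ∀ y, (bergerMetric one_pos).inner y (sphFrame i y) (frameField x a y) =
      bergerLen 1 i * sphCoframe i y (frameField x a y) := by
    intro y
    rw [bergerMetric_apply]
    simp [sphCoframe_sphFrame]
  simp only [h]
  exact contMDiffAt_const.mul (contMDiffAt_sphCoframe i
    (fieldSmoothAt_frameField x (mem_chart_source (Euc 3) x) a))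

/-- Under the inclusion the frame fields become restrictions of the linear maps `quat i`, whose
commutators are known, and the differential of the inclusion is injective. -/
lemma mlieBracket_sphFrame (i j : Fin 3) (x : Sph 3) :
    VectorField.mlieBracket 𝓘(ℝ, Euc 3) (sphFrame i) (sphFrame j) x =
      ∑ k, (2 * eps i j k) • sphFrame k x := by
  have h := diffModel_mlieBracket ((contMDiff_incl 3 x).of_le (m := 2) (by norm_cast))
    (fieldSmoothAt_sphFrame i x).diffAt (fieldSmoothAt_sphFrame j x).diffAt
  have hd : ∀ i j : Fin 3, diffModel (E := Euc 4) (E' := Euc 3)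
      (fun y ↦ diffModel (E := Euc 4) (E' := Euc 3) (incl 3) y (sphFrame j y)) x (sphFrame i x) =
      quat j (quat i (incl 3 x)) := by
    intro i j
    have h1 : (fun y ↦ diffModel (E := Euc 4) (E' := Euc 3) (incl 3) y (sphFrame j y)) =
        fun y ↦ quat j (incl 3 y) := funext fun y ↦ dincl_sphFrame j y
    rw [h1]
    refine (diffModel_clm (quat j) ((contMDiff_incl 3).mdifferentiable (by simp) x) _).trans ?_
    exact congrArg (quat j) (dincl_sphFrame i x)
  rw [hd, hd, quat_commutator] at h
  have key : ∀ (c : Fin 3 → ℝ) (v : Fin 3 → Euc 3),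
      dincl x (∑ i, c i • v i) = ∑ i, c i • dincl x (v i) := by
    intro c v; simp [map_sum]
  apply dincl_injective x
  refine h.symm.trans (Eq.trans ?_ (key (fun k ↦ 2 * eps i j k) (fun k ↦ sphFrame k x)).symm)
  exact Finset.sum_congr rfl fun i _ ↦ by rw [dincl_sphFrame]

lemma isBergerFrame {α : ℝ} (hα : 0 < α) : IsBergerFrame (bergerMetric hα) α sphFrame sphCoframe where
  pos := hα
  smooth := fieldSmoothAt_sphFrame
  dual := sphCoframe_sphFrame
  expand := sphFrame_expand
  metric := bergerMetric_apply hα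
  bracket := mlieBracket_sphFrame

end ThreeSphere

/-! ### Algebraic identities for the quadratic map behind the Hopf fibration. -/

section HopfForm

/-- The polarisation of the Hopf map. -/
def hopfForm : Euc 4 →L[ℝ] Euc 4 →L[ℝ] Euc 3 := LinearMap.toContinuousBilinearMap <|
  LinearMap.mk₂ ℝ (fun x y : Euc 4 ↦ (!₂[x 0 * y 0 + x 1 * y 1 - x 2 * y 2 - x 3 * y 3,
      x 1 * y 2 + x 2 * y 1 + x 0 * y 3 + x 3 * y 0,
      x 1 * y 3 + x 3 * y 1 - x 0 * y 2 - x 2 * y 0] : Euc 3))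
    (fun x x' y ↦ by ext j; fin_cases j <;> simp <;> ring)
    (fun c x y ↦ by ext j; fin_cases j <;> simp <;> ring)
    (fun x y y' ↦ by ext j; fin_cases j <;> simp <;> ring)
    (fun c x y ↦ by ext j; fin_cases j <;> simp <;> ring)

lemma hopfForm_apply (x y : Euc 4) : hopfForm x y =
    !₂[x 0 * y 0 + x 1 * y 1 - x 2 * y 2 - x 3 * y 3,
      x 1 * y 2 + x 2 * y 1 + x 0 * y 3 + x 3 * y 0,
      x 1 * y 3 + x 3 * y 1 - x 0 * y 2 - x 2 * y 0] := rfl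

lemma hopfForm_symm (x y : Euc 4) : hopfForm x y = hopfForm y x := by
  rw [hopfForm_apply, hopfForm_apply]
  ext j
  fin_cases j <;> simp <;> ring

lemma inner_three (x y : Euc 3) : inner ℝ x y = x 0 * y 0 + x 1 * y 1 + x 2 * y 2 := by
  simp [PiLp.inner_apply, Fin.sum_univ_three]
  ring

lemma hopfForm_quat_zero (x : Euc 4) : hopfForm x (quat 0 x) = 0 := by
  rw [hopfForm_apply]
  ext j
  fin_cases j <;> simp [quat_apply] <;> ring

/-- Up to a factor 2 these vectors are the images of the horizontal frame fields under the Hopf map,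
which is therefore conformal on horizontal vectors. -/
lemma inner_hopfForm (x : Euc 4) :
    inner ℝ (hopfForm x (quat 1 x)) (hopfForm x (quat 1 x)) = (‖x‖ ^ 2) ^ 2 ∧
    inner ℝ (hopfForm x (quat 1 x)) (hopfForm x (quat 2 x)) = 0 ∧
    inner ℝ (hopfForm x (quat 2 x)) (hopfForm x (quat 2 x)) = (‖x‖ ^ 2) ^ 2 := by
  rw [norm_sq_four]
  simp only [inner_three, hopfForm_apply, quat_apply]
  refine ⟨?_, ?_, ?_⟩ <;> simp <;> ring

lemma norm_hopfForm (x : Euc 4) : ‖hopfForm x x‖ ^ 2 = (‖x‖ ^ 2) ^ 2 := by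
  rw [← real_inner_self_eq_norm_sq, norm_sq_four, inner_three, hopfForm_apply]
  simp
  ring

/-- This identity detects the fibres: for unit vectors with the same Hopf image the right-hand side
is 1 - 1, so y is orthogonal to `quat 1 x` and `quat 2 x`. -/
lemma inner_hopfForm_hopfForm (x y : Euc 4) :
    2 * (inner ℝ (quat 1 x) y ^ 2 + inner ℝ (quat 2 x) y ^ 2) =
      ‖x‖ ^ 2 * ‖y‖ ^ 2 - inner ℝ (hopfForm x x) (hopfForm y y) := by
  rw [norm_sq_four, norm_sq_four, inner_three, inner_four, inner_four]
  simp [hopfForm_apply, quat_apply]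
  ring

lemma quat_zero_sq (x : Euc 4) : quat 0 (quat 0 x) = -x := by
  ext j
  fin_cases j <;> simp [quat_apply]

lemma norm_combination (x : Euc 4) (hx : ‖x‖ = 1) (s t : ℝ) :
    ‖s • x + t • quat 0 x‖ ^ 2 = s ^ 2 + t ^ 2 := by
  have h : ‖s • x + t • quat 0 x‖ ^ 2 = (s ^ 2 + t ^ 2) * ‖x‖ ^ 2 := by
    rw [norm_sq_four, norm_sq_four]
    simp [quat_apply]
    ring
  rw [h, hx]
  ring

end HopfForm

/-! ### The Hopf map as a Riemannian submersion onto a round sphere. -/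

section HopfMap

/-- The Hopf map. -/
def hopfMap (x : Sph 3) : Sph 2 := ⟨hopfForm (incl 3 x) (incl 3 x), by
  have h := norm_hopfForm (incl 3 x)
  rw [norm_incl, one_pow, one_pow] at h
  rw [mem_sphere_zero_iff_norm]
  exact (pow_eq_one_iff_of_nonneg (norm_nonneg _) two_ne_zero).1 h⟩

lemma incl_hopfMap (x : Sph 3) : incl 2 (hopfMap x) = hopfForm (incl 3 x) (incl 3 x) := rfl

lemma contMDiff_hopfMap : ContMDiff 𝓘(ℝ, Euc 3) 𝓘(ℝ, Euc 2) ∞ hopfMap := by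
  refine contMDiff_codRestrict ?_
  simp only [incl_hopfMap]
  exact (hopfForm.contDiff.contMDiff.comp (contMDiff_incl 3)).clm_apply (contMDiff_incl 3)

lemma dincl_diff_hopfMap (x : Sph 3) (u : Euc 3) :
    dincl (hopfMap x) (diffModel (E := Euc 2) (E' := Euc 3) hopfMap x u) =
      (2 : ℝ) • hopfForm (incl 3 x) (dincl x u) := by
  have hd := (contMDiff_incl 3).mdifferentiable (by simp) x
  refine (dincl_diff (contMDiff_hopfMap.mdifferentiable (by simp) x) u).trans ?_
  refine (diffModel_bilin hopfForm hd hd u).trans ?_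
  rw [hopfForm_symm, two_smul]
  rfl

lemma dincl_diff_hopfMap_eq (x : Sph 3) (u : TangentSpace 𝓘(ℝ, Euc 3) x) :
    dincl (hopfMap x) (diffModel (E := Euc 2) (E' := Euc 3) hopfMap x u) =
      (2 * sphCoframe 1 x u) • hopfForm (incl 3 x) (quat 1 (incl 3 x)) +
      (2 * sphCoframe 2 x u) • hopfForm (incl 3 x) (quat 2 (incl 3 x)) := by
  refine (dincl_diff_hopfMap x u).trans ?_
  refine (congrArg (fun w ↦ (2 : ℝ) • hopfForm (incl 3 x) w) (dincl_eq_sum x u)).trans ?_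
  simp only [Fin.sum_univ_three, map_add, map_smul, hopfForm_quat_zero]
  module

/-- The base metric of the Hopf fibration of the Berger sphere. -/
def baseMetric {α : ℝ} (hα : 0 < α) : RMetric (Euc 2) (Sph 2) :=
  -- The Hopf map sends the frame fields V₁, V₂ to vectors of length 2, whereas their Berger length
  -- is 1/√α; this factor is the ratio.
  pullMetric (fun x ↦ ((2 * Real.sqrt α)⁻¹ • dincl x : Euc 2 →L[ℝ] Euc 3))
    (fun x ↦ by
      have h : (2 * Real.sqrt α)⁻¹ ≠ 0 := by positivity
      exact fun u v huv ↦ dincl_injective x (smul_right_injective _ h huv))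
    (fun q a ↦ ((2 * Real.sqrt α)⁻¹ • ContinuousLinearMap.id ℝ (Euc 3)).contDiff.contMDiff.contMDiffAt.comp q
      (contMDiffAt_diffModel_apply (contMDiff_incl 2 q)
        (fieldSmoothAt_frameField q (mem_chart_source (Euc 2) q) a)))

lemma baseMetric_apply {α : ℝ} (hα : 0 < α) (x : Sph 2) (u v : TangentSpace 𝓘(ℝ, Euc 2) x) :
    (baseMetric hα).inner x u v = (4 * α)⁻¹ * inner ℝ (dincl x u) (dincl x v) := by
  have h : (baseMetric hα).inner x u v =
    inner ℝ ((2 * Real.sqrt α)⁻¹ • dincl x u) ((2 * Real.sqrt α)⁻¹ • dincl x v) := rfl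
  have hs := Real.mul_self_sqrt hα.le
  have hs' : (2 * Real.sqrt α)⁻¹ * (2 * Real.sqrt α)⁻¹ = (4 * α)⁻¹ := by
    rw [← mul_inv]
    congr 1
    linear_combination 4 * hs
  rw [h, real_inner_smul_left, real_inner_smul_right, ← hs']
  ring

lemma baseMetric_diff {α : ℝ} (hα : 0 < α) (x : Sph 3) (u v : TangentSpace 𝓘(ℝ, Euc 3) x) :
    (baseMetric hα).inner (hopfMap x) (diff (E := Euc 2) (E' := Euc 3) hopfMap x u)
        (diff (E := Euc 2) (E' := Euc 3) hopfMap x v) =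
      α⁻¹ * (sphCoframe 1 x u * sphCoframe 1 x v + sphCoframe 2 x u * sphCoframe 2 x v) := by
  have h1 : ∀ u : TangentSpace 𝓘(ℝ, Euc 3) x, dincl (hopfMap x)
      (diff (E := Euc 2) (E' := Euc 3) hopfMap x u) = _ := dincl_diff_hopfMap_eq x
  rw [baseMetric_apply, h1, h1]
  obtain ⟨h11, h12, h22⟩ := inner_hopfForm (incl 3 x)
  have h21 := h12
  rw [real_inner_comm] at h21
  rw [norm_incl] at h11 h22
  simp only [inner_add_left, inner_add_right, real_inner_smul_left, real_inner_smul_right, h11, h12,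
    h21, h22]
  field_simp
  ring

/-- The kernel lies in the line of `sphFrame 0`, so the rank is at least 3 - 1. -/
lemma diff_hopfMap_surjective (x : Sph 3) :
    Function.Surjective (diff (E := Euc 2) (E' := Euc 3) hopfMap x) := by
  have key : ∀ (L : Euc 3 →ₗ[ℝ] Euc 2) (w : Euc 3), (∀ u, L u = 0 → ∃ c : ℝ, u = c • w) →
      Function.Surjective L := by
    intro L w h
    have h1 : LinearMap.ker L ≤ Submodule.span ℝ {w} := fun u hu ↦ by
      obtain ⟨c, rfl⟩ := h u hu
      exact Submodule.smul_mem _ _ (Submodule.mem_span_singleton_self w)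
    have h2 := (Submodule.finrank_mono h1).trans (finrank_span_le_card (R := ℝ) ({w} : Set (Euc 3)))
    have h3 := L.finrank_range_add_finrank_ker
    rw [Set.toFinset_singleton, Finset.card_singleton] at h2
    rw [finrank_euclideanSpace_fin] at h3
    have h4 := Submodule.finrank_le (LinearMap.range L)
    rw [finrank_euclideanSpace_fin] at h4
    rw [← LinearMap.range_eq_top]
    apply Submodule.eq_top_of_finrank_eq
    rw [finrank_euclideanSpace_fin]
    omega
  refine key (diffModel (E := Euc 2) (E' := Euc 3) hopfMap x : Euc 3 →ₗ[ℝ] Euc 2) (sphFrame 0 x) ?_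
  intro u hu
  have h1 := baseMetric_diff one_pos x u u
  have h2 : diff (E := Euc 2) (E' := Euc 3) hopfMap x u = 0 := hu
  rw [h2, map_zero, inv_one, one_mul] at h1
  have h3 : sphCoframe 1 x u * sphCoframe 1 x u + sphCoframe 2 x u * sphCoframe 2 x u = 0 := h1.symm
  have h4 : sphCoframe 1 x u = 0 := by nlinarith [mul_self_nonneg (sphCoframe 2 x u)]
  have h5 : sphCoframe 2 x u = 0 := by nlinarith [mul_self_nonneg (sphCoframe 1 x u)]
  refine ⟨sphCoframe 0 x u, ?_⟩
  have h6 := sphFrame_expand x u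
  rw [Fin.sum_univ_three, h4, h5, zero_smul, zero_smul, add_zero, add_zero] at h6
  exact h6

lemma hopfMap_surjective : Function.Surjective hopfMap := by
  intro y
  have hy : (incl 2 y) 0 ^ 2 + (incl 2 y) 1 ^ 2 + (incl 2 y) 2 ^ 2 = 1 := by
    have h := real_inner_self_eq_norm_sq (incl 2 y)
    rw [norm_incl, inner_three] at h
    linarith
  set p := (incl 2 y) 0 with hp
  set q := (incl 2 y) 1 with hq
  set r := (incl 2 y) 2 with hr
  -- The preimage is sought with vanishing second coordinate, which can be arranged by moving along
  -- a fibre.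
  have key : ∀ a c d : ℝ, a ^ 2 + c ^ 2 + d ^ 2 = 1 → a ^ 2 - c ^ 2 - d ^ 2 = p → 2 * a * d = q →
      -(2 * a * c) = r → ∃ x, hopfMap x = y := by
    intro a c d h1 h2 h3 h4
    have hx : ‖(!₂[a, 0, c, d] : Euc 4)‖ ^ 2 = 1 := by
      rw [norm_sq_four]
      simp
      exact h1
    have hx' : (!₂[a, 0, c, d] : Euc 4) ∈ Metric.sphere (0 : Euc 4) 1 := by
      rw [mem_sphere_zero_iff_norm]
      exact (pow_eq_one_iff_of_nonneg (norm_nonneg _) two_ne_zero).1 hx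
    refine ⟨⟨_, hx'⟩, Subtype.ext ?_⟩
    change hopfForm (!₂[a, 0, c, d] : Euc 4) (!₂[a, 0, c, d] : Euc 4) = incl 2 y
    rw [hopfForm_apply]
    ext j
    fin_cases j
    · simp
      rw [← hp, ← h2]; ring
    · simp
      rw [← hq, ← h3]; ring
    · simp
      rw [← hr, ← h4]; ring
  -- The equations force a² = (1 + p)/2. Off the pole p = -1 the other coordinates follow by
  -- dividing by 2a; at the pole a = 0 and any unit (c, d) will do.
  by_cases h0 : 1 + p = 0
  · have hq0 : q = 0 := by nlinarith
    have hr0 : r = 0 := by nlinarith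
    exact key 0 1 0 (by ring) (by linarith) (by linarith) (by linarith)
  · have hpos : 0 < 1 + p := lt_of_le_of_ne (by nlinarith) (Ne.symm h0)
    set a := Real.sqrt ((1 + p) / 2) with ha
    have ha2 : a ^ 2 = (1 + p) / 2 := Real.sq_sqrt (by positivity)
    have ha0 : a ≠ 0 := (Real.sqrt_pos.2 (by positivity)).ne'
    have hcd : (-r / (2 * a)) ^ 2 + (q / (2 * a)) ^ 2 = (1 - p) / 2 := by
      rw [div_pow, div_pow, mul_pow, ha2]
      field_simp
      linarith
    refine key a (-r / (2 * a)) (q / (2 * a)) (by linarith) (by linarith) ?_ ?_ <;> field_simp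

end HopfMap

/-! ### The fibres of the Hopf map are the Reeb orbits. -/

section HopfFibres

lemma sphere_differentiableAt {γ : ℝ → Sph 3} {t : ℝ} {v : TangentSpace 𝓘(ℝ, Euc 3) (γ t)}
    (h : HasMFDerivAt 𝓘(ℝ, ℝ) 𝓘(ℝ, Euc 3) γ t ((1 : ℝ →L[ℝ] ℝ).smulRight v)) :
    diffModel (E := Euc 3) (E' := ℝ) γ t 1 = v := by
  have h1 := DFunLike.congr_fun h.mfderiv (1 : ℝ)
  refine h1.trans ?_
  have key : ∀ w : Euc 3, ((1 : ℝ →L[ℝ] ℝ).smulRight w) 1 = w := fun w ↦ by simp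
  exact key _

/-- The great circle through `x` in the direction of the Reeb field. -/
def reebCircle (α : ℝ) (x : Sph 3) (t : ℝ) : Sph 3 :=
  ⟨Real.cos (α * t) • incl 3 x + Real.sin (α * t) • quat 0 (incl 3 x), by
    rw [mem_sphere_zero_iff_norm]
    refine (pow_eq_one_iff_of_nonneg (norm_nonneg _) two_ne_zero).1 ?_
    rw [norm_combination _ (norm_incl x), Real.cos_sq_add_sin_sq]⟩

lemma isMIntegralCurve_reebCircle (α : ℝ) (x : Sph 3) :
    IsMIntegralCurve (I := 𝓘(ℝ, Euc 3)) (reebCircle α x) (fun y ↦ α • sphFrame 0 y) := by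
  intro t
  set f : ℝ → Euc 4 :=
    fun t ↦ Real.cos (α * t) • incl 3 x + Real.sin (α * t) • quat 0 (incl 3 x) with hf
  have hs : ContMDiff 𝓘(ℝ, ℝ) 𝓘(ℝ, Euc 3) ∞ (reebCircle α x) := by
    refine contMDiff_codRestrict ?_
    have : ContDiff ℝ ∞ f := by
      rw [hf]
      fun_prop
    exact this.contMDiff
  have hd : MDifferentiableAt 𝓘(ℝ, ℝ) 𝓘(ℝ, Euc 3) (reebCircle α x) t :=
    hs.mdifferentiable (by simp) t
  have h1 : HasDerivAt f (α • quat 0 (f t)) t := by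
    have hl : HasDerivAt (fun t : ℝ ↦ α * t) α t := by
      simpa using (hasDerivAt_id t).const_mul α
    have h := ((hl.cos).smul_const (incl 3 x)).add ((hl.sin).smul_const (quat 0 (incl 3 x)))
    refine h.congr_deriv ?_
    rw [hf]
    simp only [map_add, map_smul, quat_zero_sq]
    module
  have h2 : diffModel (E := Euc 3) (E' := ℝ) (reebCircle α x) t 1 =
      α • sphFrame 0 (reebCircle α x t) := by
    apply dincl_injective (reebCircle α x t)
    refine (dincl_diff hd 1).trans ?_
    have h3 : diffModel (E := Euc 4) (E' := ℝ) (fun y ↦ incl 3 (reebCircle α x y)) t 1 =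
        α • quat 0 (f t) := by
      rw [diffModel_eq_fderiv]
      exact h1.deriv
    rw [h3]
    refine Eq.trans ?_ (map_smul (dincl (reebCircle α x t)) α (sphFrame 0 (reebCircle α x t) : Euc 3)).symm
    exact congrArg (α • ·) (dincl_sphFrame 0 (reebCircle α x t)).symm
  have h4 := hd.hasMFDerivAt
  have key : ∀ (L : ℝ →L[ℝ] Euc 3) (w : Euc 3), L 1 = w → L = (1 : ℝ →L[ℝ] ℝ).smulRight w := by
    intro L w h
    ext1
    simpa using h
  have h5 : mfderiv 𝓘(ℝ, ℝ) 𝓘(ℝ, Euc 3) (reebCircle α x) t = _ := key _ _ h2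
  rw [h5] at h4
  exact h4

/-- Along an integral curve the derivative of the quadratic map is a multiple of `hopfForm x (quat 0
x)`, which is zero. -/
lemma hopfMap_integralCurve {α : ℝ} {γ : ℝ → Sph 3}
    (h : IsMIntegralCurve (I := 𝓘(ℝ, Euc 3)) γ (fun y ↦ α • sphFrame 0 y)) (t : ℝ) :
    hopfMap (γ t) = hopfMap (γ 0) := by
  have hd : ∀ s, MDifferentiableAt 𝓘(ℝ, ℝ) 𝓘(ℝ, Euc 3) γ s := fun s ↦ (h s).mdifferentiableAt
  have hdi : ∀ s, MDifferentiableAt 𝓘(ℝ, ℝ) 𝓘(ℝ, Euc 4) (fun s ↦ incl 3 (γ s)) s := fun s ↦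
    MDifferentiableAt.comp s ((contMDiff_incl 3).mdifferentiable (by simp) _) (hd s)
  have hc : ∀ s, diffModel (E := Euc 4) (E' := ℝ) (fun s ↦ incl 3 (γ s)) s 1 =
      α • quat 0 (incl 3 (γ s)) := by
    intro s
    refine (dincl_diff (hd s) 1).symm.trans ?_
    refine (congrArg (dincl (γ s)) (sphere_differentiableAt (h s))).trans ?_
    refine (map_smul (dincl (γ s)) α (sphFrame 0 (γ s) : Euc 3)).trans ?_
    exact congrArg (α • ·) (dincl_sphFrame 0 (γ s))
  have hz : ∀ s, deriv (fun s ↦ hopfForm (incl 3 (γ s)) (incl 3 (γ s))) s = 0 := by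
    intro s
    have h1 := diffModel_bilin hopfForm (hdi s) (hdi s) 1
    rw [hc, hopfForm_symm (α • _), map_smul, hopfForm_quat_zero, smul_zero, add_zero] at h1
    rw [diffModel_eq_fderiv] at h1
    exact h1
  have hdiff : Differentiable ℝ (fun s ↦ hopfForm (incl 3 (γ s)) (incl 3 (γ s))) := fun s ↦
    (mdifferentiableAt_bilin hopfForm (hdi s) (hdi s)).differentiableAt
  exact Subtype.ext (is_const_of_deriv_eq_zero hdiff hz t 0)

/-- If the images agree, y has no component along `quat 1 x` and `quat 2 x`, so y = sx + r `quat 0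
x` with s² + r² = 1. The time at which the circle reaches y is the argument of s + ir divided by α.
-/
lemma exists_reebCircle {α : ℝ} (hα : 0 < α) {x y : Sph 3} (h : hopfMap x = hopfMap y) :
    reebCircle α x 0 = x ∧ ∃ t, reebCircle α x t = y := by
  constructor
  · apply Subtype.ext
    change Real.cos (α * 0) • incl 3 x + Real.sin (α * 0) • quat 0 (incl 3 x) = incl 3 x
    simp
  have h1 := inner_hopfForm_hopfForm (incl 3 x) (incl 3 y)
  have h2 : hopfForm (incl 3 x) (incl 3 x) = hopfForm (incl 3 y) (incl 3 y) := congrArg (incl 2) h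
  rw [h2, real_inner_self_eq_norm_sq, norm_hopfForm, norm_incl, norm_incl] at h1
  have h3 : inner ℝ (quat 1 (incl 3 x)) (incl 3 y) = 0 := by
    nlinarith [sq_nonneg (inner ℝ (quat 1 (incl 3 x)) (incl 3 y)),
      sq_nonneg (inner ℝ (quat 2 (incl 3 x)) (incl 3 y))]
  have h4 : inner ℝ (quat 2 (incl 3 x)) (incl 3 y) = 0 := by
    nlinarith [sq_nonneg (inner ℝ (quat 1 (incl 3 x)) (incl 3 y)),
      sq_nonneg (inner ℝ (quat 2 (incl 3 x)) (incl 3 y))]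
  have h5 := expand_quat (incl 3 x) (incl 3 y)
  rw [norm_incl, one_pow, one_smul, Fin.sum_univ_three, h3, h4, zero_smul, zero_smul, add_zero,
    add_zero] at h5
  set s := inner ℝ (incl 3 x) (incl 3 y)
  set r := inner ℝ (quat 0 (incl 3 x)) (incl 3 y)
  have h6 : s ^ 2 + r ^ 2 = 1 := by
    rw [← norm_combination _ (norm_incl x), ← h5, norm_incl, one_pow]
  have hz : ‖(⟨s, r⟩ : ℂ)‖ = 1 := by
    rw [← pow_eq_one_iff_of_nonneg (norm_nonneg _) two_ne_zero, Complex.sq_norm, Complex.normSq_mk]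
    linarith
  have hz0 : (⟨s, r⟩ : ℂ) ≠ 0 := by
    intro h0
    rw [h0, norm_zero] at hz
    exact zero_ne_one hz
  refine ⟨Complex.arg ⟨s, r⟩ / α, Subtype.ext ?_⟩
  change Real.cos (α * (Complex.arg ⟨s, r⟩ / α)) • incl 3 x +
    Real.sin (α * (Complex.arg ⟨s, r⟩ / α)) • quat 0 (incl 3 x) = incl 3 y
  rw [mul_div_cancel₀ _ hα.ne', Complex.cos_arg hz0, Complex.sin_arg, hz, div_one, div_one]
  exact h5.symm

/-- The Hopf fibration of the Berger sphere is its Boothby-Wang fibration. -/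
theorem isBoothbyWang_hopfMap {α : ℝ} (hα : 0 < α) :
    IsBoothbyWang (bergerMetric hα) (fun y ↦ (bergerMetric hα).inner y (α • sphFrame 0 y))
      (fun y ↦ α • sphFrame 0 y) (baseMetric hα) hopfMap where
  smooth := contMDiff_hopfMap
  surjective := hopfMap_surjective
  submersion := diff_hopfMap_surjective
  fibre p q := by
    constructor
    · intro h
      obtain ⟨h0, ht⟩ := exists_reebCircle hα h
      exact ⟨_, isMIntegralCurve_reebCircle α p, h0, ht⟩
    · rintro ⟨γ, hγ, rfl, t, rfl⟩
      exact (hopfMap_integralCurve hγ t).symm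
  isometric x u v hu hv := by
    have F := isBergerFrame hα
    have h0 : sphCoframe 0 x u = 0 := by
      rw [F.eta_eq] at hu
      exact (mul_eq_zero.1 hu).resolve_left (inv_ne_zero hα.ne')
    rw [baseMetric_diff, bergerMetric_apply, Fin.sum_univ_three, h0]
    simp [bergerLen]
    ring

end HopfFibres

instance connectedSpace_sph_three : ConnectedSpace (Sph 3) :=
  isConnected_iff_connectedSpace.1 <| isConnected_sphere (by
    rw [← Module.finrank_eq_rank, finrank_euclideanSpace_fin]
    norm_num) _ zero_le_one

/-- The Berger spheres are regular Sasakian space forms. -/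
theorem isSasakianSpaceForm_berger {α : ℝ} (hα : 0 < α) :
    IsSasakianSpaceForm (bergerMetric hα) (fun y ↦ (bergerMetric hα).inner y (α • sphFrame 0 y))
      (fun y ↦ α • sphFrame 0 y) (bergerPhi sphFrame sphCoframe) (4 * α - 3) :=
  (isBergerFrame hα).isSasakianSpaceForm

end HopfCyl

end

open HopfCyl Manifold in
open scoped ContDiff in
theorem mainTheorem2 (c : ℝ) :
    (∀ (M : Type*) [TopologicalSpace M] [T2Space M] [SecondCountableTopology M]
        [ChartedSpace (Euc 3) M] [IsManifold 𝓘(ℝ, Euc 3) ∞ M]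
        (B : Type*) [TopologicalSpace B] [T2Space B] [SecondCountableTopology B]
        [ChartedSpace (Euc 2) B] [IsManifold 𝓘(ℝ, Euc 2) ∞ B]
        (g : RMetric (Euc 3) M)
        (η : ∀ x : M, TangentSpace 𝓘(ℝ, Euc 3) x →L[ℝ] ℝ)
        (ξ : ∀ x : M, TangentSpace 𝓘(ℝ, Euc 3) x)
        (φ : ∀ x : M, TangentSpace 𝓘(ℝ, Euc 3) x →L[ℝ] TangentSpace 𝓘(ℝ, Euc 3) x)
        (gB : RMetric (Euc 2) B) (pr : M → B),
        IsSasakianSpaceForm g η ξ φ c → IsBoothbyWang g η ξ gB pr →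
        (∀ (γ : ℝ → B) (J : Set ℝ), IsUnitSpeedCurve gB γ J → IsPolyharmonicHopf g pr γ J →
          (c ≤ 1 → IsGeodesic gB γ J) ∧
          (1 < c → IsGeodesic gB γ J ∨ IsRiemannianCircle gB γ J (Real.sqrt (c - 1)))) ∧
        (1 < c → HasProperPolyharmonicHopf g gB pr)) ∧
    (1 < c →
      ∃ (M : Type) (_ : TopologicalSpace M) (_ : T2Space M) (_ : SecondCountableTopology M)
        (_ : ChartedSpace (Euc 3) M) (_ : IsManifold 𝓘(ℝ, Euc 3) ∞ M)
        (B : Type) (_ : TopologicalSpace B) (_ : T2Space B) (_ : SecondCountableTopology B)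
        (_ : ChartedSpace (Euc 2) B) (_ : IsManifold 𝓘(ℝ, Euc 2) ∞ B)
        (g : RMetric (Euc 3) M)
        (η : ∀ x : M, TangentSpace 𝓘(ℝ, Euc 3) x →L[ℝ] ℝ)
        (ξ : ∀ x : M, TangentSpace 𝓘(ℝ, Euc 3) x)
        (φ : ∀ x : M, TangentSpace 𝓘(ℝ, Euc 3) x →L[ℝ] TangentSpace 𝓘(ℝ, Euc 3) x)
        (gB : RMetric (Euc 2) B) (pr : M → B),
        IsSasakianSpaceForm g η ξ φ c ∧ IsBoothbyWang g η ξ gB pr ∧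
        HasProperPolyharmonicHopf g gB pr) := by
  refine ⟨?_, fun hc ↦ ?_⟩
  · intro M _ _ _ _ _ B _ _ _ _ _ g η ξ φ gB pr S b
    exact ⟨fun γ J hγ h ↦ curve_of_polyharmonic b S hγ h, fun hc ↦ exists_polyharmonicHopf b S hc⟩
  -- The parameter is the solution of 4α - 3 = c.
  · have hα : 0 < (c + 3) / 4 := by linarith
    have S := isSasakianSpaceForm_berger hα
    have b := isBoothbyWang_hopfMap hα
    rw [show 4 * ((c + 3) / 4) - 3 = c by ring] at S
    exact ⟨Sph 3, inferInstance, inferInstance, inferInstance, inferInstance, inferInstance,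
      Sph 2, inferInstance, inferInstance, inferInstance, inferInstance, inferInstance,
      bergerMetric hα, _, _, _, baseMetric hα, hopfMap, S, b, exists_polyharmonicHopf b S hc⟩
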